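/- Let $n\ge 1$, write $y=(y',y_n)\in\mathbb R^n$, and let $\mathbb B^+_{1/2}=\{y\in\mathbb R^n : |y|<1/2,\ y_n>0\}$ with boundary $\partial\mathbb B^+_{1/2}$ (the flat part $\{|y'|\le 1/2,\ y_n=0\}$ together with the spherical cap $\{|y|=1/2,\ y_n\ge 0\}$), equipped with surface measure. For $s>0$ put $$\psi(y)=e^{s h(y)},\qquad h(y)=-\frac{|y'|^2}{4}+\frac{y_n^2}{2}-y_n .$$ Let $\theta,M>0$. There is $s_0>0$, depending only on $n,\theta,M$, such that for every $s\ge s_0$ and all $K,\delta>0$ there are constants $C_s>0$ and $C_0>0$, depending only on $n,\theta,M,K,\delta,s$, with the following property. Let $\alpha,\lambda\in\mathbb R$ with $|\alpha|\ge\delta$ or $|\lambda|\ge\delta$. Let $a_{ij}\in C^1(\mathbb B^+_{1/2})$ satisfy $|a_{ij}|\le M$, $|D_k a_{ij}|\le M$ and $\sum_{i,j}a_{ij}(y)\xi_i\xi_j\ge\theta|\xi|^2$ for all $y\in\mathbb B^+_{1/2}$, $\xi\in\mathbb R^n$, and let $b=(b_1,\dots,b_n)$ and $c$ satisfy $$\|b_i\|_{W^{1,\infty}(\mathbb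 B^+_{1/2})}\le K(|\alpha|+1)\quad(1\le i\le n),\qquad \|c\|_{W^{1,\infty}(\mathbb B^+_{1/2})}\le K(\alpha^2+|\lambda|),$$ where $\|f\|_{W^{1,\infty}}$ is the largest of the $L^\infty$ norms of $f$ and of its first weak derivatives. Then for every real-valued $v\in C^\infty(\overline{\mathbb B^+_{1/2}})$ and every $$\tau> C_s\big(|\alpha|+\sqrt{|\lambda|}\big)$$ one has \begin{align*} \Big\|e^{\tau\psi}\Big(-\sum_{i,j}a_{ij}D_{ij}v+\sum_i b_iD_iv+cv\Big)\Big\|_{L^2(\mathbb B^+_{1/2})} &+\tau^{3/2}s^2\big\|\psi^{3/2}e^{\tau\psi}v\big\|_{L^2(\partial\mathbb B^+_{1/2})} +\tau^{1/2}s\,\big\|\psi^{1/2}e^{\tau\psi}\nabla v\big\|_{L^2(\partial\mathbb B^+_{1/2})}\\ &\ge C_0\tau^{3/2}s^2\big\|\psi^{3/2}e^{\tau\psi}v\big\|_{L^2(\mathbb B^+_{1/2})} +C_0\tau^{1/2}s\,\big\|\psi^{1/2}e^{\tau\psi}\nabla v\big\|_{L^2(\mathbb B^+_{1/2})}. \end{align*}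 -/

import Mathlib

open MeasureTheory
open scoped ENNReal ContDiff

noncomputable section

namespace HalfBallCarleman

/-- The space `ℝⁿ` with `n = d + 1`; a point is `y = (y', yₙ)`, where `yₙ` is the last coordinate. -/
abbrev E (d : ℕ) : Type := EuclideanSpace ℝ (Fin (d + 1))

/-- The open half ball `{|y| < 1/2, yₙ > 0}`. -/
def halfBall (d : ℕ) : Set (E d) := {y | ‖y‖ < 1 / 2 ∧ 0 < y (Fin.last d)}

/-- The closed half ball `{|y| ≤ 1/2, yₙ ≥ 0}`. -/
def closedHalfBall (d : ℕ) : Set (E d) := {y | ‖y‖ ≤ 1 / 2 ∧ 0 ≤ y (Fin.last d)}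

/-- The inclusion `y' ↦ (y', 0)` of `ℝⁿ⁻¹` into `ℝⁿ`. -/
def flatEmbed (d : ℕ) (z : EuclideanSpace ℝ (Fin d)) : E d :=
  WithLp.toLp 2 (Fin.snoc (α := fun _ => ℝ) (fun i => z i) 0)

/-- The surface measure of the boundary of the half ball: `(n-1)`-dimensional Lebesgue measure on
the flat part `{|y'| < 1/2, yₙ = 0}`, plus the surface measure of the sphere of radius `1/2` (the
image of the one of the unit sphere under `p ↦ p / 2`, with factor `(1/2)ⁿ⁻¹`) on the part of it
with `yₙ > 0`. The edge where the two pieces meet is a null set. -/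
def boundaryMeasure (d : ℕ) : Measure (E d) :=
  Measure.map (flatEmbed d) (volume.restrict (Metric.ball 0 (1 / 2))) +
    ENNReal.ofReal ((1 / 2 : ℝ) ^ d) •
      Measure.map (fun (p : Metric.sphere (0 : E d) 1) => (1 / 2 : ℝ) • (p : E d))
        ((volume : Measure (E d)).toSphere.restrict {p | 0 < (p : E d) (Fin.last d)})

/-- The partial derivative `D_i f` relative to a set `S`; at interior points of `S` it is the usual
one, and on the boundary of the closed half ball it is the one-sided (continuous) extension if `f`
is smooth up to the boundary. -/
def partialWithin {d : ℕ} (S : Set (E d)) (i : Fin (d + 1)) (f : E d → ℝ) (y : E d) : ℝ :=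
  fderivWithin ℝ f S y (EuclideanSpace.single i 1)

/-- The function `h(y) = -|y'|²/4 + yₙ²/2 - yₙ`. -/
def h {d : ℕ} (y : E d) : ℝ :=
  -(∑ i : Fin d, y (Fin.castSucc i) ^ 2) / 4 + y (Fin.last d) ^ 2 / 2 - y (Fin.last d)

/-- The weight `ψ = e^{s h}`. -/
def psi {d : ℕ} (s : ℝ) (y : E d) : ℝ := Real.exp (s * h y)

/-- The operator `-a_{ij} D_{ij} v + b_i D_i v + c v` applied to a function `v` on the closed
half ball. -/
def ellipticOp {d : ℕ} (a : Fin (d + 1) → Fin (d + 1) → E d → ℝ) (b : Fin (d + 1) → E d → ℝ)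
    (c : E d → ℝ) (v : E d → ℝ) (y : E d) : ℝ :=
  -(∑ i, ∑ j, a i j y *
      partialWithin (closedHalfBall d) i (partialWithin (closedHalfBall d) j v) y) +
    ∑ i, b i y * partialWithin (closedHalfBall d) i v y + c y * v y

/-- `a_{ij} ∈ C¹(S)` with `C¹` norm (largest of the sup norms of the entries and of their first
derivatives) at most `M`. -/
def C1NormLE {d : ℕ} (S : Set (E d)) (a : Fin (d + 1) → Fin (d + 1) → E d → ℝ) (M : ℝ) : Prop :=
  ∀ i j, ContDiffOn ℝ 1 (a i j) S ∧
    ∀ y ∈ S, |a i j y| ≤ M ∧ ∀ k, |partialWithin S k (a i j) y| ≤ M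

/-- Uniform ellipticity on `S` with constant `θ`. -/
def UniformlyElliptic {d : ℕ} (S : Set (E d)) (a : Fin (d + 1) → Fin (d + 1) → E d → ℝ)
    (θ : ℝ) : Prop :=
  ∀ y ∈ S, ∀ ξ : E d, θ * ‖ξ‖ ^ 2 ≤ ∑ i, ∑ j, a i j y * ξ i * ξ j

/-- `g` is the weak derivative `D_i f` on the open set `U`. -/
def IsWeakPartial {d : ℕ} (U : Set (E d)) (i : Fin (d + 1)) (f g : E d → ℝ) : Prop :=
  ∀ φ : E d → ℝ, ContDiff ℝ ∞ φ → HasCompactSupport φ → tsupport φ ⊆ U →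
    ∫ y in U, f y * fderiv ℝ φ y (EuclideanSpace.single i 1) = -∫ y in U, g y * φ y

/-- `f ∈ W^{1,∞}(U)` with norm (largest of the `L^∞` norms of `f` and of its weak first
derivatives) at most `K`. -/
def W1InftyNormLE {d : ℕ} (U : Set (E d)) (f : E d → ℝ) (K : ℝ) : Prop :=
  AEStronglyMeasurable f (volume.restrict U) ∧
  eLpNorm f ∞ (volume.restrict U) ≤ ENNReal.ofReal K ∧
  ∀ i, ∃ g : E d → ℝ, AEStronglyMeasurable g (volume.restrict U) ∧
    eLpNorm g ∞ (volume.restrict U) ≤ ENNReal.ofReal K ∧ IsWeakPartial U i f g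

end HalfBallCarleman

end

/-! Conjugation by `e^{τψ}` turns the operator into `S + T + R`, where `S w = -div (a∇w) - V w`,
`T w = B · ∇w + g w` is a first-order multiplier and `R` is a small remainder, and pointwise
`(S w + T w + R w)² ≥ 2 (S w) (T w) - (R w)²`. The product `(S w) (T w)` is a divergence plus a
quadratic form in `(w, ∇w)`. For large `s` the exponential weight `ψ = e^{s h}` and the choice of
`g` make this form dominate `σ |∇w|² + σ³ w²` with `σ = τ s ψ`; the condition
`τ > C_s (|α| + √|λ|)` makes `b` and `c` subordinate to `σ`. Integrated against a cutoff, the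
divergence is at most the same energy density weighted by the gradient of the cutoff, which tends
to the boundary integrals as the cutoff tends to one. The `W^{1,∞}` coefficients `b` and `c` are
mollified first, since only their bounds enter. -/

noncomputable section

namespace HalfBallCarleman

section PartialDerivatives

variable {ι κ : Type*} [DecidableEq ι] {k l : ι} {f g : EuclideanSpace ℝ ι → ℝ}
  {f' g' : ℝ} {y : EuclideanSpace ℝ ι}

/-- The partial derivative `∂ₖ f`. It is a line derivative, so that it can be computed without
differentiability side conditions. -/
def pd (k : ι) (f : EuclideanSpace ℝ ι → ℝ) (y : EuclideanSpace ℝ ι) : ℝ :=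
  lineDeriv ℝ f y (EuclideanSpace.single k 1)

/-- `f` has the `k`-th partial derivative `f'` at `y`. -/
def HasPD (k : ι) (f : EuclideanSpace ℝ ι → ℝ) (f' : ℝ) (y : EuclideanSpace ℝ ι) : Prop :=
  HasLineDerivAt ℝ f f' y (EuclideanSpace.single k 1)

namespace HasPD

theorem pd_eq (hf : HasPD k f f' y) : pd k f y = f' :=
  HasLineDerivAt.lineDeriv hf

theorem congr_deriv (hf : HasPD k f f' y) (h : f' = g') : HasPD k f g' y := h ▸ hf

theorem mul (hf : HasPD k f f' y) (hg : HasPD k g g' y) :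
    HasPD k (fun z => f z * g z) (f' * g y + f y * g') y := by
  have := HasDerivAt.fun_mul hf hg
  simp only [zero_smul, add_zero] at this
  exact this

theorem add (hf : HasPD k f f' y) (hg : HasPD k g g' y) :
    HasPD k (fun z => f z + g z) (f' + g') y :=
  HasDerivAt.fun_add hf hg

theorem sub (hf : HasPD k f f' y) (hg : HasPD k g g' y) :
    HasPD k (fun z => f z - g z) (f' - g') y :=
  HasDerivAt.fun_sub hf hg

theorem sum [Fintype κ] {f : κ → EuclideanSpace ℝ ι → ℝ} {f' : κ → ℝ}
    (hf : ∀ i, HasPD k (f i) (f' i) y) : HasPD k (fun z => ∑ i, f i z) (∑ i, f' i) y :=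
  HasDerivAt.fun_sum fun i _ => hf i

theorem const_mul (c : ℝ) (hf : HasPD k f f' y) : HasPD k (fun z => c * f z) (c * f') y :=
  HasDerivAt.const_mul c hf

theorem const (c : ℝ) (k : ι) (y : EuclideanSpace ℝ ι) : HasPD k (fun _ => c) 0 y :=
  hasDerivAt_const 0 c

theorem comp {φ : ℝ → ℝ} {φ' : ℝ} (hf : HasPD k f f' y) (hφ : HasDerivAt φ φ' (f y)) :
    HasPD k (fun z => φ (f z)) (φ' * f') y :=
  HasDerivAt.comp_of_eq (0 : ℝ) hφ hf (by simp)

theorem exp (hf : HasPD k f f' y) :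
    HasPD k (fun z => Real.exp (f z)) (Real.exp (f y) * f') y :=
  hf.comp (Real.hasDerivAt_exp (f y))

end HasPD

theorem pd_eq_fderiv [Finite ι] (hf : DifferentiableAt ℝ f y) :
    pd k f y = fderiv ℝ f y (EuclideanSpace.single k 1) :=
  have := Fintype.ofFinite ι
  hf.lineDeriv_eq_fderiv

theorem HasPD.of_differentiableAt [Finite ι] (hf : DifferentiableAt ℝ f y) :
    HasPD k f (pd k f y) y :=
  have := Fintype.ofFinite ι
  hf.lineDifferentiableAt.hasLineDerivAt

theorem pd_eq_zero_of_notMem_tsupport [Finite ι] (hy : y ∉ tsupport f) (k : ι) : pd k f y = 0 :=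
  have := Fintype.ofFinite ι
  (notMem_tsupport_iff_eventuallyEq.1 hy).lineDeriv_eq.trans (by simp [lineDeriv])

theorem tsupport_pd_subset [Finite ι] (k : ι) : tsupport (pd k f) ⊆ tsupport f :=
  closure_minimal (fun _ hy => by_contra fun h => hy (pd_eq_zero_of_notMem_tsupport h k))
    (isClosed_tsupport _)

variable [Fintype ι]

theorem pd_eventuallyEq_fderiv (hf : ContDiffAt ℝ 1 f y) :
    pd k f =ᶠ[nhds y] fun z => fderiv ℝ f z (EuclideanSpace.single k 1) := by
  filter_upwards [hf.eventually (by simp)] with z hz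
  exact pd_eq_fderiv (hz.differentiableAt one_ne_zero)

theorem contDiffAt_pd {n m : WithTop ℕ∞} (hf : ContDiffAt ℝ n f y) (hmn : m + 1 ≤ n) :
    ContDiffAt ℝ m (pd k f) y :=
  ((hf.fderiv_right hmn).clm_apply contDiffAt_const).congr_of_eventuallyEq
    (pd_eventuallyEq_fderiv (hf.of_le (le_add_self.trans hmn)))

theorem differentiableAt_pd (hf : ContDiffAt ℝ 2 f y) : DifferentiableAt ℝ (pd k f) y :=
  (contDiffAt_pd (m := 1) hf (by norm_num)).differentiableAt one_ne_zero

theorem pd_comm (hf : ContDiffAt ℝ 2 f y) : pd k (pd l f) y = pd l (pd k f) y := by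
  have hd : DifferentiableAt ℝ (fderiv ℝ f) y :=
    (hf.fderiv_right (m := 1) (by norm_num)).differentiableAt one_ne_zero
  have key : ∀ i j : ι, pd i (pd j f) y =
      fderiv ℝ (fderiv ℝ f) y (EuclideanSpace.single i 1) (EuclideanSpace.single j 1) := by
    intro i j
    rw [pd_eq_fderiv (differentiableAt_pd hf),
      (pd_eventuallyEq_fderiv (hf.of_le one_le_two)).fderiv_eq,
      fderiv_clm_apply hd (differentiableAt_const _)]
    simp
  rw [key, key]
  exact hf.isSymmSndFDerivAt (by simp) _ _

end PartialDerivatives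

section MultiplierIdentity

variable {ι : Type*} [Fintype ι] [DecidableEq ι] {A : ι → ι → EuclideanSpace ℝ ι → ℝ}
  {B : ι → EuclideanSpace ℝ ι → ℝ} {V g w : EuclideanSpace ℝ ι → ℝ} {y : EuclideanSpace ℝ ι}

/-- The divergence of the vector field with components `F k`. -/
def divergence (F : ι → EuclideanSpace ℝ ι → ℝ) (y : EuclideanSpace ℝ ι) : ℝ :=
  ∑ k, pd k (F k) y

/-- The conormal gradient `A∇w`. -/
def coGradient (A : ι → ι → EuclideanSpace ℝ ι → ℝ) (w : EuclideanSpace ℝ ι → ℝ) (k : ι)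
    (y : EuclideanSpace ℝ ι) : ℝ :=
  ∑ j, A k j y * pd j w y

/-- The energy density `A∇w · ∇w`. -/
def dirichletEnergy (A : ι → ι → EuclideanSpace ℝ ι → ℝ) (w : EuclideanSpace ℝ ι → ℝ)
    (y : EuclideanSpace ℝ ι) : ℝ :=
  ∑ i, coGradient A w i y * pd i w y

/-- The first-order multiplier `B · ∇w + g w`. -/
def multiplier (B : ι → EuclideanSpace ℝ ι → ℝ) (g w : EuclideanSpace ℝ ι → ℝ)
    (y : EuclideanSpace ℝ ι) : ℝ :=
  ∑ l, B l y * pd l w y + g y * w y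

/-- The flux in the multiplier identity `divergence_multiplierFlux` for the operator
`-div (A∇w) - V w` and the multiplier `B · ∇w + g w`. -/
def multiplierFlux (A : ι → ι → EuclideanSpace ℝ ι → ℝ) (B : ι → EuclideanSpace ℝ ι → ℝ)
    (V g w : EuclideanSpace ℝ ι → ℝ) (k : ι) (y : EuclideanSpace ℝ ι) : ℝ :=
  B k y * (1 / 2 * (dirichletEnergy A w y - V y * w y ^ 2)) -
    coGradient A w k y * multiplier B g w y

/-- The quadratic form in `∇w` produced by commuting `-div (A∇·)` with the vector field `X`; it is
the deformation of the energy density along `X`. -/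
def stressForm (A : ι → ι → EuclideanSpace ℝ ι → ℝ) (X : ι → EuclideanSpace ℝ ι → ℝ)
    (w : EuclideanSpace ℝ ι → ℝ) (y : EuclideanSpace ℝ ι) : ℝ :=
  ∑ k, coGradient A w k y * ∑ l, pd k (X l) y * pd l w y -
    1 / 2 * divergence X y * dirichletEnergy A w y -
    1 / 2 * ∑ l, X l y * dirichletEnergy (fun i j => pd l (A i j)) w y

/-- The coefficient of `w²` in `commutatorForm`. -/
def potentialForm (B : ι → EuclideanSpace ℝ ι → ℝ) (V g : EuclideanSpace ℝ ι → ℝ)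
    (y : EuclideanSpace ℝ ι) : ℝ :=
  1 / 2 * V y * divergence B y + 1 / 2 * ∑ l, B l y * pd l V y - V y * g y

/-- The quadratic form in `(w, ∇w)` that remains when the product of `-div (A∇w) - V w` with the
multiplier `B · ∇w + g w` is written as a divergence. -/
def commutatorForm (A : ι → ι → EuclideanSpace ℝ ι → ℝ) (B : ι → EuclideanSpace ℝ ι → ℝ)
    (V g w : EuclideanSpace ℝ ι → ℝ) (y : EuclideanSpace ℝ ι) : ℝ :=
  stressForm A B w y + g y * dirichletEnergy A w y +
    w y * ∑ k, coGradient A w k y * pd k g y + w y ^ 2 * potentialForm B V g y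

theorem divergence_mul {F : ι → EuclideanSpace ℝ ι → ℝ} {f : EuclideanSpace ℝ ι → ℝ}
    {f' : ι → ℝ} (hF : ∀ k, DifferentiableAt ℝ (F k) y) (hf : ∀ k, HasPD k f (f' k) y) :
    divergence (fun k z => F k z * f z) y = divergence F y * f y + ∑ k, F k y * f' k := by
  simp only [divergence, ((HasPD.of_differentiableAt (hF _)).mul (hf _)).pd_eq,
    Finset.sum_add_distrib, Finset.sum_mul]

theorem divergence_sub {F G : ι → EuclideanSpace ℝ ι → ℝ}
    (hF : ∀ k, DifferentiableAt ℝ (F k) y) (hG : ∀ k, DifferentiableAt ℝ (G k) y) :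
    divergence (fun k z => F k z - G k z) y = divergence F y - divergence G y := by
  simp only [divergence,
    ((HasPD.of_differentiableAt (hF _)).sub (HasPD.of_differentiableAt (hG _))).pd_eq,
    Finset.sum_sub_distrib]

theorem differentiableAt_coGradient (hA : ∀ i j, DifferentiableAt ℝ (A i j) y)
    (hw : ContDiffAt ℝ 2 w y) (k : ι) : DifferentiableAt ℝ (coGradient A w k) y := by
  have := fun j : ι => differentiableAt_pd (k := j) hw
  unfold coGradient; fun_prop

theorem differentiableAt_dirichletEnergy (hA : ∀ i j, DifferentiableAt ℝ (A i j) y)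
    (hw : ContDiffAt ℝ 2 w y) : DifferentiableAt ℝ (dirichletEnergy A w) y := by
  have := fun j : ι => differentiableAt_pd (k := j) hw
  have := differentiableAt_coGradient hA hw
  unfold dirichletEnergy; fun_prop

theorem differentiableAt_multiplier (hB : ∀ l, DifferentiableAt ℝ (B l) y)
    (hg : DifferentiableAt ℝ g y) (hw : ContDiffAt ℝ 2 w y) :
    DifferentiableAt ℝ (multiplier B g w) y := by
  have := fun j : ι => differentiableAt_pd (k := j) hw
  have := hw.differentiableAt two_ne_zero
  unfold multiplier; fun_prop

theorem sum_coGradient_mul_comm (hsymm : ∀ i j, A i j y = A j i y) (X : ι → ℝ) :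
    ∑ i, (∑ j, A i j y * X j) * pd i w y = ∑ i, coGradient A w i y * X i := by
  simp only [coGradient, Finset.sum_mul]
  rw [Finset.sum_comm]
  refine Finset.sum_congr rfl fun i _ => Finset.sum_congr rfl fun j _ => ?_
  rw [hsymm j i]
  ring

theorem sum_coGradient_mul_pd_comm {u : EuclideanSpace ℝ ι → ℝ} (hsymm : ∀ i j, A i j y = A j i y) :
    ∑ i, coGradient A u i y * pd i w y = ∑ i, coGradient A w i y * pd i u y :=
  sum_coGradient_mul_comm hsymm fun j => pd j u y

theorem hasPD_coGradient (hA : ∀ i j, DifferentiableAt ℝ (A i j) y) (hw : ContDiffAt ℝ 2 w y)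
    (k l : ι) : HasPD k (coGradient A w l)
      (∑ j, (pd k (A l j) y * pd j w y + A l j y * pd k (pd j w) y)) y :=
  HasPD.sum fun j : ι => (HasPD.of_differentiableAt (hA l j)).mul
    (HasPD.of_differentiableAt (differentiableAt_pd hw))

theorem hasPD_dirichletEnergy (hA : ∀ i j, DifferentiableAt ℝ (A i j) y)
    (hsymm : ∀ i j, A i j y = A j i y) (hw : ContDiffAt ℝ 2 w y) (k : ι) :
    HasPD k (dirichletEnergy A w) (dirichletEnergy (fun i j => pd k (A i j)) w y +
      2 * ∑ i, coGradient A w i y * pd k (pd i w) y) y := by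
  have hu := fun i : ι => HasPD.of_differentiableAt (k := k) (differentiableAt_pd (k := i) hw)
  refine (HasPD.sum fun i : ι => (hasPD_coGradient hA hw k i).mul (hu i)).congr_deriv ?_
  have hcomm := sum_coGradient_mul_comm (w := w) hsymm fun i => pd k (pd i w) y
  simp only [dirichletEnergy, coGradient, Finset.sum_add_distrib, add_mul] at hcomm ⊢
  rw [hcomm]
  ring

theorem hasPD_multiplier (hB : ∀ l, DifferentiableAt ℝ (B l) y) (hg : DifferentiableAt ℝ g y)
    (hw : ContDiffAt ℝ 2 w y) (k : ι) :
    HasPD k (multiplier B g w) (∑ l, (pd k (B l) y * pd l w y + B l y * pd k (pd l w) y) +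
      (pd k g y * w y + g y * pd k w y)) y :=
  (HasPD.sum fun l : ι => (HasPD.of_differentiableAt (hB l)).mul
    (HasPD.of_differentiableAt (differentiableAt_pd hw))).add
    ((HasPD.of_differentiableAt hg).mul
      (HasPD.of_differentiableAt (hw.differentiableAt two_ne_zero)))

theorem divergence_mul_energy (hA : ∀ i j, DifferentiableAt ℝ (A i j) y)
    (hsymm : ∀ i j, A i j y = A j i y) (hB : ∀ l, DifferentiableAt ℝ (B l) y)
    (hV : DifferentiableAt ℝ V y) (hw : ContDiffAt ℝ 2 w y) :
    divergence (fun k z => B k z * (1 / 2 * (dirichletEnergy A w z - V z * w z ^ 2))) y =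
      1 / 2 * divergence B y * (dirichletEnergy A w y - V y * w y ^ 2) +
        1 / 2 * ∑ k, B k y * dirichletEnergy (fun i j => pd k (A i j)) w y +
        ∑ k, B k y * ∑ i, coGradient A w i y * pd k (pd i w) y -
        w y ^ 2 * (1 / 2 * ∑ k, B k y * pd k V y) - V y * w y * ∑ k, B k y * pd k w y := by
  have energy_deriv (k : ι) :
      HasPD k (fun z => 1 / 2 * (dirichletEnergy A w z - V z * w z ^ 2)) (1 / 2 *
        (dirichletEnergy (fun i j => pd k (A i j)) w y +
          2 * ∑ i, coGradient A w i y * pd k (pd i w) y -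
          (pd k V y * (w y * w y) + V y * (pd k w y * w y + w y * pd k w y)))) y := by
    simp only [pow_two]
    have hw_pd : HasPD k w (pd k w y) y :=
      HasPD.of_differentiableAt (hw.differentiableAt two_ne_zero)
    exact ((hasPD_dirichletEnergy hA hsymm hw k).sub
      ((HasPD.of_differentiableAt hV).mul (hw_pd.mul hw_pd))).const_mul _
  have expand (z S V' : ι → ℝ) : ∑ k, B k y * (1 / 2 * (z k + 2 * S k -
        (V' k * (w y * w y) + V y * (pd k w y * w y + w y * pd k w y)))) =
      1 / 2 * ∑ k, B k y * z k + ∑ k, B k y * S k - w y ^ 2 * (1 / 2 * ∑ k, B k y * V' k) -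
        V y * w y * ∑ k, B k y * pd k w y := by
    simp only [Finset.mul_sum, ← Finset.sum_add_distrib, ← Finset.sum_sub_distrib]
    exact Finset.sum_congr rfl fun k _ => by ring
  rw [divergence_mul hB energy_deriv, expand]
  ring

theorem divergence_coGradient_mul_multiplier (hA : ∀ i j, DifferentiableAt ℝ (A i j) y)
    (hB : ∀ l, DifferentiableAt ℝ (B l) y) (hg : DifferentiableAt ℝ g y)
    (hw : ContDiffAt ℝ 2 w y) :
    divergence (fun k z => coGradient A w k z * multiplier B g w z) y =
      divergence (coGradient A w) y * multiplier B g w y +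
        ∑ k, coGradient A w k y * ∑ l, pd k (B l) y * pd l w y +
        ∑ k, B k y * ∑ i, coGradient A w i y * pd k (pd i w) y +
        w y * ∑ k, coGradient A w k y * pd k g y + g y * dirichletEnergy A w y := by
  have second_order : ∑ k, coGradient A w k y * ∑ l, B l y * pd k (pd l w) y =
      ∑ k, B k y * ∑ i, coGradient A w i y * pd k (pd i w) y := by
    simp only [Finset.mul_sum]
    rw [Finset.sum_comm]
    refine Finset.sum_congr rfl fun k _ => Finset.sum_congr rfl fun i _ => ?_
    rw [pd_comm hw]
    ring
  have expand (p S T g' : ι → ℝ) :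
      ∑ k, p k * (S k + T k + (g' k * w y + g y * pd k w y)) =
        ∑ k, p k * S k + ∑ k, p k * T k + w y * ∑ k, p k * g' k +
          g y * ∑ k, p k * pd k w y := by
    simp only [Finset.mul_sum, ← Finset.sum_add_distrib]
    exact Finset.sum_congr rfl fun k _ => by ring
  rw [divergence_mul (differentiableAt_coGradient hA hw) (hasPD_multiplier hB hg hw)]
  simp only [Finset.sum_add_distrib (f := fun l => pd _ (B l) y * pd l w y), expand,
    second_order, dirichletEnergy]
  ring

theorem divergence_multiplierFlux (hA : ∀ i j, DifferentiableAt ℝ (A i j) y)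
    (hsymm : ∀ i j, A i j y = A j i y) (hB : ∀ l, DifferentiableAt ℝ (B l) y)
    (hV : DifferentiableAt ℝ V y) (hg : DifferentiableAt ℝ g y) (hw : ContDiffAt ℝ 2 w y) :
    divergence (multiplierFlux A B V g w) y =
      (-divergence (coGradient A w) y - V y * w y) * multiplier B g w y -
        commutatorForm A B V g w y := by
  have := hw.differentiableAt two_ne_zero
  have := differentiableAt_dirichletEnergy hA hw
  have := differentiableAt_multiplier hB hg hw
  have := differentiableAt_coGradient hA hw
  unfold multiplierFlux
  rw [divergence_sub (by fun_prop) (by fun_prop), divergence_mul_energy hA hsymm hB hV hw,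
    divergence_coGradient_mul_multiplier hA hB hg hw]
  simp only [commutatorForm, stressForm, potentialForm, multiplier]
  ring

end MultiplierIdentity

section Conjugation

variable {ι : Type*} {τ s : ℝ} {φ v : EuclideanSpace ℝ ι → ℝ} {y : EuclideanSpace ℝ ι} {k l : ι}

/-- The large parameter `σ = τ s e^{sφ}`; then `∇ e^{τ e^{sφ}} = σ e^{τ e^{sφ}} ∇φ`. -/
def largeParam (τ s : ℝ) (φ : EuclideanSpace ℝ ι → ℝ) (y : EuclideanSpace ℝ ι) : ℝ :=
  τ * s * Real.exp (s * φ y)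

/-- The Carleman weight `e^{τ e^{sφ}}`. -/
def expWeight (τ s : ℝ) (φ : EuclideanSpace ℝ ι → ℝ) (y : EuclideanSpace ℝ ι) : ℝ :=
  Real.exp (τ * Real.exp (s * φ y))

/-- The conjugated function `w = e^{τ e^{sφ}} v`. -/
def conjugate (τ s : ℝ) (φ v : EuclideanSpace ℝ ι → ℝ) (y : EuclideanSpace ℝ ι) : ℝ :=
  expWeight τ s φ y * v y

section Regularity

variable [Fintype ι] {n : WithTop ℕ∞}

theorem contDiffAt_largeParam (hφ : ContDiffAt ℝ n φ y) :
    ContDiffAt ℝ n (largeParam τ s φ) y := by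
  unfold largeParam; fun_prop

theorem contDiffAt_expWeight (hφ : ContDiffAt ℝ n φ y) :
    ContDiffAt ℝ n (expWeight τ s φ) y := by
  unfold expWeight; fun_prop

theorem contDiffAt_conjugate (hφ : ContDiffAt ℝ n φ y)
    (hv : ContDiffAt ℝ n v y) : ContDiffAt ℝ n (conjugate τ s φ v) y :=
  (contDiffAt_expWeight hφ).mul hv

end Regularity

variable [DecidableEq ι]

theorem hasPD_largeParam {φ' : ℝ} (hφ : HasPD k φ φ' y) :
    HasPD k (largeParam τ s φ) (largeParam τ s φ y * (s * φ')) y :=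
  ((hφ.const_mul s).exp.const_mul (τ * s)).congr_deriv (by unfold largeParam; ring)

theorem hasPD_expWeight {φ' : ℝ} (hφ : HasPD k φ φ' y) :
    HasPD k (expWeight τ s φ) (expWeight τ s φ y * (largeParam τ s φ y * φ')) y :=
  ((hφ.const_mul s).exp.const_mul τ).exp.congr_deriv (by unfold expWeight largeParam; ring)

theorem pd_conjugate [Finite ι] (hφ : DifferentiableAt ℝ φ y) (hv : DifferentiableAt ℝ v y) :
    pd k (conjugate τ s φ v) y =
      expWeight τ s φ y * (pd k v y + largeParam τ s φ y * pd k φ y * v y) := by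
  refine (((hasPD_expWeight (.of_differentiableAt hφ)).mul
    (.of_differentiableAt hv)).congr_deriv ?_).pd_eq
  ring

variable [Fintype ι]

theorem pd_pd_conjugate (hφ : ContDiffAt ℝ 2 φ y) (hv : ContDiffAt ℝ 2 v y) :
    pd k (pd l (conjugate τ s φ v)) y = expWeight τ s φ y *
      (pd k (pd l v) y +
        largeParam τ s φ y * (pd k φ y * pd l v y + pd l φ y * pd k v y) +
        (largeParam τ s φ y ^ 2 * (pd k φ y * pd l φ y) +
          largeParam τ s φ y * (s * (pd k φ y * pd l φ y) + pd k (pd l φ) y)) * v y) := by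
  have hφ₁ : HasPD k φ (pd k φ y) y := .of_differentiableAt (hφ.differentiableAt two_ne_zero)
  have hv₁ : HasPD k v (pd k v y) y := .of_differentiableAt (hv.differentiableAt two_ne_zero)
  have pd_eq : pd l (conjugate τ s φ v) =ᶠ[nhds y] fun z =>
      expWeight τ s φ z * (pd l v z + largeParam τ s φ z * pd l φ z * v z) := by
    filter_upwards [hφ.eventually (by simp), hv.eventually (by simp)] with z hφz hvz
    exact pd_conjugate (hφz.differentiableAt two_ne_zero) (hvz.differentiableAt two_ne_zero)
  rw [pd, pd_eq.lineDeriv_eq]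
  refine (((hasPD_expWeight hφ₁).mul (.add (.of_differentiableAt (differentiableAt_pd hv))
    (.mul (.mul (hasPD_largeParam hφ₁) (.of_differentiableAt (differentiableAt_pd hφ)))
      hv₁))).congr_deriv ?_).pd_eq
  ring

end Conjugation

section ConjugatedOperator

variable {ι : Type*} [Fintype ι] [DecidableEq ι] {τ s : ℝ} {φ v : EuclideanSpace ℝ ι → ℝ}
  {a : ι → ι → EuclideanSpace ℝ ι → ℝ} {b : ι → EuclideanSpace ℝ ι → ℝ}
  {c : EuclideanSpace ℝ ι → ℝ} {y : EuclideanSpace ℝ ι}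

/-- The operator `-∑ aᵢⱼ ∂ᵢⱼ + ∑ bᵢ ∂ᵢ + c` on an open set. -/
def nondivOp (a : ι → ι → EuclideanSpace ℝ ι → ℝ) (b : ι → EuclideanSpace ℝ ι → ℝ)
    (c v : EuclideanSpace ℝ ι → ℝ) (y : EuclideanSpace ℝ ι) : ℝ :=
  -(∑ i, ∑ j, a i j y * pd i (pd j v) y) + ∑ i, b i y * pd i v y + c y * v y

/-- The first-order coefficients `2 σ a∇φ + b` of the conjugated operator. -/
def conjDrift (τ s : ℝ) (φ : EuclideanSpace ℝ ι → ℝ) (a : ι → ι → EuclideanSpace ℝ ι → ℝ)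
    (b : ι → EuclideanSpace ℝ ι → ℝ) (l : ι) (y : EuclideanSpace ℝ ι) : ℝ :=
  2 * largeParam τ s φ y * coGradient a φ l y + b l y

/-- The contribution `σ b · ∇φ - c` of the lower order terms to `conjPotential`. -/
def lowerPotential (τ s : ℝ) (φ : EuclideanSpace ℝ ι → ℝ) (b : ι → EuclideanSpace ℝ ι → ℝ)
    (c : EuclideanSpace ℝ ι → ℝ) (y : EuclideanSpace ℝ ι) : ℝ :=
  largeParam τ s φ y * ∑ i, b i y * pd i φ y - c y

/-- The potential `σ² a∇φ·∇φ + σ b·∇φ - c` of the conjugated operator. -/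
def conjPotential (τ s : ℝ) (φ : EuclideanSpace ℝ ι → ℝ) (a : ι → ι → EuclideanSpace ℝ ι → ℝ)
    (b : ι → EuclideanSpace ℝ ι → ℝ) (c : EuclideanSpace ℝ ι → ℝ) (y : EuclideanSpace ℝ ι) : ℝ :=
  largeParam τ s φ y ^ 2 * dirichletEnergy a φ y + lowerPotential τ s φ b c y

/-- The zeroth-order part `2 σ s a∇φ·∇φ` of the multiplier. It turns the indefinite contribution
`-σ s (a∇φ·∇φ) (a∇w·∇w)` of the vector field `2 σ a∇φ` to the commutator into a positive one. -/
def multiplierGain (τ s : ℝ) (φ : EuclideanSpace ℝ ι → ℝ) (a : ι → ι → EuclideanSpace ℝ ι → ℝ)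
    (y : EuclideanSpace ℝ ι) : ℝ :=
  2 * s * (largeParam τ s φ y * dirichletEnergy a φ y)

/-- What is left of the conjugated operator after the divergence form part and the multiplier have
been split off. -/
def conjRemainder (τ s : ℝ) (φ : EuclideanSpace ℝ ι → ℝ) (a : ι → ι → EuclideanSpace ℝ ι → ℝ)
    (w : EuclideanSpace ℝ ι → ℝ) (y : EuclideanSpace ℝ ι) : ℝ :=
  ∑ i, ∑ j, pd i (a i j) y * pd j w y + largeParam τ s φ y *
    (∑ i, ∑ j, a i j y * pd i (pd j φ) y - s * dirichletEnergy a φ y) * w y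

theorem divergence_coGradient {w : EuclideanSpace ℝ ι → ℝ}
    (ha : ∀ i j, DifferentiableAt ℝ (a i j) y) (hw : ContDiffAt ℝ 2 w y) :
    divergence (coGradient a w) y =
      ∑ i, ∑ j, pd i (a i j) y * pd j w y + ∑ i, ∑ j, a i j y * pd i (pd j w) y := by
  simp only [divergence, (hasPD_coGradient ha hw _ _).pd_eq, Finset.sum_add_distrib]

theorem sum_mul_hessian_conjugate (hsymm : ∀ i j, a i j y = a j i y) (hφ : ContDiffAt ℝ 2 φ y)
    (hv : ContDiffAt ℝ 2 v y) :
    ∑ i, ∑ j, a i j y * pd i (pd j (conjugate τ s φ v)) y = expWeight τ s φ y *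
      (∑ i, ∑ j, a i j y * pd i (pd j v) y +
        2 * largeParam τ s φ y * ∑ i, coGradient a φ i y * pd i v y +
        (largeParam τ s φ y ^ 2 * dirichletEnergy a φ y + largeParam τ s φ y *
          (s * dirichletEnergy a φ y + ∑ i, ∑ j, a i j y * pd i (pd j φ) y)) * v y) := by
  have gradient_comm :
      ∑ i, ∑ j, a i j y * (pd i φ y * pd j v y) = ∑ i, coGradient a φ i y * pd i v y := by
    rw [← sum_coGradient_mul_comm hsymm]
    simp only [Finset.sum_mul]
    exact Finset.sum_congr rfl fun i _ => Finset.sum_congr rfl fun j _ => by ring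
  have split_entry (i j : ι) : a i j y * (expWeight τ s φ y *
      (pd i (pd j v) y + largeParam τ s φ y * (pd i φ y * pd j v y + pd j φ y * pd i v y) +
        (largeParam τ s φ y ^ 2 * (pd i φ y * pd j φ y) +
          largeParam τ s φ y * (s * (pd i φ y * pd j φ y) + pd i (pd j φ) y)) * v y)) =
      expWeight τ s φ y * (a i j y * pd i (pd j v) y) +
        expWeight τ s φ y * largeParam τ s φ y * (a i j y * (pd i φ y * pd j v y)) +
        expWeight τ s φ y * largeParam τ s φ y * (a i j y * pd j φ y * pd i v y) +
        expWeight τ s φ y * v y * (largeParam τ s φ y ^ 2 + largeParam τ s φ y * s) *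
          (a i j y * pd j φ y * pd i φ y) +
        expWeight τ s φ y * v y * largeParam τ s φ y * (a i j y * pd i (pd j φ) y) := by
    ring
  simp only [pd_pd_conjugate hφ hv, split_entry, Finset.sum_add_distrib, ← Finset.mul_sum,
    gradient_comm, ← Finset.sum_mul, dirichletEnergy]
  simp only [coGradient]
  ring

theorem expWeight_mul_nondivOp (hsymm : ∀ i j, a i j y = a j i y)
    (ha : ∀ i j, DifferentiableAt ℝ (a i j) y) (hφ : ContDiffAt ℝ 2 φ y)
    (hv : ContDiffAt ℝ 2 v y) :
    expWeight τ s φ y * nondivOp a b c v y =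
      (-divergence (coGradient a (conjugate τ s φ v)) y -
        conjPotential τ s φ a b c y * conjugate τ s φ v y) +
      multiplier (conjDrift τ s φ a b) (multiplierGain τ s φ a) (conjugate τ s φ v) y +
      conjRemainder τ s φ a (conjugate τ s φ v) y := by
  have drift_sum : ∑ l, conjDrift τ s φ a b l y * pd l (conjugate τ s φ v) y =
      expWeight τ s φ y * (2 * largeParam τ s φ y * ∑ i, coGradient a φ i y * pd i v y +
        2 * largeParam τ s φ y ^ 2 * dirichletEnergy a φ y * v y + ∑ i, b i y * pd i v y +
        largeParam τ s φ y * (∑ i, b i y * pd i φ y) * v y) := by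
    simp only [conjDrift, pd_conjugate (hφ.differentiableAt two_ne_zero)
      (hv.differentiableAt two_ne_zero), dirichletEnergy, Finset.mul_sum, Finset.sum_mul,
      ← Finset.sum_add_distrib]
    exact Finset.sum_congr rfl fun k _ => by ring
  rw [divergence_coGradient ha (contDiffAt_conjugate hφ hv), sum_mul_hessian_conjugate hsymm hφ hv]
  simp only [nondivOp, multiplier, drift_sum, conjPotential, lowerPotential, multiplierGain,
    conjRemainder, conjugate]
  ring

end ConjugatedOperator

section SymbolBounds

variable {ι : Type*} [DecidableEq ι] {τ s N κ m p : ℝ} {φ v w : EuclideanSpace ℝ ι → ℝ}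
  {A a : ι → ι → EuclideanSpace ℝ ι → ℝ} {X : ι → EuclideanSpace ℝ ι → ℝ}
  {y : EuclideanSpace ℝ ι} {k l : ι}

/-- The gradient `∇f`, assembled from the partial derivatives. -/
def grad (f : EuclideanSpace ℝ ι → ℝ) (y : EuclideanSpace ℝ ι) : EuclideanSpace ℝ ι :=
  WithLp.toLp 2 fun k => pd k f y

theorem grad_conjugate [Finite ι] (hφ : DifferentiableAt ℝ φ y) (hv : DifferentiableAt ℝ v y) :
    grad (conjugate τ s φ v) y =
      expWeight τ s φ y • grad v y + (largeParam τ s φ y * conjugate τ s φ v y) • grad φ y := by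
  ext k
  simp only [grad, pd_conjugate hφ hv, conjugate, PiLp.add_apply, PiLp.smul_apply, smul_eq_mul]
  ring

variable [Fintype ι]

theorem norm_pd_le_norm_grad (k : ι) : ‖pd k w y‖ ≤ ‖grad w y‖ :=
  PiLp.norm_apply_le (grad w y) k

theorem norm_sum_le_mul {α : Type*} [Fintype α] {f : α → ℝ} (hN : (Fintype.card α : ℝ) ≤ N)
    (hm : 0 ≤ m) (hf : ∀ i, ‖f i‖ ≤ m) : ‖∑ i, f i‖ ≤ N * m :=
  calc ‖∑ i, f i‖ ≤ ∑ _i : α, m := norm_sum_le_of_le _ fun i _ => hf i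
    _ = Fintype.card α * m := by simp
    _ ≤ N * m := by gcongr

theorem norm_coGradient_le (hN : (Fintype.card ι : ℝ) ≤ N) (hm : 0 ≤ m) (hp : 0 ≤ p)
    (hA : ∀ i j, ‖A i j y‖ ≤ m) (hw : ∀ j, ‖pd j w y‖ ≤ p) (k : ι) :
    ‖coGradient A w k y‖ ≤ N * (m * p) :=
  norm_sum_le_mul hN (by positivity) fun j => norm_mul_le_of_le (hA k j) (hw j)

theorem norm_dirichletEnergy_le (hN : (Fintype.card ι : ℝ) ≤ N) (hm : 0 ≤ m) (hp : 0 ≤ p)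
    (hA : ∀ i j, ‖A i j y‖ ≤ m) (hw : ∀ j, ‖pd j w y‖ ≤ p) :
    ‖dirichletEnergy A w y‖ ≤ N * (N * (m * p) * p) := by
  have hN₀ : 0 ≤ N := (Nat.cast_nonneg _).trans hN
  exact norm_sum_le_mul hN (by positivity) fun i =>
    norm_mul_le_of_le (norm_coGradient_le hN hm hp hA hw i) (hw i)

/-- At the point `y`, the coefficients `a` are symmetric, `C¹` and elliptic with constant `κ`, the
weight function `φ` is `C²` and noncharacteristic for `a`, and `N` bounds the dimension and the
derivatives of `a` and `φ` that occur in a Carleman estimate. -/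
structure IsAdmissibleSymbol (N κ : ℝ) (φ : EuclideanSpace ℝ ι → ℝ)
    (a : ι → ι → EuclideanSpace ℝ ι → ℝ) (y : EuclideanSpace ℝ ι) : Prop where
  one_le : 1 ≤ N
  card_le : (Fintype.card ι : ℝ) ≤ N
  contDiffAt_weight : ContDiffAt ℝ 2 φ y
  norm_pd_weight_le : ∀ k, ‖pd k φ y‖ ≤ N
  norm_pd_pd_weight_le : ∀ k l, ‖pd k (pd l φ) y‖ ≤ N
  contDiffAt_coeff : ∀ i j, ContDiffAt ℝ 1 (a i j) y
  symm : ∀ i j, a i j y = a j i y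
  norm_coeff_le : ∀ i j, ‖a i j y‖ ≤ N
  norm_pd_coeff_le : ∀ k i j, ‖pd k (a i j) y‖ ≤ N
  elliptic : ∀ ξ : EuclideanSpace ℝ ι, κ * ‖ξ‖ ^ 2 ≤ ∑ i, (∑ j, a i j y * ξ j) * ξ i
  noncharacteristic : κ ≤ dirichletEnergy a φ y

namespace IsAdmissibleSymbol

theorem nonneg (ha : IsAdmissibleSymbol N κ φ a y) : 0 ≤ N := zero_le_one.trans ha.one_le

theorem pow_le_pow (ha : IsAdmissibleSymbol N κ φ a y) {i j : ℕ} (hij : i ≤ j) : N ^ i ≤ N ^ j :=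
  pow_le_pow_right₀ ha.one_le hij

theorem differentiableAt_coeff (ha : IsAdmissibleSymbol N κ φ a y)
    (i j : ι) : DifferentiableAt ℝ (a i j) y :=
  (ha.contDiffAt_coeff i j).differentiableAt one_ne_zero

theorem differentiableAt_weight (ha : IsAdmissibleSymbol N κ φ a y) : DifferentiableAt ℝ φ y :=
  ha.contDiffAt_weight.differentiableAt two_ne_zero

theorem mul_norm_grad_sq_le (ha : IsAdmissibleSymbol N κ φ a y)
    : κ * ‖grad w y‖ ^ 2 ≤ dirichletEnergy a w y :=
  ha.elliptic _

theorem norm_coGradient_grad_le (ha : IsAdmissibleSymbol N κ φ a y)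
    : ‖coGradient a w k y‖ ≤ N ^ 2 * ‖grad w y‖ :=
  (norm_coGradient_le ha.card_le ha.nonneg (norm_nonneg _) ha.norm_coeff_le
    norm_pd_le_norm_grad k).trans_eq (by ring)

theorem norm_dirichletEnergy_grad_le (ha : IsAdmissibleSymbol N κ φ a y)
    : ‖dirichletEnergy a w y‖ ≤ N ^ 3 * ‖grad w y‖ ^ 2 :=
  (norm_dirichletEnergy_le ha.card_le ha.nonneg (norm_nonneg _) ha.norm_coeff_le
    norm_pd_le_norm_grad).trans_eq (by ring)

theorem norm_dirichletEnergy_pd_grad_le (ha : IsAdmissibleSymbol N κ φ a y) (k : ι) :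
    ‖dirichletEnergy (fun i j => pd k (a i j)) w y‖ ≤ N ^ 3 * ‖grad w y‖ ^ 2 :=
  (norm_dirichletEnergy_le ha.card_le ha.nonneg (norm_nonneg _) (ha.norm_pd_coeff_le k)
    norm_pd_le_norm_grad).trans_eq (by ring)

theorem norm_coGradient_weight_le (ha : IsAdmissibleSymbol N κ φ a y)
    (k : ι) : ‖coGradient a φ k y‖ ≤ N ^ 3 :=
  (norm_coGradient_le ha.card_le ha.nonneg ha.nonneg ha.norm_coeff_le
    ha.norm_pd_weight_le k).trans_eq (by ring)

theorem norm_dirichletEnergy_weight_le (ha : IsAdmissibleSymbol N κ φ a y)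
    : ‖dirichletEnergy a φ y‖ ≤ N ^ 5 :=
  (norm_dirichletEnergy_le ha.card_le ha.nonneg ha.nonneg ha.norm_coeff_le
    ha.norm_pd_weight_le).trans_eq (by ring)

theorem norm_pd_coGradient_weight_le (ha : IsAdmissibleSymbol N κ φ a y)
    (k l : ι) : ‖pd k (coGradient a φ l) y‖ ≤ 2 * N ^ 3 := by
  have hN := ha.nonneg
  rw [(hasPD_coGradient ha.differentiableAt_coeff ha.contDiffAt_weight k l).pd_eq]
  refine (norm_sum_le_mul (m := N * N + N * N) ha.card_le (by positivity) fun j =>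
    norm_add_le_of_le (norm_mul_le_of_le (ha.norm_pd_coeff_le k l j) (ha.norm_pd_weight_le j))
      (norm_mul_le_of_le (ha.norm_coeff_le l j) (ha.norm_pd_pd_weight_le k j))).trans_eq ?_
  ring

theorem norm_pd_dirichletEnergy_weight_le (ha : IsAdmissibleSymbol N κ φ a y) (k : ι) :
    ‖pd k (dirichletEnergy a φ) y‖ ≤ 3 * N ^ 5 := by
  have hN := ha.nonneg
  rw [(hasPD_dirichletEnergy ha.differentiableAt_coeff ha.symm ha.contDiffAt_weight k).pd_eq]
  refine (norm_add_le_of_le (norm_dirichletEnergy_le ha.card_le hN hN (ha.norm_pd_coeff_le k)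
    ha.norm_pd_weight_le) (norm_mul_le_of_le (Real.norm_ofNat 2).le
      (norm_sum_le_mul (m := N ^ 3 * N) ha.card_le (by positivity) fun i =>
        norm_mul_le_of_le (ha.norm_coGradient_weight_le i)
          (ha.norm_pd_pd_weight_le k i)))).trans_eq ?_
  ring

theorem norm_divergence_le (ha : IsAdmissibleSymbol N κ φ a y)
    (hX' : ∀ k, ‖pd k (X k) y‖ ≤ m) (hm : 0 ≤ m) :
    ‖divergence X y‖ ≤ N * m :=
  norm_sum_le_mul ha.card_le hm hX'

theorem norm_stressForm_le (ha : IsAdmissibleSymbol N κ φ a y) (hm : 0 ≤ m) (hX : ∀ l, ‖X l y‖ ≤ m)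
    (hX' : ∀ k l, ‖pd k (X l) y‖ ≤ m) :
    ‖stressForm a X w y‖ ≤ 2 * N ^ 4 * m * ‖grad w y‖ ^ 2 := by
  have hN := ha.nonneg
  have hhalf : ‖(1 / 2 : ℝ)‖ ≤ 1 / 2 := by norm_num
  refine (norm_sub_le_of_le (norm_sub_le_of_le
    (norm_sum_le_mul (m := N ^ 2 * ‖grad w y‖ * (N * (m * ‖grad w y‖))) ha.card_le (by positivity)
      fun k => norm_mul_le_of_le ha.norm_coGradient_grad_le
        (norm_sum_le_mul ha.card_le (by positivity) fun l =>
          norm_mul_le_of_le (hX' k l) (norm_pd_le_norm_grad l)))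
    (norm_mul_le_of_le (norm_mul_le_of_le hhalf (ha.norm_divergence_le (fun k => hX' k k) hm))
      ha.norm_dirichletEnergy_grad_le))
    (norm_mul_le_of_le hhalf (norm_sum_le_mul (m := m * (N ^ 3 * ‖grad w y‖ ^ 2)) ha.card_le
      (by positivity) fun l =>
        norm_mul_le_of_le (hX l) (ha.norm_dirichletEnergy_pd_grad_le l)))).trans_eq ?_
  ring

end IsAdmissibleSymbol

end SymbolBounds

section StressForm

variable {ι : Type*} [Fintype ι] [DecidableEq ι] {A : ι → ι → EuclideanSpace ℝ ι → ℝ}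
  {X Y : ι → EuclideanSpace ℝ ι → ℝ} {f w : EuclideanSpace ℝ ι → ℝ} {y : EuclideanSpace ℝ ι}

theorem stressForm_add (hX : ∀ l, DifferentiableAt ℝ (X l) y)
    (hY : ∀ l, DifferentiableAt ℝ (Y l) y) :
    stressForm A (fun l z => X l z + Y l z) w y = stressForm A X w y + stressForm A Y w y := by
  simp only [stressForm, divergence,
    ((HasPD.of_differentiableAt (hX _)).add (.of_differentiableAt (hY _))).pd_eq,
    add_mul, mul_add, Finset.sum_add_distrib]
  ring

theorem stressForm_mul (hf : DifferentiableAt ℝ f y) (hX : ∀ l, DifferentiableAt ℝ (X l) y) :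
    stressForm A (fun l z => f z * X l z) w y = f y * stressForm A X w y +
      (∑ k, coGradient A w k y * pd k f y) * ∑ l, X l y * pd l w y -
      1 / 2 * (∑ k, pd k f y * X k y) * dirichletEnergy A w y := by
  have first_term : ∑ k, coGradient A w k y *
        ∑ l, (pd k f y * X l y + f y * pd k (X l) y) * pd l w y =
      f y * ∑ k, coGradient A w k y * ∑ l, pd k (X l) y * pd l w y +
        (∑ k, coGradient A w k y * pd k f y) * ∑ l, X l y * pd l w y := by
    rw [Finset.mul_sum, Finset.sum_mul, ← Finset.sum_add_distrib]
    refine Finset.sum_congr rfl fun k _ => ?_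
    simp only [add_mul, Finset.sum_add_distrib, mul_assoc, ← Finset.mul_sum]
    ring
  simp only [stressForm, divergence,
    ((HasPD.of_differentiableAt hf).mul (.of_differentiableAt (hX _))).pd_eq, first_term,
    Finset.sum_add_distrib, mul_assoc, ← Finset.mul_sum]
  ring

end StressForm

section ConjugatedCoefficients

variable {ι : Type*} [Fintype ι] [DecidableEq ι] {N κ τ s ε : ℝ} {φ : EuclideanSpace ℝ ι → ℝ}
  {a : ι → ι → EuclideanSpace ℝ ι → ℝ} {b : ι → EuclideanSpace ℝ ι → ℝ}
  {c : EuclideanSpace ℝ ι → ℝ} {y : EuclideanSpace ℝ ι}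

/-- At the point `y`, the lower order coefficients `b` and `c` are `C¹` and small of relative size
`ε` compared with the powers of the large parameter `σ` that scale like them. -/
structure IsSubordinate (ε σ : ℝ) (b : ι → EuclideanSpace ℝ ι → ℝ) (c : EuclideanSpace ℝ ι → ℝ)
    (y : EuclideanSpace ℝ ι) : Prop where
  nonneg : 0 ≤ ε
  le_one : ε ≤ 1
  one_le_mul : 1 ≤ ε * σ
  contDiffAt_drift : ∀ i, ContDiffAt ℝ 1 (b i) y
  norm_drift_le : ∀ i, ‖b i y‖ ≤ ε * σ
  norm_pd_drift_le : ∀ k i, ‖pd k (b i) y‖ ≤ ε * σ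
  contDiffAt_potential : ContDiffAt ℝ 1 c y
  norm_potential_le : ‖c y‖ ≤ ε * σ ^ 2
  norm_pd_potential_le : ∀ k, ‖pd k c y‖ ≤ ε * σ ^ 2

theorem IsSubordinate.one_le {σ : ℝ} (hb : IsSubordinate ε σ b c y) : 1 ≤ σ := by
  have hσ : 0 ≤ σ := le_of_lt (pos_of_mul_pos_right (one_pos.trans_le hb.one_le_mul) hb.nonneg)
  exact hb.one_le_mul.trans (mul_le_of_le_one_left hσ hb.le_one)

theorem IsSubordinate.pos {σ : ℝ} (hb : IsSubordinate ε σ b c y) : 0 < σ :=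
  one_pos.trans_le hb.one_le

theorem IsSubordinate.differentiableAt_drift {σ : ℝ} (hb : IsSubordinate ε σ b c y) (i : ι) :
    DifferentiableAt ℝ (b i) y := (hb.contDiffAt_drift i).differentiableAt one_ne_zero

theorem IsSubordinate.differentiableAt_potential {σ : ℝ} (hb : IsSubordinate ε σ b c y) :
    DifferentiableAt ℝ c y := hb.contDiffAt_potential.differentiableAt one_ne_zero

theorem IsAdmissibleSymbol.mul_pow_le_mul_mul_pow (ha : IsAdmissibleSymbol N κ φ a y)
    (hs : 1 ≤ s) {x : ℝ} (hx : 0 ≤ x) {i j : ℕ} (hij : i ≤ j) : x * N ^ i ≤ s * x * N ^ j := by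
  have := ha.nonneg
  calc x * N ^ i = 1 * x * N ^ i := by ring
    _ ≤ s * x * N ^ j := by gcongr; exact ha.one_le

local notation "σ" => largeParam τ s φ y

theorem hasPD_conjDrift (ha : IsAdmissibleSymbol N κ φ a y)
    (hb : ∀ i, DifferentiableAt ℝ (b i) y) (k l : ι) :
    HasPD k (conjDrift τ s φ a b l) (2 * (σ * (s * pd k φ y)) * coGradient a φ l y +
      2 * σ * pd k (coGradient a φ l) y + pd k (b l) y) y :=
  (((hasPD_largeParam (.of_differentiableAt ha.differentiableAt_weight)).const_mul 2).mul
    (.of_differentiableAt (differentiableAt_coGradient ha.differentiableAt_coeff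
      ha.contDiffAt_weight l))).add (.of_differentiableAt (hb l))

theorem norm_conjDrift_le (ha : IsAdmissibleSymbol N κ φ a y) (hb : IsSubordinate ε σ b c y)
    (l : ι) : ‖conjDrift τ s φ a b l y‖ ≤ 3 * N ^ 3 * σ := by
  have hσ := hb.pos
  have hε := mul_le_of_le_one_left hσ.le hb.le_one
  have hN := mul_le_mul_of_nonneg_right (one_le_pow₀ ha.one_le (n := 3)) hσ.le
  have := norm_add_le_of_le (norm_mul_le_of_le (norm_mul_le_of_le (Real.norm_ofNat 2).le
    (Real.norm_of_nonneg hσ.le).le) (ha.norm_coGradient_weight_le l)) (hb.norm_drift_le l)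
  exact this.trans (by linarith)

theorem norm_pd_conjDrift_le (hs : 1 ≤ s) (ha : IsAdmissibleSymbol N κ φ a y)
    (hb : IsSubordinate ε σ b c y) (k l : ι) :
    ‖pd k (conjDrift τ s φ a b l) y‖ ≤ 7 * s * N ^ 4 * σ := by
  have hσ := hb.pos
  have hε := mul_le_of_le_one_left hσ.le hb.le_one
  have hN₀ := ha.mul_pow_le_mul_mul_pow hs hσ.le (Nat.zero_le 4)
  have hN₃ := ha.mul_pow_le_mul_mul_pow hs hσ.le (show 3 ≤ 4 by norm_num)
  have h2 := (Real.norm_ofNat 2).le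
  have hσ' := (Real.norm_of_nonneg hσ.le).le
  have hs' := (Real.norm_of_nonneg (zero_le_one.trans hs)).le
  rw [(hasPD_conjDrift ha hb.differentiableAt_drift k l).pd_eq]
  refine (norm_add_le_of_le (norm_add_le_of_le (norm_mul_le_of_le (norm_mul_le_of_le h2
    (norm_mul_le_of_le hσ' (norm_mul_le_of_le hs' (ha.norm_pd_weight_le k))))
    (ha.norm_coGradient_weight_le l)) (norm_mul_le_of_le (norm_mul_le_of_le h2 hσ')
      (ha.norm_pd_coGradient_weight_le k l))) (hb.norm_pd_drift_le k l)).trans ?_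
  linarith

theorem hasPD_lowerPotential (ha : IsAdmissibleSymbol N κ φ a y)
    (hb : ∀ i, DifferentiableAt ℝ (b i) y) (hc : DifferentiableAt ℝ c y) (k : ι) :
    HasPD k (lowerPotential τ s φ b c) (σ * (s * pd k φ y) * ∑ i, b i y * pd i φ y +
      σ * ∑ i, (pd k (b i) y * pd i φ y + b i y * pd k (pd i φ) y) - pd k c y) y :=
  ((hasPD_largeParam (.of_differentiableAt ha.differentiableAt_weight)).mul
    (.sum fun i : ι => .mul (.of_differentiableAt (hb i)) (.of_differentiableAt
      (differentiableAt_pd ha.contDiffAt_weight)))).sub (.of_differentiableAt hc)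

theorem norm_lowerPotential_le (ha : IsAdmissibleSymbol N κ φ a y)
    (hb : IsSubordinate ε σ b c y) :
    ‖lowerPotential τ s φ b c y‖ ≤ 2 * N ^ 2 * (ε * σ ^ 2) := by
  have hσ := hb.pos
  have hε := hb.nonneg
  have hN := ha.nonneg
  have hN₂ : 1 * (ε * σ ^ 2) ≤ N ^ 2 * (ε * σ ^ 2) := by
    gcongr; exact one_le_pow₀ ha.one_le
  refine (norm_sub_le_of_le (norm_mul_le_of_le (Real.norm_of_nonneg hσ.le).le
    (norm_sum_le_mul (m := ε * σ * N) ha.card_le (by positivity) fun i =>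
      norm_mul_le_of_le (hb.norm_drift_le i) (ha.norm_pd_weight_le i)))
    hb.norm_potential_le).trans ?_
  linarith

theorem norm_pd_lowerPotential_le (hs : 1 ≤ s) (ha : IsAdmissibleSymbol N κ φ a y)
    (hb : IsSubordinate ε σ b c y) (k : ι) :
    ‖pd k (lowerPotential τ s φ b c) y‖ ≤ 4 * s * N ^ 3 * (ε * σ ^ 2) := by
  have hσ := hb.pos
  have hε := hb.nonneg
  have hN := ha.nonneg
  have hσ' := (Real.norm_of_nonneg hσ.le).le
  have hs' := (Real.norm_of_nonneg (zero_le_one.trans hs)).le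
  have hεσ : 0 ≤ ε * σ ^ 2 := by positivity
  have hN₀ := ha.mul_pow_le_mul_mul_pow hs hεσ (Nat.zero_le 3)
  have hN₂ := ha.mul_pow_le_mul_mul_pow hs hεσ (show 2 ≤ 3 by norm_num)
  rw [(hasPD_lowerPotential ha hb.differentiableAt_drift hb.differentiableAt_potential k).pd_eq]
  refine (norm_sub_le_of_le (norm_add_le_of_le (norm_mul_le_of_le (norm_mul_le_of_le hσ'
    (norm_mul_le_of_le hs' (ha.norm_pd_weight_le k))) (norm_sum_le_mul (m := ε * σ * N)
      ha.card_le (by positivity) fun i =>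
        norm_mul_le_of_le (hb.norm_drift_le i) (ha.norm_pd_weight_le i)))
    (norm_mul_le_of_le hσ' (norm_sum_le_mul (m := ε * σ * N + ε * σ * N) ha.card_le
      (by positivity) fun i => norm_add_le_of_le
        (norm_mul_le_of_le (hb.norm_pd_drift_le k i) (ha.norm_pd_weight_le i))
        (norm_mul_le_of_le (hb.norm_drift_le i) (ha.norm_pd_pd_weight_le k i)))))
    (hb.norm_pd_potential_le k)).trans ?_
  linarith

theorem hasPD_multiplierGain (ha : IsAdmissibleSymbol N κ φ a y) (k : ι) :
    HasPD k (multiplierGain τ s φ a) (2 * s * (σ * (s * pd k φ y) * dirichletEnergy a φ y +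
      σ * pd k (dirichletEnergy a φ) y)) y :=
  ((hasPD_largeParam (.of_differentiableAt ha.differentiableAt_weight)).mul
    (.of_differentiableAt (differentiableAt_dirichletEnergy ha.differentiableAt_coeff
      ha.contDiffAt_weight))).const_mul (2 * s)

theorem norm_multiplierGain_le (hs : 1 ≤ s) (ha : IsAdmissibleSymbol N κ φ a y) (hσ : 0 ≤ σ) :
    ‖multiplierGain τ s φ a y‖ ≤ 2 * s * N ^ 5 * σ := by
  have hs' := (Real.norm_of_nonneg (zero_le_one.trans hs)).le
  refine (norm_mul_le_of_le (norm_mul_le_of_le (Real.norm_ofNat 2).le hs')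
    (norm_mul_le_of_le (Real.norm_of_nonneg hσ).le ha.norm_dirichletEnergy_weight_le)).trans_eq ?_
  ring

theorem norm_pd_multiplierGain_le (hs : 1 ≤ s) (ha : IsAdmissibleSymbol N κ φ a y) (hσ : 0 ≤ σ)
    (k : ι) : ‖pd k (multiplierGain τ s φ a) y‖ ≤ 8 * s ^ 2 * N ^ 6 * σ := by
  have hs' := (Real.norm_of_nonneg (zero_le_one.trans hs)).le
  have hσ' := (Real.norm_of_nonneg hσ).le
  have hN := ha.mul_pow_le_mul_mul_pow hs (show 0 ≤ s * σ by positivity) (show 5 ≤ 6 by norm_num)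
  rw [(hasPD_multiplierGain ha k).pd_eq]
  refine (norm_mul_le_of_le (norm_mul_le_of_le (Real.norm_ofNat 2).le hs') (norm_add_le_of_le
    (norm_mul_le_of_le (norm_mul_le_of_le hσ' (norm_mul_le_of_le hs' (ha.norm_pd_weight_le k)))
      ha.norm_dirichletEnergy_weight_le)
    (norm_mul_le_of_le hσ' (ha.norm_pd_dirichletEnergy_weight_le k)))).trans ?_
  linarith

theorem hasPD_conjPotential (ha : IsAdmissibleSymbol N κ φ a y)
    (hb : ∀ i, DifferentiableAt ℝ (b i) y) (hc : DifferentiableAt ℝ c y) (k : ι) :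
    HasPD k (conjPotential τ s φ a b c) (σ ^ 2 * (2 * s * pd k φ y * dirichletEnergy a φ y +
      pd k (dirichletEnergy a φ) y) + pd k (lowerPotential τ s φ b c) y) y := by
  have hσ : HasPD k (largeParam τ s φ) _ y :=
    hasPD_largeParam (.of_differentiableAt ha.differentiableAt_weight)
  have hV₁ := hasPD_lowerPotential (τ := τ) (s := s) ha hb hc k
  unfold conjPotential
  simp only [pow_two]
  refine (((hσ.mul hσ).mul (.of_differentiableAt (differentiableAt_dirichletEnergy
    ha.differentiableAt_coeff ha.contDiffAt_weight))).add hV₁).congr_deriv ?_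
  rw [hV₁.pd_eq]
  ring

theorem norm_conjPotential_le (ha : IsAdmissibleSymbol N κ φ a y)
    (hb : IsSubordinate ε σ b c y) : ‖conjPotential τ s φ a b c y‖ ≤ 3 * N ^ 5 * σ ^ 2 := by
  have hN := ha.nonneg
  refine (norm_add_le_of_le (norm_mul_le_of_le (Real.norm_of_nonneg (sq_nonneg _)).le
    ha.norm_dirichletEnergy_weight_le) (norm_lowerPotential_le ha hb)).trans ?_
  have hε := hb.nonneg
  have : N ^ 2 * (ε * σ ^ 2) ≤ N ^ 5 * (1 * σ ^ 2) :=
    mul_le_mul (ha.pow_le_pow (by norm_num)) (by gcongr; exact hb.le_one) (by positivity)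
      (by positivity)
  linarith

end ConjugatedCoefficients

section CommutatorBound

variable {ι : Type*} [Fintype ι] [DecidableEq ι] {N κ τ s ε : ℝ} {φ w : EuclideanSpace ℝ ι → ℝ}
  {a : ι → ι → EuclideanSpace ℝ ι → ℝ} {b : ι → EuclideanSpace ℝ ι → ℝ}
  {c : EuclideanSpace ℝ ι → ℝ} {y : EuclideanSpace ℝ ι}

/-- The energy density `σ |∇w|² + σ³ w²` controlled by the commutator. -/
def carlemanEnergy (σ : ℝ) (w : EuclideanSpace ℝ ι → ℝ) (y : EuclideanSpace ℝ ι) : ℝ :=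
  σ * ‖grad w y‖ ^ 2 + σ ^ 3 * w y ^ 2

theorem carlemanEnergy_nonneg {σ : ℝ} (hσ : 0 ≤ σ) : 0 ≤ carlemanEnergy σ w y := by
  unfold carlemanEnergy; positivity

local notation "σ" => largeParam τ s φ y

theorem stressForm_conjDrift (ha : IsAdmissibleSymbol N κ φ a y)
    (hb : ∀ i, DifferentiableAt ℝ (b i) y) :
    stressForm a (conjDrift τ s φ a b) w y = 2 * σ * stressForm a (coGradient a φ) w y +
      2 * s * σ * (∑ l, coGradient a φ l y * pd l w y) ^ 2 -
      s * σ * dirichletEnergy a φ y * dirichletEnergy a w y + stressForm a b w y := by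
  have hσ : ∀ k, HasPD k (fun z => 2 * largeParam τ s φ z) (2 * (σ * (s * pd k φ y))) y :=
    fun k => (hasPD_largeParam (.of_differentiableAt ha.differentiableAt_weight)).const_mul 2
  have hσd : DifferentiableAt ℝ (fun z => 2 * largeParam τ s φ z) y :=
    ((contDiffAt_largeParam ha.contDiffAt_weight).differentiableAt two_ne_zero).const_mul 2
  have hq := differentiableAt_coGradient ha.differentiableAt_coeff ha.contDiffAt_weight
  have conormal_comm : ∑ k, coGradient a w k y * (2 * (σ * (s * pd k φ y))) =
      2 * s * σ * ∑ k, coGradient a φ k y * pd k w y := by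
    rw [sum_coGradient_mul_pd_comm ha.symm, Finset.mul_sum]
    exact Finset.sum_congr rfl fun k _ => by ring
  have weight_term : ∑ k, 2 * (σ * (s * pd k φ y)) * coGradient a φ k y =
      2 * s * σ * dirichletEnergy a φ y := by
    rw [dirichletEnergy, Finset.mul_sum]
    exact Finset.sum_congr rfl fun k _ => by ring
  calc stressForm a (conjDrift τ s φ a b) w y
      = stressForm a (fun l z => 2 * largeParam τ s φ z * coGradient a φ l z) w y +
          stressForm a b w y := stressForm_add (fun l => hσd.mul (hq l)) hb
    _ = _ := by
      rw [stressForm_mul hσd hq]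
      simp only [(hσ _).pd_eq, conormal_comm, weight_term]
      ring

theorem le_stressForm_conjDrift (hs : 1 ≤ s) (hκ : 0 ≤ κ) (ha : IsAdmissibleSymbol N κ φ a y)
    (hb : IsSubordinate ε σ b c y) :
    (s * κ ^ 2 - 8 * N ^ 7 - 2 * N ^ 4 * ε) * (σ * ‖grad w y‖ ^ 2) ≤
      stressForm a (conjDrift τ s φ a b) w y +
        multiplierGain τ s φ a y * dirichletEnergy a w y := by
  have hσ := hb.pos
  have hε := hb.nonneg
  have hN := ha.nonneg
  have hN₃ : N ^ 3 ≤ 2 * N ^ 3 := by linarith [pow_nonneg hN 3]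
  have drift_stress := neg_le_of_abs_le (ha.norm_stressForm_le (w := w) (by positivity)
    hb.norm_drift_le hb.norm_pd_drift_le)
  have conormal_stress := neg_le_of_abs_le (ha.norm_stressForm_le (w := w) (by positivity)
    (fun l => (ha.norm_coGradient_weight_le l).trans hN₃) ha.norm_pd_coGradient_weight_le)
  have principal : s * σ * (κ * (κ * ‖grad w y‖ ^ 2)) ≤
      s * σ * (dirichletEnergy a φ y * dirichletEnergy a w y) := by
    have := hκ.trans ha.noncharacteristic
    gcongr
    exacts [ha.noncharacteristic, ha.mul_norm_grad_sq_le]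
  have conormal_sq : 0 ≤ 2 * s * σ * (∑ l, coGradient a φ l y * pd l w y) ^ 2 := by positivity
  rw [stressForm_conjDrift ha hb.differentiableAt_drift, multiplierGain]
  linarith [mul_le_mul_of_nonneg_left conormal_stress (show 0 ≤ 2 * σ by positivity)]

/-- The part of `potentialForm` for the conjugated coefficients that contains `b` or `c`. -/
def lowerPotentialForm (τ s : ℝ) (φ : EuclideanSpace ℝ ι → ℝ)
    (a : ι → ι → EuclideanSpace ℝ ι → ℝ) (b : ι → EuclideanSpace ℝ ι → ℝ)
    (c : EuclideanSpace ℝ ι → ℝ) (y : EuclideanSpace ℝ ι) : ℝ :=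
  1 / 2 * (largeParam τ s φ y ^ 2 * dirichletEnergy a φ y * divergence b y) +
    1 / 2 * (lowerPotential τ s φ b c y * divergence (conjDrift τ s φ a b) y) +
    1 / 2 * (largeParam τ s φ y ^ 2 * ∑ l, b l y * (2 * s * pd l φ y * dirichletEnergy a φ y +
      pd l (dirichletEnergy a φ) y)) +
    1 / 2 * (∑ l, conjDrift τ s φ a b l y * pd l (lowerPotential τ s φ b c) y) -
    lowerPotential τ s φ b c y * multiplierGain τ s φ a y

theorem divergence_conjDrift (ha : IsAdmissibleSymbol N κ φ a y)
    (hb : ∀ i, DifferentiableAt ℝ (b i) y) :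
    divergence (conjDrift τ s φ a b) y = 2 * s * σ * dirichletEnergy a φ y +
      2 * σ * divergence (coGradient a φ) y + divergence b y := by
  simp only [divergence, (hasPD_conjDrift ha hb _ _).pd_eq, Finset.sum_add_distrib,
    dirichletEnergy, Finset.mul_sum]
  congr 2
  exact Finset.sum_congr rfl fun k _ => by ring

theorem potentialForm_conj (ha : IsAdmissibleSymbol N κ φ a y)
    (hb : ∀ i, DifferentiableAt ℝ (b i) y) (hc : DifferentiableAt ℝ c y) :
    potentialForm (conjDrift τ s φ a b) (conjPotential τ s φ a b c) (multiplierGain τ s φ a) y =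
      σ ^ 3 * (s * dirichletEnergy a φ y ^ 2 +
        dirichletEnergy a φ y * divergence (coGradient a φ) y +
        ∑ l, coGradient a φ l y * pd l (dirichletEnergy a φ) y) +
      lowerPotentialForm τ s φ a b c y := by
  have transport : ∑ l, conjDrift τ s φ a b l y * pd l (conjPotential τ s φ a b c) y =
      4 * s * σ ^ 3 * dirichletEnergy a φ y * dirichletEnergy a φ y +
        2 * σ ^ 3 * ∑ l, coGradient a φ l y * pd l (dirichletEnergy a φ) y +
        σ ^ 2 * ∑ l, b l y * (2 * s * pd l φ y * dirichletEnergy a φ y +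
          pd l (dirichletEnergy a φ) y) +
        ∑ l, conjDrift τ s φ a b l y * pd l (lowerPotential τ s φ b c) y := by
    have energy : dirichletEnergy a φ y = ∑ l, coGradient a φ l y * pd l φ y := rfl
    rw [mul_assoc _ (dirichletEnergy a φ y)]
    nth_rewrite 2 [energy]
    simp only [(hasPD_conjPotential ha hb hc _).pd_eq, Finset.mul_sum, ← Finset.sum_add_distrib,
      conjDrift]
    exact Finset.sum_congr rfl fun l _ => by ring
  rw [potentialForm, transport, lowerPotentialForm, conjPotential, multiplierGain]
  linear_combination (1 / 2 * σ ^ 2 * dirichletEnergy a φ y) *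
    divergence_conjDrift (τ := τ) (s := s) ha hb

theorem norm_lowerPotentialForm_le (hs : 1 ≤ s) (ha : IsAdmissibleSymbol N κ φ a y)
    (hb : IsSubordinate ε σ b c y) :
    ‖lowerPotentialForm τ s φ a b c y‖ ≤ 20 * s * N ^ 7 * (ε * σ ^ 3) := by
  have hσ := hb.pos
  have hε := hb.nonneg
  have hN := ha.nonneg
  have hεσ : 0 ≤ ε * σ ^ 3 := by positivity
  have hN₆ := ha.mul_pow_le_mul_mul_pow hs hεσ (show 6 ≤ 7 by norm_num)
  have hσ' := (Real.norm_of_nonneg (sq_nonneg (σ))).le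
  have hhalf : ‖(1 / 2 : ℝ)‖ ≤ 1 / 2 := by norm_num
  have h2s : ‖2 * s‖ ≤ 2 * s := (Real.norm_of_nonneg (by positivity)).le
  have hV := norm_lowerPotential_le ha hb
  refine (norm_sub_le_of_le (norm_add_le_of_le (norm_add_le_of_le (norm_add_le_of_le
    (norm_mul_le_of_le hhalf (norm_mul_le_of_le
      (norm_mul_le_of_le hσ' ha.norm_dirichletEnergy_weight_le)
      (ha.norm_divergence_le (fun k => hb.norm_pd_drift_le k k) (by positivity))))
    (norm_mul_le_of_le hhalf (norm_mul_le_of_le hV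
      (ha.norm_divergence_le (fun k => norm_pd_conjDrift_le hs ha hb k k) (by positivity)))))
    (norm_mul_le_of_le hhalf (norm_mul_le_of_le hσ'
      (norm_sum_le_mul (m := ε * σ * (2 * s * N * N ^ 5 + 3 * N ^ 5)) ha.card_le (by positivity)
        fun l => norm_mul_le_of_le (hb.norm_drift_le l) (norm_add_le_of_le
          (norm_mul_le_of_le (norm_mul_le_of_le h2s (ha.norm_pd_weight_le l))
            ha.norm_dirichletEnergy_weight_le) (ha.norm_pd_dirichletEnergy_weight_le l))))))
    (norm_mul_le_of_le hhalf (norm_sum_le_mul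
      (m := 3 * N ^ 3 * σ * (4 * s * N ^ 3 * (ε * σ ^ 2))) ha.card_le (by positivity)
        fun l => norm_mul_le_of_le (norm_conjDrift_le ha hb l)
          (norm_pd_lowerPotential_le hs ha hb l))))
    (norm_mul_le_of_le hV (norm_multiplierGain_le hs ha hσ.le))).trans ?_
  linarith

theorem le_potentialForm_conj (hs : 1 ≤ s) (hκ : 0 ≤ κ) (ha : IsAdmissibleSymbol N κ φ a y)
    (hb : IsSubordinate ε σ b c y) :
    (s * κ ^ 2 - 5 * N ^ 9 - 20 * s * N ^ 7 * ε) * σ ^ 3 ≤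
      potentialForm (conjDrift τ s φ a b) (conjPotential τ s φ a b c)
        (multiplierGain τ s φ a) y := by
  have hσ := hb.pos
  have hN := ha.nonneg
  have lower := neg_le_of_abs_le (norm_lowerPotentialForm_le hs ha hb)
  have principal : s * κ ^ 2 ≤ s * dirichletEnergy a φ y ^ 2 := by
    gcongr; exact ha.noncharacteristic
  have curvature : ‖dirichletEnergy a φ y * divergence (coGradient a φ) y +
      ∑ l, coGradient a φ l y * pd l (dirichletEnergy a φ) y‖ ≤ 5 * N ^ 9 :=
    (norm_add_le_of_le (norm_mul_le_of_le ha.norm_dirichletEnergy_weight_le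
      (ha.norm_divergence_le (fun k => ha.norm_pd_coGradient_weight_le k k) (by positivity)))
      (norm_sum_le_mul (m := N ^ 3 * (3 * N ^ 5)) ha.card_le (by positivity) fun l =>
        norm_mul_le_of_le (ha.norm_coGradient_weight_le l)
          (ha.norm_pd_dirichletEnergy_weight_le l))).trans_eq (by ring)
  have leading := mul_le_mul_of_nonneg_left (add_le_add principal (neg_le_of_abs_le curvature))
    (show 0 ≤ σ ^ 3 by positivity)
  rw [potentialForm_conj ha hb.differentiableAt_drift hb.differentiableAt_potential]
  linarith

theorem mul_abs_mul_norm_grad_le {σ₀ : ℝ} (hσ : 0 ≤ σ₀) (h : 1 ≤ ε * σ₀) :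
    σ₀ * (|w y| * ‖grad w y‖) ≤ ε / 2 * carlemanEnergy σ₀ w y := by
  have amgm := two_mul_le_add_sq (σ₀ * |w y|) ‖grad w y‖
  rw [mul_pow, sq_abs] at amgm
  calc σ₀ * (|w y| * ‖grad w y‖) = 1 * (σ₀ * (|w y| * ‖grad w y‖)) := by ring
    _ ≤ ε * σ₀ * (σ₀ * (|w y| * ‖grad w y‖)) := by gcongr
    _ = ε * σ₀ / 2 * (2 * (σ₀ * |w y|) * ‖grad w y‖) := by ring
    _ ≤ ε * σ₀ / 2 * (σ₀ ^ 2 * w y ^ 2 + ‖grad w y‖ ^ 2) := by gcongr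
    _ = ε / 2 * carlemanEnergy σ₀ w y := by unfold carlemanEnergy; ring

theorem norm_mul_sum_pd_multiplierGain_le (hs : 1 ≤ s) (ha : IsAdmissibleSymbol N κ φ a y)
    (hb : IsSubordinate ε σ b c y) :
    ‖w y * ∑ k, coGradient a w k y * pd k (multiplierGain τ s φ a) y‖ ≤
      4 * s ^ 2 * N ^ 9 * ε * carlemanEnergy (σ) w y := by
  have hσ := hb.pos
  have hN := ha.nonneg
  calc ‖w y * ∑ k, coGradient a w k y * pd k (multiplierGain τ s φ a) y‖
      ≤ |w y| * (N * (N ^ 2 * ‖grad w y‖ * (8 * s ^ 2 * N ^ 6 * σ))) :=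
        norm_mul_le_of_le le_rfl (norm_sum_le_mul ha.card_le (by positivity) fun k =>
          norm_mul_le_of_le ha.norm_coGradient_grad_le
            (norm_pd_multiplierGain_le hs ha hσ.le k))
    _ = 8 * s ^ 2 * N ^ 9 * (σ * (|w y| * ‖grad w y‖)) := by ring
    _ ≤ 8 * s ^ 2 * N ^ 9 * (ε / 2 * carlemanEnergy (σ) w y) := by
        gcongr ?_ * ?_
        exact mul_abs_mul_norm_grad_le hσ.le hb.one_le_mul
    _ = 4 * s ^ 2 * N ^ 9 * ε * carlemanEnergy (σ) w y := by ring

theorem le_commutatorForm_conj (hs : 1 ≤ s) (hκ : 0 ≤ κ) (ha : IsAdmissibleSymbol N κ φ a y)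
    (hb : IsSubordinate ε σ b c y) :
    (s * κ ^ 2 - 8 * N ^ 9 - 24 * s ^ 2 * N ^ 9 * ε) * carlemanEnergy (σ) w y ≤
      commutatorForm a (conjDrift τ s φ a b) (conjPotential τ s φ a b c)
        (multiplierGain τ s φ a) w y := by
  have hσ := hb.pos
  have hε := hb.nonneg
  have hN := ha.nonneg
  have gradient := le_stressForm_conjDrift (w := w) hs hκ ha hb
  have zeroth := mul_le_mul_of_nonneg_right (le_potentialForm_conj hs hκ ha hb) (sq_nonneg (w y))
  have cross := neg_le_of_abs_le (norm_mul_sum_pd_multiplierGain_le (w := w) hs ha hb)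
  have gradient_const : s * κ ^ 2 - 8 * N ^ 9 - 20 * s ^ 2 * N ^ 9 * ε ≤
      s * κ ^ 2 - 8 * N ^ 7 - 2 * N ^ 4 * ε := by
    have h₁ := ha.pow_le_pow (show 7 ≤ 9 by norm_num)
    have h₂ := ha.mul_pow_le_mul_mul_pow (x := s * ε) hs (by positivity) (show 4 ≤ 9 by norm_num)
    have h₃ : 0 ≤ N ^ 9 * ε := by positivity
    have h₄ := mul_le_mul_of_nonneg_right hs (show 0 ≤ N ^ 4 * ε by positivity)
    nlinarith
  have zeroth_const : s * κ ^ 2 - 8 * N ^ 9 - 20 * s ^ 2 * N ^ 9 * ε ≤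
      s * κ ^ 2 - 5 * N ^ 9 - 20 * s * N ^ 7 * ε := by
    have h₂ := ha.mul_pow_le_mul_mul_pow (x := s * ε) hs (by positivity) (show 7 ≤ 9 by norm_num)
    linarith [pow_nonneg hN 9]
  have gradient' := mul_le_mul_of_nonneg_right gradient_const
    (show 0 ≤ σ * ‖grad w y‖ ^ 2 by positivity)
  have zeroth' := mul_le_mul_of_nonneg_right zeroth_const (show 0 ≤ σ ^ 3 * w y ^ 2 by positivity)
  unfold carlemanEnergy at cross ⊢
  unfold commutatorForm
  linarith

end CommutatorBound

section PointwiseEstimate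

variable {ι : Type*} [Fintype ι] [DecidableEq ι] {N κ τ s ε : ℝ} {φ v w : EuclideanSpace ℝ ι → ℝ}
  {a : ι → ι → EuclideanSpace ℝ ι → ℝ} {b : ι → EuclideanSpace ℝ ι → ℝ}
  {c : EuclideanSpace ℝ ι → ℝ} {y : EuclideanSpace ℝ ι}

/-- The density `e^{2τψ} (σ |∇v|² + σ³ v²)`, with `ψ = e^{sφ}` and `σ = τ s ψ`, of the norms in a
Carleman estimate. -/
def carlemanDensity (τ s : ℝ) (φ v : EuclideanSpace ℝ ι → ℝ) (y : EuclideanSpace ℝ ι) : ℝ :=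
  expWeight τ s φ y ^ 2 * carlemanEnergy (largeParam τ s φ y) v y

local notation "σ" => largeParam τ s φ y

theorem norm_add_smul_sq_le {F : Type*} [SeminormedAddCommGroup F] [NormedSpace ℝ F] (p q : F)
    (r : ℝ) : ‖p + r • q‖ ^ 2 ≤ 2 * (‖p‖ ^ 2 + ‖q‖ ^ 2 * r ^ 2) := by
  have hr : ‖r • q‖ ^ 2 = ‖q‖ ^ 2 * r ^ 2 := by
    rw [norm_smul, mul_pow, Real.norm_eq_abs, sq_abs, mul_comm]
  calc ‖p + r • q‖ ^ 2 ≤ (‖p‖ + ‖r • q‖) ^ 2 := by gcongr; exact norm_add_le _ _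
    _ ≤ 2 * (‖p‖ ^ 2 + ‖r • q‖ ^ 2) := add_sq_le
    _ = _ := by rw [hr]

theorem IsAdmissibleSymbol.norm_grad_weight_sq_le (ha : IsAdmissibleSymbol N κ φ a y) :
    ‖grad φ y‖ ^ 2 ≤ N ^ 3 := by
  calc ‖grad φ y‖ ^ 2 = ∑ k, ‖pd k φ y‖ ^ 2 := EuclideanSpace.norm_sq_eq _
    _ ≤ ∑ _k : ι, N ^ 2 := by gcongr with k; exact ha.norm_pd_weight_le k
    _ = Fintype.card ι * N ^ 2 := by simp
    _ ≤ N * N ^ 2 := by gcongr; exact ha.card_le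
    _ = N ^ 3 := by ring

theorem IsAdmissibleSymbol.carlemanEnergy_conjugate_le (ha : IsAdmissibleSymbol N κ φ a y)
    (hσ : 0 ≤ σ) (hv : DifferentiableAt ℝ v y) :
    carlemanEnergy (σ) (conjugate τ s φ v) y ≤ 3 * N ^ 3 * carlemanDensity τ s φ v y := by
  have hN := one_le_pow₀ ha.one_le (n := 3)
  have gradient : ‖grad (conjugate τ s φ v) y‖ ^ 2 ≤ 2 * (expWeight τ s φ y ^ 2 * ‖grad v y‖ ^ 2 +
      N ^ 3 * (σ * conjugate τ s φ v y) ^ 2) := by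
    rw [grad_conjugate ha.differentiableAt_weight hv]
    refine (norm_add_smul_sq_le _ _ _).trans ?_
    rw [norm_smul, mul_pow, Real.norm_eq_abs, sq_abs]
    gcongr
    exact ha.norm_grad_weight_sq_le
  have gradient_const := mul_le_mul_of_nonneg_right (show 2 ≤ 3 * N ^ 3 by linarith)
    (show 0 ≤ expWeight τ s φ y ^ 2 * (σ * ‖grad v y‖ ^ 2) by positivity)
  have zeroth_const := mul_le_mul_of_nonneg_right hN
    (show 0 ≤ expWeight τ s φ y ^ 2 * (σ ^ 3 * v y ^ 2) by positivity)
  have := mul_le_mul_of_nonneg_left gradient hσ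
  simp only [carlemanEnergy, carlemanDensity, conjugate] at this ⊢
  linarith

theorem IsAdmissibleSymbol.carlemanDensity_le (ha : IsAdmissibleSymbol N κ φ a y)
    (hσ : 0 ≤ σ) (hv : DifferentiableAt ℝ v y) :
    carlemanDensity τ s φ v y ≤ 3 * N ^ 3 * carlemanEnergy (σ) (conjugate τ s φ v) y := by
  have hN := one_le_pow₀ ha.one_le (n := 3)
  have gradient : expWeight τ s φ y ^ 2 * ‖grad v y‖ ^ 2 ≤
      2 * (‖grad (conjugate τ s φ v) y‖ ^ 2 + N ^ 3 * (σ * conjugate τ s φ v y) ^ 2) := by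
    have grad_eq : expWeight τ s φ y • grad v y = grad (conjugate τ s φ v) y +
        (-(σ * conjugate τ s φ v y)) • grad φ y := by
      rw [grad_conjugate ha.differentiableAt_weight hv, neg_smul, add_neg_cancel_right]
    calc expWeight τ s φ y ^ 2 * ‖grad v y‖ ^ 2 = ‖expWeight τ s φ y • grad v y‖ ^ 2 := by
          rw [norm_smul, mul_pow, Real.norm_eq_abs, sq_abs]
      _ ≤ _ := by
          rw [grad_eq, ← neg_sq (σ * conjugate τ s φ v y)]
          refine (norm_add_smul_sq_le _ _ _).trans ?_
          gcongr
          exact ha.norm_grad_weight_sq_le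
  have gradient_const := mul_le_mul_of_nonneg_right (show 2 ≤ 3 * N ^ 3 by linarith)
    (show 0 ≤ σ * ‖grad (conjugate τ s φ v) y‖ ^ 2 by positivity)
  have zeroth_const := mul_le_mul_of_nonneg_right hN
    (show 0 ≤ σ ^ 3 * conjugate τ s φ v y ^ 2 by positivity)
  have := mul_le_mul_of_nonneg_left gradient hσ
  have density_eq : carlemanDensity τ s φ v y = σ * (expWeight τ s φ y ^ 2 * ‖grad v y‖ ^ 2) +
      σ ^ 3 * conjugate τ s φ v y ^ 2 := by
    simp only [carlemanDensity, carlemanEnergy, conjugate]; ring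
  rw [density_eq, carlemanEnergy]
  linarith

theorem conjRemainder_sq_le (hs : 1 ≤ s) (ha : IsAdmissibleSymbol N κ φ a y) (hσ : 0 ≤ σ)
    (hεσ : 1 ≤ ε * σ) :
    conjRemainder τ s φ a w y ^ 2 ≤ 8 * s ^ 2 * N ^ 10 * ε * carlemanEnergy (σ) w y := by
  have hN := ha.nonneg
  have hs' := (Real.norm_of_nonneg (zero_le_one.trans hs)).le
  have bound : ‖conjRemainder τ s φ a w y‖ ≤
      N * (N * (N * ‖grad w y‖)) + σ * (N * (N * (N * N)) + s * N ^ 5) * ‖w y‖ :=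
    norm_add_le_of_le (norm_sum_le_mul ha.card_le (by positivity) fun i =>
      norm_sum_le_mul ha.card_le (by positivity) fun j =>
        norm_mul_le_of_le (ha.norm_pd_coeff_le i i j) (norm_pd_le_norm_grad j))
      (norm_mul_le_of_le (norm_mul_le_of_le (Real.norm_of_nonneg hσ).le
        (norm_sub_le_of_le (norm_sum_le_mul ha.card_le (by positivity) fun i =>
          norm_sum_le_mul ha.card_le (by positivity) fun j =>
            norm_mul_le_of_le (ha.norm_coeff_le i j) (ha.norm_pd_pd_weight_le i j))
          (norm_mul_le_of_le hs' ha.norm_dirichletEnergy_weight_le))) le_rfl)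
  have bound' : ‖conjRemainder τ s φ a w y‖ ≤ 2 * s * N ^ 5 * (‖grad w y‖ + σ * ‖w y‖) := by
    have h₃ := ha.mul_pow_le_mul_mul_pow hs (norm_nonneg (grad w y)) (show 3 ≤ 5 by norm_num)
    have h₄ := ha.mul_pow_le_mul_mul_pow hs (show 0 ≤ σ * ‖w y‖ by positivity)
      (show 4 ≤ 5 by norm_num)
    have : 0 ≤ s * N ^ 5 * ‖grad w y‖ := by positivity
    linarith
  calc conjRemainder τ s φ a w y ^ 2
      = ‖conjRemainder τ s φ a w y‖ ^ 2 := by rw [Real.norm_eq_abs, sq_abs]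
    _ ≤ (2 * s * N ^ 5 * (‖grad w y‖ + σ * ‖w y‖)) ^ 2 := by gcongr
    _ = 4 * s ^ 2 * N ^ 10 * (‖grad w y‖ + σ * ‖w y‖) ^ 2 := by ring
    _ ≤ 4 * s ^ 2 * N ^ 10 * (2 * (‖grad w y‖ ^ 2 + (σ * ‖w y‖) ^ 2)) := by
        gcongr; exact add_sq_le
    _ = 8 * s ^ 2 * N ^ 10 * (1 * (‖grad w y‖ ^ 2 + σ ^ 2 * w y ^ 2)) := by
        rw [mul_pow, Real.norm_eq_abs (w y), sq_abs]; ring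
    _ ≤ 8 * s ^ 2 * N ^ 10 * (ε * σ * (‖grad w y‖ ^ 2 + σ ^ 2 * w y ^ 2)) := by gcongr
    _ = 8 * s ^ 2 * N ^ 10 * ε * carlemanEnergy (σ) w y := by unfold carlemanEnergy; ring

theorem norm_multiplierFlux_le (hs : 1 ≤ s) (ha : IsAdmissibleSymbol N κ φ a y)
    (hb : IsSubordinate ε σ b c y) (k : ι) :
    ‖multiplierFlux a (conjDrift τ s φ a b) (conjPotential τ s φ a b c) (multiplierGain τ s φ a)
      w k y‖ ≤ 6 * s * N ^ 8 * carlemanEnergy (σ) w y := by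
  have hσ := hb.pos
  have hN := ha.nonneg
  have hhalf : ‖(1 / 2 : ℝ)‖ ≤ 1 / 2 := by norm_num
  have hw : ‖w y ^ 2‖ ≤ w y ^ 2 := (Real.norm_of_nonneg (sq_nonneg _)).le
  have hE := carlemanEnergy_nonneg (w := w) (y := y) hσ.le
  have cross : σ * (‖w y‖ * ‖grad w y‖) ≤ 1 / 2 * carlemanEnergy (σ) w y := by
    refine (mul_abs_mul_norm_grad_le hσ.le hb.one_le_mul).trans ?_
    gcongr
    exact hb.le_one
  have h₈ := ha.mul_pow_le_mul_mul_pow hs hE (le_refl 8)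
  have h₆ := mul_le_mul_of_nonneg_right (ha.pow_le_pow (show 6 ≤ 8 by norm_num))
    (show 0 ≤ σ * ‖grad w y‖ ^ 2 by positivity)
  have h₇ : s * (N ^ 7 * (σ * (‖w y‖ * ‖grad w y‖))) ≤
      s * (N ^ 8 * (1 / 2 * carlemanEnergy (σ) w y)) := by
    have := ha.pow_le_pow (show 7 ≤ 8 by norm_num)
    gcongr
  have h : 0 ≤ s * N ^ 8 * carlemanEnergy (σ) w y := by positivity
  have bound := norm_sub_le_of_le (norm_mul_le_of_le (norm_conjDrift_le ha hb k)
    (norm_mul_le_of_le hhalf (norm_sub_le_of_le (ha.norm_dirichletEnergy_grad_le (w := w))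
      (norm_mul_le_of_le (norm_conjPotential_le ha hb) hw))))
    (norm_mul_le_of_le (ha.norm_coGradient_grad_le (w := w) (k := k))
      (norm_add_le_of_le (norm_sum_le_mul (m := 3 * N ^ 3 * σ * ‖grad w y‖) ha.card_le
        (by positivity) fun l => norm_mul_le_of_le (norm_conjDrift_le ha hb l)
          (norm_pd_le_norm_grad l))
        (norm_mul_le_of_le (norm_multiplierGain_le hs ha hσ.le) (le_refl ‖w y‖))))
  refine bound.trans ?_
  unfold carlemanEnergy at *
  linarith

end PointwiseEstimate

section CarlemanFlux

variable {ι : Type*} [Fintype ι] [DecidableEq ι] {N κ τ s ε : ℝ} {φ v w : EuclideanSpace ℝ ι → ℝ}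
  {a : ι → ι → EuclideanSpace ℝ ι → ℝ} {b : ι → EuclideanSpace ℝ ι → ℝ}
  {c : EuclideanSpace ℝ ι → ℝ} {y : EuclideanSpace ℝ ι}

/-- The flux of the Carleman identity: `multiplierFlux` for the conjugated operator and function. -/
def carlemanFlux (τ s : ℝ) (φ : EuclideanSpace ℝ ι → ℝ) (a : ι → ι → EuclideanSpace ℝ ι → ℝ)
    (b : ι → EuclideanSpace ℝ ι → ℝ) (c v : EuclideanSpace ℝ ι → ℝ) :
    ι → EuclideanSpace ℝ ι → ℝ :=
  multiplierFlux a (conjDrift τ s φ a b) (conjPotential τ s φ a b c) (multiplierGain τ s φ a)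
    (conjugate τ s φ v)

local notation "σ" => largeParam τ s φ y

theorem contDiffAt_coGradient (ha : ∀ i j, ContDiffAt ℝ 1 (a i j) y) (hw : ContDiffAt ℝ 2 w y)
    (k : ι) : ContDiffAt ℝ 1 (coGradient a w k) y := by
  have := fun j : ι => contDiffAt_pd (k := j) (m := 1) hw (by norm_num)
  unfold coGradient; fun_prop

theorem contDiffAt_dirichletEnergy (ha : ∀ i j, ContDiffAt ℝ 1 (a i j) y)
    (hw : ContDiffAt ℝ 2 w y) : ContDiffAt ℝ 1 (dirichletEnergy a w) y := by
  have := fun j : ι => contDiffAt_pd (k := j) (m := 1) hw (by norm_num)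
  have := contDiffAt_coGradient ha hw
  unfold dirichletEnergy; fun_prop

theorem contDiffAt_conjDrift (hφ : ContDiffAt ℝ 2 φ y) (ha : ∀ i j, ContDiffAt ℝ 1 (a i j) y)
    (hb : ∀ i, ContDiffAt ℝ 1 (b i) y) (l : ι) :
    ContDiffAt ℝ 1 (conjDrift τ s φ a b l) y := by
  have := contDiffAt_largeParam (τ := τ) (s := s) (hφ.of_le one_le_two)
  have := contDiffAt_coGradient ha hφ
  unfold conjDrift; fun_prop

theorem contDiffAt_multiplierGain (hφ : ContDiffAt ℝ 2 φ y) (ha : ∀ i j, ContDiffAt ℝ 1 (a i j) y) :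
    ContDiffAt ℝ 1 (multiplierGain τ s φ a) y := by
  have := contDiffAt_largeParam (τ := τ) (s := s) (hφ.of_le one_le_two)
  have := contDiffAt_dirichletEnergy ha hφ
  unfold multiplierGain; fun_prop

theorem contDiffAt_conjPotential (hφ : ContDiffAt ℝ 2 φ y) (ha : ∀ i j, ContDiffAt ℝ 1 (a i j) y)
    (hb : ∀ i, ContDiffAt ℝ 1 (b i) y) (hc : ContDiffAt ℝ 1 c y) :
    ContDiffAt ℝ 1 (conjPotential τ s φ a b c) y := by
  have := contDiffAt_largeParam (τ := τ) (s := s) (hφ.of_le one_le_two)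
  have := contDiffAt_dirichletEnergy ha hφ
  have := fun j : ι => contDiffAt_pd (k := j) (m := 1) hφ (by norm_num)
  unfold conjPotential lowerPotential; fun_prop

theorem contDiffAt_carlemanFlux (hφ : ContDiffAt ℝ 2 φ y) (ha : ∀ i j, ContDiffAt ℝ 1 (a i j) y)
    (hb : ∀ i, ContDiffAt ℝ 1 (b i) y) (hc : ContDiffAt ℝ 1 c y)
    (hv : ContDiffAt ℝ 2 v y) (k : ι) : ContDiffAt ℝ 1 (carlemanFlux τ s φ a b c v k) y := by
  have hw := contDiffAt_conjugate (τ := τ) (s := s) hφ hv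
  have := hw.of_le one_le_two
  have := fun j : ι => contDiffAt_pd (k := j) (m := 1) hw (by norm_num)
  have := contDiffAt_coGradient ha hw
  have := contDiffAt_dirichletEnergy ha hw
  have := fun l => contDiffAt_conjDrift (τ := τ) (s := s) hφ ha hb l
  have := contDiffAt_multiplierGain (τ := τ) (s := s) hφ ha
  have := contDiffAt_conjPotential (τ := τ) (s := s) hφ ha hb hc
  unfold carlemanFlux multiplierFlux multiplier; fun_prop

theorem norm_carlemanFlux_le (hs : 1 ≤ s) (ha : IsAdmissibleSymbol N κ φ a y)
    (hb : IsSubordinate ε σ b c y) (hv : DifferentiableAt ℝ v y) (k : ι) :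
    ‖carlemanFlux τ s φ a b c v k y‖ ≤ 18 * s * N ^ 11 * carlemanDensity τ s φ v y := by
  calc ‖carlemanFlux τ s φ a b c v k y‖
      ≤ 6 * s * N ^ 8 * carlemanEnergy (σ) (conjugate τ s φ v) y :=
        norm_multiplierFlux_le hs ha hb k
    _ ≤ 6 * s * N ^ 8 * (3 * N ^ 3 * carlemanDensity τ s φ v y) := by
        gcongr; exact ha.carlemanEnergy_conjugate_le hb.pos.le hv
    _ = _ := by ring

theorem le_two_mul_commutatorForm_sub_sq (hs : 1 ≤ s) (hκ : 0 ≤ κ)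
    (hsκ : 32 * N ^ 9 ≤ s * κ ^ 2) (hεκ : 112 * s * N ^ 10 * ε ≤ κ ^ 2)
    (ha : IsAdmissibleSymbol N κ φ a y) (hb : IsSubordinate ε σ b c y) :
    s * κ ^ 2 * carlemanEnergy (σ) w y ≤
      2 * commutatorForm a (conjDrift τ s φ a b) (conjPotential τ s φ a b c)
        (multiplierGain τ s φ a) w y - conjRemainder τ s φ a w y ^ 2 := by
  have hε := hb.nonneg
  have constants : s * κ ^ 2 ≤ 2 * (s * κ ^ 2 - 8 * N ^ 9 - 24 * s ^ 2 * N ^ 9 * ε) -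
      8 * s ^ 2 * N ^ 10 * ε := by
    have h₁ := mul_le_mul_of_nonneg_left hεκ (zero_le_one.trans hs)
    have h₂ := mul_le_mul_of_nonneg_left (ha.pow_le_pow (show 9 ≤ 10 by norm_num))
      (show 0 ≤ s ^ 2 * ε by positivity)
    linarith
  have := mul_le_mul_of_nonneg_right constants
    (carlemanEnergy_nonneg (w := w) (y := y) hb.pos.le)
  have := le_commutatorForm_conj (w := w) hs hκ ha hb
  have := conjRemainder_sq_le (w := w) hs ha hb.pos.le hb.one_le_mul
  linarith

theorem divergence_carlemanFlux_add_le_sq (hs : 1 ≤ s) (hκ : 0 ≤ κ)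
    (hsκ : 32 * N ^ 9 ≤ s * κ ^ 2) (hεκ : 112 * s * N ^ 10 * ε ≤ κ ^ 2)
    (ha : IsAdmissibleSymbol N κ φ a y) (hb : IsSubordinate ε σ b c y)
    (hv : ContDiffAt ℝ 2 v y) :
    2 * divergence (carlemanFlux τ s φ a b c v) y +
        s * κ ^ 2 / (3 * N ^ 3) * carlemanDensity τ s φ v y ≤
      (expWeight τ s φ y * nondivOp a b c v y) ^ 2 := by
  have hN : 0 < N := one_pos.trans_le ha.one_le
  have hφ := ha.contDiffAt_weight
  have ha₁ := ha.contDiffAt_coeff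
  have identity : divergence (carlemanFlux τ s φ a b c v) y = _ :=
    divergence_multiplierFlux ha.differentiableAt_coeff ha.symm
      (fun l => (contDiffAt_conjDrift hφ ha₁ hb.contDiffAt_drift l).differentiableAt one_ne_zero)
      ((contDiffAt_conjPotential hφ ha₁ hb.contDiffAt_drift
        hb.contDiffAt_potential).differentiableAt one_ne_zero)
      ((contDiffAt_multiplierGain hφ ha₁).differentiableAt one_ne_zero)
      (contDiffAt_conjugate hφ hv)
  have energy : s * κ ^ 2 / (3 * N ^ 3) * carlemanDensity τ s φ v y ≤
      s * κ ^ 2 * carlemanEnergy (σ) (conjugate τ s φ v) y := by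
    rw [div_mul_eq_mul_div, div_le_iff₀ (by positivity), mul_assoc (s * κ ^ 2), mul_comm _ (3 * _)]
    gcongr
    exact ha.carlemanDensity_le hb.pos.le (hv.differentiableAt two_ne_zero)
  have commutator := le_two_mul_commutatorForm_sub_sq (w := conjugate τ s φ v) hs hκ hsκ hεκ ha hb
  rw [expWeight_mul_nondivOp ha.symm ha.differentiableAt_coeff hφ hv]
  set S := -divergence (coGradient a (conjugate τ s φ v)) y -
    conjPotential τ s φ a b c y * conjugate τ s φ v y
  set T := multiplier (conjDrift τ s φ a b) (multiplierGain τ s φ a) (conjugate τ s φ v) y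
  set R := conjRemainder τ s φ a (conjugate τ s φ v) y
  linarith [sq_nonneg (S - T), sq_nonneg (S + T + 2 * R)]

end CarlemanFlux

section Mollification

open Filter Topology
open scoped Convolution

variable {ι : Type*} [Fintype ι] {m : ℕ} {y : EuclideanSpace ℝ ι}
  {f : EuclideanSpace ℝ ι → ℝ} {K : ℝ}

/-- A bump function supported in the ball of radius `1 / (m + 1)`, from which the standard
mollifier at that scale is built. -/
def mollifierBump (ι : Type*) [Fintype ι] (m : ℕ) : ContDiffBump (0 : EuclideanSpace ℝ ι) where
  rIn := 1 / ((m : ℝ) + 1) / 2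
  rOut := 1 / ((m : ℝ) + 1)
  rIn_pos := by positivity
  rIn_lt_rOut := half_lt_self (by positivity)

/-- The mollification of `f` at scale `1 / (m + 1)`. -/
def mollify (m : ℕ) (f : EuclideanSpace ℝ ι → ℝ) : EuclideanSpace ℝ ι → ℝ :=
  (mollifierBump ι m).normed volume ⋆[ContinuousLinearMap.lsmul ℝ ℝ, volume] f

/-- The kernel `t ↦ η (y - t)` of the mollification at scale `1 / (m + 1)`. -/
def mollifier (m : ℕ) (y t : EuclideanSpace ℝ ι) : ℝ := (mollifierBump ι m).normed volume (y - t)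

theorem contDiff_mollifier : ContDiff ℝ ∞ (mollifier m y) :=
  (mollifierBump ι m).contDiff_normed.comp (contDiff_const.sub contDiff_id)

theorem mollifier_nonneg (t : EuclideanSpace ℝ ι) : 0 ≤ mollifier m y t :=
  (mollifierBump ι m).nonneg_normed _

theorem tsupport_mollifier_subset :
    tsupport (mollifier m y) ⊆ Metric.closedBall y (1 / ((m : ℝ) + 1)) := by
  refine closure_minimal (fun t ht => ?_) Metric.isClosed_closedBall
  have ht' : y - t ∈ Function.support ((mollifierBump ι m).normed volume) := ht
  rw [ContDiffBump.support_normed_eq, mem_ball_zero_iff] at ht'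
  rw [Metric.mem_closedBall, dist_eq_norm']
  exact ht'.le

theorem hasCompactSupport_mollifier : HasCompactSupport (mollifier m y) :=
  (isCompact_closedBall y _).of_isClosed_subset (isClosed_tsupport _) tsupport_mollifier_subset

theorem integrable_mollifier : Integrable (mollifier m y) :=
  contDiff_mollifier.continuous.integrable_of_hasCompactSupport hasCompactSupport_mollifier

theorem integral_mollifier : ∫ t, mollifier m y t = 1 := by
  unfold mollifier
  rw [integral_sub_left_eq_self]
  exact (mollifierBump ι m).integral_normed

theorem mollify_apply : mollify m f y = ∫ t, mollifier m y t * f t :=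
  convolution_eq_swap _

theorem contDiff_mollify (hf : LocallyIntegrable f) : ContDiff ℝ ∞ (mollify m f) :=
  (mollifierBump ι m).hasCompactSupport_normed.contDiff_convolution_left _
    (mollifierBump ι m).contDiff_normed hf

theorem ae_tendsto_mollify (hf : LocallyIntegrable f) :
    ∀ᵐ y, Tendsto (fun m => mollify m f y) atTop (𝓝 (f y)) :=
  ContDiffBump.ae_convolution_tendsto_right_of_locallyIntegrable (φ := mollifierBump ι) (K := 2)
    tendsto_one_div_add_atTop_nhds_zero_nat
    (Eventually.of_forall fun _ => (mul_div_cancel₀ _ two_ne_zero).ge) hf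

theorem norm_mollify_le (hf : ∀ᵐ t, ‖f t‖ ≤ K) : ‖mollify m f y‖ ≤ K :=
  calc ‖mollify m f y‖ ≤ ∫ t, mollifier m y t * K := by
        rw [mollify_apply]
        refine norm_integral_le_of_norm_le (integrable_mollifier.mul_const K) ?_
        filter_upwards [hf] with t ht
        exact norm_mul_le_of_le (Real.norm_of_nonneg (mollifier_nonneg t)).le ht
    _ = K := by rw [integral_mul_const, integral_mollifier, one_mul]

variable [DecidableEq ι]

theorem pd_mollifier (k : ι) (t : EuclideanSpace ℝ ι) :
    pd k (mollifier m y) t =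
      -fderiv ℝ ((mollifierBump ι m).normed volume) (y - t) (EuclideanSpace.single k 1) := by
  have chain : HasFDerivAt (mollifier m y) _ t :=
    ((mollifierBump ι m).contDiff_normed (n := 1)).differentiable one_ne_zero
      |>.differentiableAt.hasFDerivAt.comp t ((hasFDerivAt_id t).const_sub y)
  rw [pd_eq_fderiv chain.differentiableAt, chain.fderiv]
  simp

theorem pd_mollify (hf : LocallyIntegrable f) (k : ι) :
    pd k (mollify m f) y = -∫ t, pd k (mollifier m y) t * f t := by
  have hbump := (mollifierBump ι m).contDiff_normed (μ := volume) (n := 1)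
  have hsupp := (mollifierBump ι m).hasCompactSupport_normed (μ := volume)
  have exists_fderiv := (hsupp.fderiv ℝ).convolutionExists_left
    ((ContinuousLinearMap.lsmul ℝ ℝ).precompL _) (hbump.continuous_fderiv one_ne_zero) hf y
  rw [pd_eq_fderiv ((contDiff_mollify hf).differentiable (by simp) y), mollify,
    (hsupp.hasFDerivAt_convolution_left _ hbump hf y).fderiv, convolution_eq_swap,
    ContinuousLinearMap.integral_apply exists_fderiv.integrable_swap, ← integral_neg]
  simp only [pd_mollifier, neg_mul, neg_neg]
  rfl

end Mollification

section WeakDerivatives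

open Filter Topology

variable {d : ℕ} {U : Set (E d)} {f g : E d → ℝ} {K : ℝ} {m : ℕ} {y : E d}

theorem ae_norm_le_of_eLpNorm_top_le {α : Type*} [MeasurableSpace α] {μ : Measure α} {f : α → ℝ}
    {K : ℝ} (hK : 0 ≤ K) (hf : eLpNorm f ∞ μ ≤ ENNReal.ofReal K) : ∀ᵐ y ∂μ, ‖f y‖ ≤ K := by
  rw [eLpNorm_exponent_top] at hf
  filter_upwards [ae_le_eLpNormEssSup (f := f) (μ := μ)] with y hy
  have := hy.trans hf
  rwa [← ofReal_norm, ENNReal.ofReal_le_ofReal_iff hK] at this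

theorem ae_norm_indicator_le {α : Type*} [MeasurableSpace α] {μ : Measure α} {f : α → ℝ}
    {U : Set α} {K : ℝ} (hU : MeasurableSet U) (hK : 0 ≤ K)
    (hf : eLpNorm f ∞ (μ.restrict U) ≤ ENNReal.ofReal K) : ∀ᵐ y ∂μ, ‖U.indicator f y‖ ≤ K := by
  filter_upwards [(ae_restrict_iff' hU).1 (ae_norm_le_of_eLpNorm_top_le hK hf)] with y hy
  by_cases hyU : y ∈ U
  · rw [Set.indicator_of_mem hyU]
    exact hy hyU
  · rw [Set.indicator_of_notMem hyU, norm_zero]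
    exact hK

theorem IsWeakPartial.pd_mollify_indicator (hU : MeasurableSet U) {k : Fin (d + 1)}
    (hfg : IsWeakPartial U k f g) (hf : LocallyIntegrable (U.indicator f))
    (hy : Metric.closedBall y (1 / ((m : ℝ) + 1)) ⊆ U) :
    pd k (mollify m (U.indicator f)) y = mollify m (U.indicator g) y := by
  have indicator_mul (ζ f : E d → ℝ) : ∫ t, ζ t * U.indicator f t = ∫ t in U, f t * ζ t := by
    simp_rw [mul_comm (f _), ← integral_indicator hU, ← Set.indicator_mul_right]
  have duality := hfg (mollifier m y) contDiff_mollifier hasCompactSupport_mollifier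
    (tsupport_mollifier_subset.trans hy)
  simp only [← pd_eq_fderiv (contDiff_mollifier.differentiable (by simp) _)] at duality
  rw [pd_mollify hf, mollify_apply, indicator_mul, indicator_mul, duality, neg_neg]

theorem W1InftyNormLE.locallyIntegrable_indicator (hU : MeasurableSet U) (hK : 0 ≤ K)
    (hf : W1InftyNormLE U f K) : LocallyIntegrable (U.indicator f) :=
  (memLp_top_of_bound ((aestronglyMeasurable_indicator_iff hU).2 hf.1) K
    (ae_norm_indicator_le hU hK hf.2.1)).locallyIntegrable le_top

theorem W1InftyNormLE.ae_tendsto_mollify (hU : MeasurableSet U) (hK : 0 ≤ K)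
    (hf : W1InftyNormLE U f K) :
    ∀ᵐ y, y ∈ U → Tendsto (fun m => mollify m (U.indicator f) y) atTop (𝓝 (f y)) := by
  filter_upwards [HalfBallCarleman.ae_tendsto_mollify (hf.locallyIntegrable_indicator hU hK)]
    with y hy hyU
  rwa [Set.indicator_of_mem hyU] at hy

theorem W1InftyNormLE.norm_mollify_le (hU : MeasurableSet U) (hK : 0 ≤ K)
    (hf : W1InftyNormLE U f K) : ‖mollify m (U.indicator f) y‖ ≤ K :=
  HalfBallCarleman.norm_mollify_le (ae_norm_indicator_le hU hK hf.2.1)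

theorem W1InftyNormLE.norm_pd_mollify_le (hU : MeasurableSet U) (hK : 0 ≤ K)
    (hf : W1InftyNormLE U f K) (hy : Metric.closedBall y (1 / ((m : ℝ) + 1)) ⊆ U)
    (k : Fin (d + 1)) : ‖pd k (mollify m (U.indicator f)) y‖ ≤ K := by
  obtain ⟨g, -, hg, hfg⟩ := hf.2.2 k
  rw [hfg.pd_mollify_indicator hU (hf.locallyIntegrable_indicator hU hK) hy]
  exact HalfBallCarleman.norm_mollify_le (ae_norm_indicator_le hU hK hg)

theorem eventually_closedBall_subset {X : Type*} [PseudoMetricSpace X] {S U : Set X}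
    (hS : IsCompact S) (hU : IsOpen U) (hSU : S ⊆ U) :
    ∀ᶠ m : ℕ in atTop, ∀ y ∈ S, Metric.closedBall y (1 / ((m : ℝ) + 1)) ⊆ U := by
  obtain ⟨δ, hδ, hthick⟩ := hS.exists_cthickening_subset_open hU hSU
  filter_upwards [(tendsto_one_div_add_atTop_nhds_zero_nat (𝕜 := ℝ)).eventually
    (Iio_mem_nhds hδ)] with m hm y hy
  exact (Metric.closedBall_subset_closedBall (le_of_lt hm)).trans
    ((Metric.closedBall_subset_cthickening hy δ).trans hthick)

end WeakDerivatives

section IntegrationByParts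

variable {ι : Type*} [Fintype ι] [DecidableEq ι] {χ f g : EuclideanSpace ℝ ι → ℝ}
  {F : ι → EuclideanSpace ℝ ι → ℝ}

theorem integrable_mul_of_tsupport {X : Type*} [TopologicalSpace X] [MeasurableSpace X]
    [OpensMeasurableSpace X] {μ : Measure X} [IsFiniteMeasureOnCompacts μ] {χ g : X → ℝ}
    (hχ : Continuous χ) (hcs : HasCompactSupport χ) (hg : ∀ y ∈ tsupport χ, ContinuousAt g y) :
    Integrable (fun y => χ y * g y) μ :=
  (continuous_of_tsupport fun y hy =>
    hχ.continuousAt.mul (hg y (tsupport_mul_subset_left hy))).integrable_of_hasCompactSupport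
      hcs.mul_right

theorem continuous_pd (hf : ContDiff ℝ 1 f) (k : ι) : Continuous (pd k f) :=
  continuous_iff_continuousAt.2 fun _ => (contDiffAt_pd (m := 0) hf.contDiffAt le_rfl).continuousAt

theorem integrable_pd_mul (hχ : ContDiff ℝ 1 χ) (hcs : HasCompactSupport χ)
    (hf : ∀ y ∈ tsupport χ, ContinuousAt f y) (k : ι) : Integrable fun y => pd k χ y * f y :=
  integrable_mul_of_tsupport (continuous_pd hχ k)
    (hcs.of_isClosed_subset (isClosed_tsupport _) (tsupport_pd_subset k))
    fun y hy => hf y (tsupport_pd_subset k hy)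

theorem integrable_abs_pd_mul (hχ : ContDiff ℝ 1 χ) (hcs : HasCompactSupport χ)
    (hf : ∀ y ∈ tsupport χ, ContinuousAt f y) (k : ι) : Integrable fun y => |pd k χ y| * f y :=
  have tsupport_abs_subset : tsupport (fun y => |pd k χ y|) ⊆ tsupport χ :=
    closure_minimal (fun _ hy => by_contra fun h => hy (by simp [pd_eq_zero_of_notMem_tsupport h]))
      (isClosed_tsupport _)
  integrable_mul_of_tsupport (continuous_pd hχ k).abs
    (hcs.of_isClosed_subset (isClosed_tsupport _) tsupport_abs_subset)
    fun y hy => hf y (tsupport_abs_subset hy)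

theorem integral_mul_pd (hχ : ContDiff ℝ 1 χ) (hcs : HasCompactSupport χ)
    (hf : ∀ y ∈ tsupport χ, ContDiffAt ℝ 1 f y) (k : ι) :
    ∫ y, χ y * pd k f y = -∫ y, pd k χ y * f y :=
  integral_bilinear_hasLineDerivAt_right_eq_neg_left_of_integrable
    (B := ContinuousLinearMap.mul ℝ ℝ)
    (integrable_pd_mul hχ hcs (fun y hy => (hf y hy).continuousAt) k)
    (integrable_mul_of_tsupport hχ.continuous hcs fun y hy =>
      (contDiffAt_pd (m := 0) (hf y hy) le_rfl).continuousAt)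
    (integrable_mul_of_tsupport hχ.continuous hcs fun y hy => (hf y hy).continuousAt)
    (fun y _ => HasPD.of_differentiableAt (hχ.differentiable one_ne_zero y))
    (fun y hy => HasPD.of_differentiableAt ((hf y hy).differentiableAt one_ne_zero))

theorem continuousAt_divergence {y : EuclideanSpace ℝ ι} (hF : ∀ k, ContDiffAt ℝ 1 (F k) y) :
    ContinuousAt (divergence F) y :=
  tendsto_finsetSum _ fun k _ => (contDiffAt_pd (m := 0) (hF k) le_rfl).continuousAt

theorem integral_mul_divergence (hχ : ContDiff ℝ 1 χ) (hcs : HasCompactSupport χ)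
    (hF : ∀ y ∈ tsupport χ, ∀ k, ContDiffAt ℝ 1 (F k) y) :
    ∫ y, χ y * divergence F y = -∫ y, ∑ k, pd k χ y * F k y := by
  simp only [divergence, Finset.mul_sum]
  rw [integral_finsetSum, integral_finsetSum, ← Finset.sum_neg_distrib]
  · exact Finset.sum_congr rfl fun k _ => integral_mul_pd hχ hcs (fun y hy => hF y hy k) k
  · exact fun k _ => integrable_pd_mul hχ hcs (fun y hy => (hF y hy k).continuousAt) k
  · exact fun k _ => integrable_mul_of_tsupport hχ.continuous hcs fun y hy =>
      (contDiffAt_pd (m := 0) (hF y hy k) le_rfl).continuousAt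

end IntegrationByParts

section CutoffEstimate

open Filter Topology

variable {ι : Type*} [Fintype ι] [DecidableEq ι] {N κ ε τ s : ℝ} {φ v c χ : EuclideanSpace ℝ ι → ℝ}
  {a : ι → ι → EuclideanSpace ℝ ι → ℝ} {b : ι → EuclideanSpace ℝ ι → ℝ} {y : EuclideanSpace ℝ ι}

theorem continuousAt_grad (hv : ContDiffAt ℝ 1 v y) : ContinuousAt (grad v) y :=
  (PiLp.continuous_toLp 2 _).continuousAt.comp
    (continuousAt_pi.2 fun _ => (contDiffAt_pd (m := 0) hv le_rfl).continuousAt)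

theorem continuousAt_carlemanDensity (hφ : ContDiffAt ℝ 0 φ y) (hv : ContDiffAt ℝ 1 v y) :
    ContinuousAt (carlemanDensity τ s φ v) y := by
  have := (contDiffAt_expWeight (τ := τ) (s := s) hφ).continuousAt
  have := (contDiffAt_largeParam (τ := τ) (s := s) hφ).continuousAt
  have := continuousAt_grad hv
  have := hv.continuousAt
  unfold carlemanDensity carlemanEnergy
  fun_prop

theorem continuousAt_nondivOp (ha : ∀ i j, ContinuousAt (a i j) y) (hb : ∀ i, ContinuousAt (b i) y)
    (hc : ContinuousAt c y) (hv : ContDiffAt ℝ 2 v y) : ContinuousAt (nondivOp a b c v) y := by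
  have := hv.continuousAt
  have hv₁ := fun j : ι => contDiffAt_pd (k := j) (m := 1) hv (by norm_num)
  have := fun j => (hv₁ j).continuousAt
  have := fun i j => (contDiffAt_pd (k := i) (m := 0) (hv₁ j) le_rfl).continuousAt
  unfold nondivOp
  fun_prop

theorem two_mul_integral_divergence_carlemanFlux_add_le (hs : 1 ≤ s) (hκ : 0 ≤ κ)
    (hsκ : 32 * N ^ 9 ≤ s * κ ^ 2) (hεκ : 112 * s * N ^ 10 * ε ≤ κ ^ 2)
    (hχ : ContDiff ℝ 1 χ) (hχ₀ : ∀ y, 0 ≤ χ y) (hcs : HasCompactSupport χ)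
    (ha : ∀ y ∈ tsupport χ, IsAdmissibleSymbol N κ φ a y)
    (hb : ∀ y ∈ tsupport χ, IsSubordinate ε (largeParam τ s φ y) b c y)
    (hv : ∀ y ∈ tsupport χ, ContDiffAt ℝ 2 v y) :
    2 * (∫ y, χ y * divergence (carlemanFlux τ s φ a b c v) y) +
        s * κ ^ 2 / (3 * N ^ 3) * ∫ y, χ y * carlemanDensity τ s φ v y ≤
      ∫ y, χ y * (expWeight τ s φ y * nondivOp a b c v y) ^ 2 := by
  have density_integrable := integrable_mul_of_tsupport (μ := volume) hχ.continuous hcs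
    fun y hy => continuousAt_carlemanDensity (τ := τ) (s := s)
      ((ha y hy).contDiffAt_weight.of_le (by simp)) ((hv y hy).of_le one_le_two)
  have div_integrable := integrable_mul_of_tsupport (μ := volume) hχ.continuous hcs fun y hy =>
    continuousAt_divergence (contDiffAt_carlemanFlux (τ := τ) (s := s) (ha y hy).contDiffAt_weight
      (ha y hy).contDiffAt_coeff (hb y hy).contDiffAt_drift (hb y hy).contDiffAt_potential
      (hv y hy))
  have op_integrable := integrable_mul_of_tsupport (μ := volume) hχ.continuous hcs fun y hy =>
    ((contDiffAt_expWeight (τ := τ) (s := s) (ha y hy).contDiffAt_weight).continuousAt.mul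
      (continuousAt_nondivOp (fun i j => ((ha y hy).contDiffAt_coeff i j).continuousAt)
        (fun i => ((hb y hy).contDiffAt_drift i).continuousAt)
        (hb y hy).contDiffAt_potential.continuousAt (hv y hy))).pow 2
  rw [← integral_const_mul, ← integral_const_mul, ← integral_add
    (div_integrable.const_mul _) (density_integrable.const_mul _)]
  refine integral_mono ((div_integrable.const_mul _).add (density_integrable.const_mul _))
    op_integrable fun y => ?_
  by_cases hy : y ∈ tsupport χ
  · have := mul_le_mul_of_nonneg_left (divergence_carlemanFlux_add_le_sq hs hκ hsκ hεκ
      (ha y hy) (hb y hy) (hv y hy)) (hχ₀ y)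
    linarith
  · simp [image_eq_zero_of_notMem_tsupport hy]

theorem integral_pd_mul_carlemanFlux_le (hs : 1 ≤ s) (hχ : ContDiff ℝ 1 χ)
    (hcs : HasCompactSupport χ) (ha : ∀ y ∈ tsupport χ, IsAdmissibleSymbol N κ φ a y)
    (hb : ∀ y ∈ tsupport χ, IsSubordinate ε (largeParam τ s φ y) b c y)
    (hv : ∀ y ∈ tsupport χ, ContDiffAt ℝ 2 v y) :
    ∫ y, ∑ k, pd k χ y * carlemanFlux τ s φ a b c v k y ≤
      18 * s * N ^ 11 * ∫ y, (∑ k, |pd k χ y|) * carlemanDensity τ s φ v y := by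
  simp only [← integral_const_mul, Finset.sum_mul, Finset.mul_sum]
  refine integral_mono (integrable_finsetSum _ fun k _ => integrable_pd_mul hχ hcs (fun y hy =>
      (contDiffAt_carlemanFlux (ha y hy).contDiffAt_weight (ha y hy).contDiffAt_coeff
        (hb y hy).contDiffAt_drift (hb y hy).contDiffAt_potential (hv y hy) k).continuousAt) k)
    (integrable_finsetSum _ fun k _ => .const_mul ?_ _) fun y => Finset.sum_le_sum fun k _ => ?_
  · exact integrable_abs_pd_mul hχ hcs (fun y hy => continuousAt_carlemanDensity
      ((ha y hy).contDiffAt_weight.of_le (by simp)) ((hv y hy).of_le one_le_two)) k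
  · by_cases hy : y ∈ tsupport χ
    · calc pd k χ y * carlemanFlux τ s φ a b c v k y
          ≤ |pd k χ y| * ‖carlemanFlux τ s φ a b c v k y‖ := by
            rw [Real.norm_eq_abs, ← abs_mul]; exact le_abs_self _
        _ ≤ |pd k χ y| * (18 * s * N ^ 11 * carlemanDensity τ s φ v y) := by
            gcongr
            exact norm_carlemanFlux_le hs (ha y hy) (hb y hy)
              ((hv y hy).differentiableAt two_ne_zero) k
        _ = _ := by ring
    · simp [pd_eq_zero_of_notMem_tsupport hy]

theorem mul_integral_carlemanDensity_le (hs : 1 ≤ s) (hκ : 0 ≤ κ)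
    (hsκ : 32 * N ^ 9 ≤ s * κ ^ 2) (hεκ : 112 * s * N ^ 10 * ε ≤ κ ^ 2)
    (hχ : ContDiff ℝ 1 χ) (hχ₀ : ∀ y, 0 ≤ χ y) (hcs : HasCompactSupport χ)
    (ha : ∀ y ∈ tsupport χ, IsAdmissibleSymbol N κ φ a y)
    (hb : ∀ y ∈ tsupport χ, IsSubordinate ε (largeParam τ s φ y) b c y)
    (hv : ∀ y ∈ tsupport χ, ContDiffAt ℝ 2 v y) :
    s * κ ^ 2 / (3 * N ^ 3) * ∫ y, χ y * carlemanDensity τ s φ v y ≤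
      (∫ y, χ y * (expWeight τ s φ y * nondivOp a b c v y) ^ 2) +
        36 * s * N ^ 11 * ∫ y, (∑ k, |pd k χ y|) * carlemanDensity τ s φ v y := by
  have interior := two_mul_integral_divergence_carlemanFlux_add_le hs hκ hsκ hεκ hχ hχ₀ hcs ha hb hv
  have boundary := integral_pd_mul_carlemanFlux_le hs hχ hcs ha hb hv
  rw [integral_mul_divergence hχ hcs fun y hy => contDiffAt_carlemanFlux
    (ha y hy).contDiffAt_weight (ha y hy).contDiffAt_coeff (hb y hy).contDiffAt_drift
    (hb y hy).contDiffAt_potential (hv y hy)] at interior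
  linarith

end CutoffEstimate

section CutoffEstimateW1Infty

open Filter Topology

section Limit

variable {ι : Type*} [Fintype ι] [DecidableEq ι] {χ w v : EuclideanSpace ℝ ι → ℝ}
  {a : ι → ι → EuclideanSpace ℝ ι → ℝ} {Kb Kc : ℝ}

theorem norm_nondivOp_le {b : ι → EuclideanSpace ℝ ι → ℝ} {c : EuclideanSpace ℝ ι → ℝ}
    {y : EuclideanSpace ℝ ι} (hb : ∀ i, ‖b i y‖ ≤ Kb) (hc : ‖c y‖ ≤ Kc) :
    ‖nondivOp a b c v y‖ ≤
      ‖nondivOp a 0 0 v y‖ + ∑ i, Kb * ‖pd i v y‖ + Kc * ‖v y‖ := by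
  simp only [nondivOp, Pi.zero_apply, zero_mul, Finset.sum_const_zero, add_zero]
  exact norm_add_le_of_le (norm_add_le_of_le le_rfl
    (norm_sum_le_of_le _ fun i _ => norm_mul_le_of_le (hb i) le_rfl)) (norm_mul_le_of_le hc le_rfl)

theorem tendsto_integral_mul_sq_nondivOp {b : ι → EuclideanSpace ℝ ι → ℝ}
    {c : EuclideanSpace ℝ ι → ℝ} {bm : ℕ → ι → EuclideanSpace ℝ ι → ℝ}
    {cm : ℕ → EuclideanSpace ℝ ι → ℝ} (hχ : Continuous χ) (hcs : HasCompactSupport χ)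
    (hw : ∀ y ∈ tsupport χ, ContinuousAt w y)
    (ha : ∀ y ∈ tsupport χ, ∀ i j, ContinuousAt (a i j) y)
    (hv : ∀ y ∈ tsupport χ, ContDiffAt ℝ 2 v y)
    (hbm : ∀ m i, Continuous (bm m i)) (hcm : ∀ m, Continuous (cm m))
    (hbK : ∀ m i y, ‖bm m i y‖ ≤ Kb) (hcK : ∀ m y, ‖cm m y‖ ≤ Kc)
    (hb : ∀ᵐ y, y ∈ tsupport χ → ∀ i, Tendsto (fun m => bm m i y) atTop (𝓝 (b i y)))
    (hc : ∀ᵐ y, y ∈ tsupport χ → Tendsto (fun m => cm m y) atTop (𝓝 (c y))) :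
    Tendsto (fun m => ∫ y, χ y * (w y * nondivOp a (bm m) (cm m) v y) ^ 2) atTop
      (𝓝 (∫ y, χ y * (w y * nondivOp a b c v y) ^ 2)) := by
  have hbound : Integrable fun y =>
      χ y * (w y * (‖nondivOp a 0 0 v y‖ + ∑ i, Kb * ‖pd i v y‖ + Kc * ‖v y‖)) ^ 2 := by
    refine integrable_mul_of_tsupport hχ hcs fun y hy => ?_
    have := hw y hy
    have := (hv y hy).continuousAt
    have := fun i => (contDiffAt_pd (k := i) (m := 0) ((hv y hy).of_le one_le_two)
      le_rfl).continuousAt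
    have := continuousAt_nondivOp (b := 0) (c := 0) (ha y hy) (fun _ => continuousAt_const)
      continuousAt_const (hv y hy)
    fun_prop
  refine tendsto_integral_of_dominated_convergence _ (fun m => ?_) hbound.norm
    (fun m => ae_of_all _ fun y => ?_) ?_
  · exact (integrable_mul_of_tsupport hχ hcs fun y hy => ((hw y hy).mul (continuousAt_nondivOp
      (ha y hy) (fun i => (hbm m i).continuousAt) (hcm m).continuousAt
      (hv y hy))).pow 2).aestronglyMeasurable
  · simp only [norm_mul, norm_pow]
    gcongr
    exact (norm_nondivOp_le (fun i => hbK m i y) (hcK m y)).trans (le_abs_self _)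
  · filter_upwards [hb, hc] with y hby hcy
    by_cases hy : y ∈ tsupport χ
    · exact ((((tendsto_finsetSum _ fun i _ => (hby hy i).mul_const _).const_add _).add
        ((hcy hy).mul_const _)).const_mul _ |>.pow 2).const_mul _
    · simp [image_eq_zero_of_notMem_tsupport hy]

end Limit

variable {d : ℕ} {N κ ε τ s Kb Kc : ℝ} {U : Set (E d)} {φ v χ c : E d → ℝ}
  {a : Fin (d + 1) → Fin (d + 1) → E d → ℝ} {b : Fin (d + 1) → E d → ℝ}

theorem isSubordinate_mollify {σ : ℝ} {m : ℕ} {y : E d} (hU : MeasurableSet U) (hKb : 0 ≤ Kb)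
    (hKc : 0 ≤ Kc) (hε₀ : 0 ≤ ε) (hε₁ : ε ≤ 1) (hσ : 1 ≤ ε * σ) (hbσ : Kb ≤ ε * σ)
    (hcσ : Kc ≤ ε * σ ^ 2) (hb : ∀ i, W1InftyNormLE U (b i) Kb) (hc : W1InftyNormLE U c Kc)
    (hy : Metric.closedBall y (1 / ((m : ℝ) + 1)) ⊆ U) :
    IsSubordinate ε σ (fun i => mollify m (U.indicator (b i))) (mollify m (U.indicator c)) y where
  nonneg := hε₀
  le_one := hε₁
  one_le_mul := hσ
  contDiffAt_drift i := ((contDiff_mollify ((hb i).locallyIntegrable_indicator hU hKb)).of_le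
    (by exact_mod_cast le_top)).contDiffAt
  norm_drift_le i := ((hb i).norm_mollify_le hU hKb).trans hbσ
  norm_pd_drift_le k i := ((hb i).norm_pd_mollify_le hU hKb hy k).trans hbσ
  contDiffAt_potential := ((contDiff_mollify (hc.locallyIntegrable_indicator hU hKc)).of_le
    (by exact_mod_cast le_top)).contDiffAt
  norm_potential_le := (hc.norm_mollify_le hU hKc).trans hcσ
  norm_pd_potential_le k := (hc.norm_pd_mollify_le hU hKc hy k).trans hcσ

theorem mul_integral_carlemanDensity_le_of_w1Infty (hU : IsOpen U) (hs : 1 ≤ s) (hκ : 0 ≤ κ)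
    (hsκ : 32 * N ^ 9 ≤ s * κ ^ 2) (hεκ : 112 * s * N ^ 10 * ε ≤ κ ^ 2)
    (hε₀ : 0 ≤ ε) (hε₁ : ε ≤ 1) (hKb : 0 ≤ Kb) (hKc : 0 ≤ Kc)
    (hχ : ContDiff ℝ 1 χ) (hχ₀ : ∀ y, 0 ≤ χ y) (hcs : HasCompactSupport χ) (hχU : tsupport χ ⊆ U)
    (ha : ∀ y ∈ U, IsAdmissibleSymbol N κ φ a y)
    (hσ : ∀ y ∈ U, 1 ≤ ε * largeParam τ s φ y) (hbσ : ∀ y ∈ U, Kb ≤ ε * largeParam τ s φ y)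
    (hcσ : ∀ y ∈ U, Kc ≤ ε * largeParam τ s φ y ^ 2)
    (hb : ∀ i, W1InftyNormLE U (b i) Kb) (hc : W1InftyNormLE U c Kc)
    (hv : ∀ y ∈ U, ContDiffAt ℝ 2 v y) :
    s * κ ^ 2 / (3 * N ^ 3) * ∫ y, χ y * carlemanDensity τ s φ v y ≤
      (∫ y, χ y * (expWeight τ s φ y * nondivOp a b c v y) ^ 2) +
        36 * s * N ^ 11 * ∫ y, (∑ k, |pd k χ y|) * carlemanDensity τ s φ v y := by
  have hUm := hU.measurableSet
  refine ge_of_tendsto ((tendsto_integral_mul_sq_nondivOp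
    (bm := fun m i => mollify m (U.indicator (b i))) (cm := fun m => mollify m (U.indicator c))
    (b := b) (c := c) hχ.continuous hcs
    (fun y hy => (contDiffAt_expWeight (ha y (hχU hy)).contDiffAt_weight).continuousAt)
    (fun y hy i j => ((ha y (hχU hy)).contDiffAt_coeff i j).continuousAt)
    (fun y hy => hv y (hχU hy))
    (fun m i => (contDiff_mollify ((hb i).locallyIntegrable_indicator hUm hKb)).continuous)
    (fun m => (contDiff_mollify (hc.locallyIntegrable_indicator hUm hKc)).continuous)
    (fun m i y => (hb i).norm_mollify_le hUm hKb) (fun m y => hc.norm_mollify_le hUm hKc)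
    ?_ ?_).add_const _) ?_
  · filter_upwards [ae_all_iff.2 fun i => (hb i).ae_tendsto_mollify hUm hKb] with y hy hyχ i
      using hy i (hχU hyχ)
  · filter_upwards [hc.ae_tendsto_mollify hUm hKc] with y hy hyχ using hy (hχU hyχ)
  · filter_upwards [eventually_closedBall_subset hcs.isCompact hU hχU] with m hm
    exact mul_integral_carlemanDensity_le hs hκ hsκ hεκ hχ hχ₀ hcs (fun y hy => ha y (hχU hy))
      (fun y hy => isSubordinate_mollify hUm hKb hKc hε₀ hε₁ (hσ y (hχU hy)) (hbσ y (hχU hy))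
        (hcσ y (hχU hy)) hb hc (hm y hy)) fun y hy => hv y (hχU hy)

end CutoffEstimateW1Infty

section Geometry

variable {d : ℕ}

theorem measurable_coord (i : Fin (d + 1)) : Measurable fun y : E d => y i :=
  (EuclideanSpace.proj (𝕜 := ℝ) i).continuous.measurable

theorem isOpen_halfBall : IsOpen (halfBall d) :=
  (isOpen_lt continuous_norm continuous_const).inter
    (isOpen_lt continuous_const (EuclideanSpace.proj (𝕜 := ℝ) (Fin.last d)).continuous)

theorem isClosed_closedHalfBall : IsClosed (closedHalfBall d) :=
  (isClosed_le continuous_norm continuous_const).inter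
    (isClosed_le continuous_const (EuclideanSpace.proj (𝕜 := ℝ) (Fin.last d)).continuous)

theorem isCompact_closedHalfBall : IsCompact (closedHalfBall d) :=
  (isCompact_closedBall (0 : E d) (1 / 2)).of_isClosed_subset isClosed_closedHalfBall
    fun _ hy => mem_closedBall_zero_iff.2 hy.1

theorem halfBall_subset_closedHalfBall : halfBall d ⊆ closedHalfBall d :=
  fun _ hy => ⟨hy.1.le, hy.2.le⟩

theorem flatEmbed_castSucc (z : EuclideanSpace ℝ (Fin d)) (j : Fin d) :
    flatEmbed d z (Fin.castSucc j) = z j := by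
  simp [flatEmbed]

theorem flatEmbed_last (z : EuclideanSpace ℝ (Fin d)) : flatEmbed d z (Fin.last d) = 0 := by
  simp [flatEmbed]

theorem norm_flatEmbed (z : EuclideanSpace ℝ (Fin d)) : ‖flatEmbed d z‖ = ‖z‖ := by
  simp [EuclideanSpace.norm_eq, Fin.sum_univ_castSucc, flatEmbed_castSucc, flatEmbed_last]

theorem continuous_flatEmbed : Continuous (flatEmbed d) := by
  refine (PiLp.continuous_toLp 2 _).comp (continuous_pi fun i => ?_)
  refine Fin.lastCases ?_ (fun j => ?_) i
  · simpa using continuous_const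
  · simpa using (EuclideanSpace.proj (𝕜 := ℝ) j).continuous

/-- The splitting of `y = (y', yₙ)` into the pair `(yₙ, y')`. -/
def splitLast (d : ℕ) (y : E d) : ℝ × EuclideanSpace ℝ (Fin d) :=
  (y (Fin.last d), WithLp.toLp 2 fun j => y (Fin.castSucc j))

theorem measurePreserving_splitLast : MeasurePreserving (splitLast d) := by
  have h_split := (volume_preserving_piFinSuccAbove (fun _ : Fin (d + 1) => ℝ) (Fin.last d)).comp
    (PiLp.volume_preserving_ofLp (Fin (d + 1)))
  convert ((MeasurePreserving.id volume).prod (PiLp.volume_preserving_toLp (Fin d))).comp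
    h_split using 1
  · funext y
    simp only [splitLast, Function.comp, MeasurableEquiv.piFinSuccAbove_apply,
      Fin.insertNthEquiv_last]
    rfl
  · exact Measure.volume_eq_prod ℝ (EuclideanSpace ℝ (Fin d))

theorem norm_sq_eq_norm_sq_splitLast_add (y : E d) :
    ‖y‖ ^ 2 = ‖(splitLast d y).2‖ ^ 2 + y (Fin.last d) ^ 2 := by
  rw [EuclideanSpace.real_norm_sq_eq, EuclideanSpace.real_norm_sq_eq, Fin.sum_univ_castSucc]
  rfl

theorem norm_splitLast_lt {y : E d} (hy : y ∈ halfBall d) : ‖(splitLast d y).2‖ < 1 / 2 := by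
  refine lt_of_le_of_lt ?_ hy.1
  refine (sq_le_sq₀ (norm_nonneg _) (norm_nonneg _)).1 ?_
  linarith [norm_sq_eq_norm_sq_splitLast_add y, sq_nonneg (y (Fin.last d))]

end Geometry

section BoundaryLayers

open Filter Topology

variable {d : ℕ}

/-- The part of the half ball at height at most `r` above its flat boundary. -/
def flatLayer (d : ℕ) (r : ℝ) : Set (E d) := halfBall d ∩ {y | y (Fin.last d) ≤ r}

/-- The part of the half ball at distance at most `r` from the sphere of radius `1/2`. -/
def capLayer (d : ℕ) (r : ℝ) : Set (E d) := halfBall d ∩ {y | 1 / 2 - r ≤ ‖y‖}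

/-- The projection `(y', yₙ) ↦ (y', 0)` onto the flat boundary. -/
def flatProj (y : E d) : E d := flatEmbed d (splitLast d y).2

/-- The radial projection onto the sphere of radius `1/2`. -/
def capProj (y : E d) : E d := (1 / 2 : ℝ) • ‖y‖⁻¹ • y

/-- The open upper half of the unit sphere. -/
def upperSphere (d : ℕ) : Set (Metric.sphere (0 : E d) 1) := {p | 0 < (p : E d) (Fin.last d)}

/-- The surface measure of the flat part of the boundary of the half ball. -/
def flatMeasure (d : ℕ) : Measure (E d) :=
  Measure.map (flatEmbed d) (volume.restrict (Metric.ball 0 (1 / 2)))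

/-- The surface measure of the spherical part of the boundary of the half ball. -/
def capMeasure (d : ℕ) : Measure (E d) :=
  ENNReal.ofReal ((1 / 2 : ℝ) ^ d) •
    Measure.map (fun p : Metric.sphere (0 : E d) 1 => (1 / 2 : ℝ) • (p : E d))
      ((volume : Measure (E d)).toSphere.restrict (upperSphere d))

theorem boundaryMeasure_eq_add : boundaryMeasure d = flatMeasure d + capMeasure d := rfl

instance : IsFiniteMeasure (boundaryMeasure d) := by
  have : IsFiniteMeasure (volume.restrict (Metric.ball (0 : EuclideanSpace ℝ (Fin d)) (1 / 2))) :=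
    isFiniteMeasure_restrict.2 measure_ball_lt_top.ne
  have : IsFiniteMeasure (flatMeasure d) := by unfold flatMeasure; infer_instance
  have : IsFiniteMeasure (capMeasure d) := Measure.smul_finite _ ENNReal.ofReal_ne_top
  rw [boundaryMeasure_eq_add]
  infer_instance

theorem measurableSet_flatLayer (r : ℝ) : MeasurableSet (flatLayer d r) :=
  isOpen_halfBall.measurableSet.inter
    (measurableSet_le (measurable_coord (Fin.last d)) measurable_const)

theorem measurableSet_capLayer (r : ℝ) : MeasurableSet (capLayer d r) :=
  isOpen_halfBall.measurableSet.inter (measurableSet_le measurable_const measurable_norm)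

theorem flatProj_mem_closedHalfBall {y : E d} (hy : y ∈ halfBall d) :
    flatProj y ∈ closedHalfBall d :=
  ⟨(norm_flatEmbed _).trans_le (norm_splitLast_lt hy).le, (flatEmbed_last _).ge⟩

theorem dist_flatProj (y : E d) : dist y (flatProj y) = |y (Fin.last d)| := by
  simp [EuclideanSpace.dist_eq, Fin.sum_univ_castSucc, flatProj, flatEmbed_castSucc,
    flatEmbed_last, splitLast, Real.dist_eq, Real.sqrt_sq_eq_abs]

theorem capProj_mem_closedHalfBall {y : E d} (hy : y ∈ halfBall d) :
    capProj y ∈ closedHalfBall d := by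
  refine ⟨?_, ?_⟩
  · rw [capProj, norm_smul, norm_smul, norm_inv, norm_norm]
    norm_num [inv_mul_le_one]
  · have := hy.2.le
    simp only [capProj, PiLp.smul_apply, smul_eq_mul]
    positivity

theorem dist_capProj {y : E d} (hy : y ≠ 0) : dist y (capProj y) = |‖y‖ - 1 / 2| := by
  have hy' : ‖y‖ ≠ 0 := norm_ne_zero_iff.2 hy
  have h_sub : y - capProj y = ((‖y‖ - 1 / 2) * ‖y‖⁻¹) • y := by
    rw [capProj, smul_smul, sub_mul, mul_inv_cancel₀ hy', sub_smul, one_smul]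
  rw [dist_eq_norm, h_sub, norm_smul, norm_mul, norm_inv, norm_norm, inv_mul_cancel_right₀ hy',
    Real.norm_eq_abs]

theorem lintegral_flatLayer_comp_flatProj_le {f : E d → ℝ≥0∞} (hf : Measurable f) (r : ℝ) :
    ∫⁻ y in flatLayer d r, f (flatProj y) ≤ ENNReal.ofReal r * ∫⁻ y, f y ∂flatMeasure d := by
  have hf' : Measurable fun z => f (flatEmbed d z) := hf.comp continuous_flatEmbed.measurable
  have h_sub : flatLayer d r ⊆ splitLast d ⁻¹' (Set.Ioc 0 r ×ˢ Metric.ball 0 (1 / 2)) :=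
    fun y hy => ⟨⟨hy.1.2, hy.2⟩, mem_ball_zero_iff.2 (norm_splitLast_lt hy.1)⟩
  calc ∫⁻ y in flatLayer d r, f (flatProj y)
      ≤ ∫⁻ y in splitLast d ⁻¹' (Set.Ioc 0 r ×ˢ Metric.ball 0 (1 / 2)),
          f (flatEmbed d (splitLast d y).2) := lintegral_mono_set h_sub
    _ = ∫⁻ p in Set.Ioc 0 r ×ˢ Metric.ball 0 (1 / 2), f (flatEmbed d p.2) :=
        measurePreserving_splitLast.setLIntegral_comp_preimage
          (measurableSet_Ioc.prod measurableSet_ball) (hf'.comp measurable_snd)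
    _ = (∫⁻ _ in Set.Ioc 0 r, 1) * ∫⁻ z in Metric.ball 0 (1 / 2), f (flatEmbed d z) := by
        rw [Measure.volume_eq_prod, ← Measure.prod_restrict,
          ← lintegral_prod_mul aemeasurable_const hf'.aemeasurable]
        simp only [one_mul]
    _ = ENNReal.ofReal r * ∫⁻ y, f y ∂flatMeasure d := by
        rw [flatMeasure, lintegral_map hf continuous_flatEmbed.measurable, setLIntegral_one,
          Real.volume_Ioc, sub_zero]

theorem volumeIoiPow_Ico_le (n : ℕ) (r ρ : ℝ) :
    Measure.volumeIoiPow n (Subtype.val ⁻¹' Set.Ico ρ r) ≤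
      ENNReal.ofReal (r ^ n) * ENNReal.ofReal (r - ρ) := by
  have hm : MeasurableSet (Subtype.val ⁻¹' Set.Ico ρ r : Set (Set.Ioi (0 : ℝ))) :=
    measurable_subtype_coe measurableSet_Ico
  rw [Measure.volumeIoiPow, withDensity_apply _ hm]
  calc ∫⁻ t : Set.Ioi (0 : ℝ) in (Subtype.val ⁻¹' Set.Ico ρ r), ENNReal.ofReal ((t : ℝ) ^ n)
        ∂Measure.comap Subtype.val volume
      ≤ ∫⁻ _ in (Subtype.val ⁻¹' Set.Ico ρ r : Set (Set.Ioi (0 : ℝ))), ENNReal.ofReal (r ^ n)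
        ∂Measure.comap Subtype.val volume :=
        setLIntegral_mono measurable_const fun t ht =>
          ENNReal.ofReal_le_ofReal (pow_le_pow_left₀ t.2.le ht.2.le n)
    _ = ENNReal.ofReal (r ^ n) *
        Measure.comap Subtype.val volume (Subtype.val ⁻¹' Set.Ico ρ r : Set (Set.Ioi (0 : ℝ))) :=
        setLIntegral_const _ _
    _ ≤ ENNReal.ofReal (r ^ n) * ENNReal.ofReal (r - ρ) := by
        rw [comap_subtype_coe_apply measurableSet_Ioi, ← Real.volume_Ico]
        gcongr
        rintro _ ⟨t, ht, rfl⟩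
        exact ht

theorem measurableSet_upperSphere : MeasurableSet (upperSphere d) :=
  measurableSet_lt measurable_const ((measurable_coord (Fin.last d)).comp measurable_subtype_coe)

theorem homeomorphUnitSphereProd_mem_of_mem_capLayer {r : ℝ} {y : ({0}ᶜ : Set (E d))}
    (hy : (y : E d) ∈ capLayer d r) :
    homeomorphUnitSphereProd (E d) y ∈
      upperSphere d ×ˢ (Subtype.val ⁻¹' Set.Ico (1 / 2 - r) (1 / 2)) := by
  refine ⟨?_, ?_⟩
  · have hy_inv : 0 < ‖(y : E d)‖⁻¹ := inv_pos.2 (norm_pos_iff.2 y.2)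
    simpa [upperSphere] using mul_pos hy_inv hy.1.2
  · simpa using And.intro hy.2 hy.1.1

theorem lintegral_capLayer_comp_capProj_le {f : E d → ℝ≥0∞} (hf : Measurable f) (r : ℝ) :
    ∫⁻ y in capLayer d r, f (capProj y) ≤ ENNReal.ofReal r * ∫⁻ y, f y ∂capMeasure d := by
  set S := upperSphere d ×ˢ (Subtype.val ⁻¹' Set.Ico (1 / 2 - r) (1 / 2) : Set (Set.Ioi (0 : ℝ)))
  have hS : MeasurableSet S :=
    measurableSet_upperSphere.prod (measurable_subtype_coe measurableSet_Ico)
  have h_half : Measurable fun p : Metric.sphere (0 : E d) 1 => (1 / 2 : ℝ) • (p : E d) :=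
    Continuous.measurable (by fun_prop)
  have hf' : Measurable fun p : Metric.sphere (0 : E d) 1 => f ((1 / 2 : ℝ) • (p : E d)) :=
    hf.comp h_half
  have h_coe : MeasurePreserving (Subtype.val : ({0}ᶜ : Set (E d)) → E d)
      (volume.comap Subtype.val) volume := by
    refine ⟨measurable_subtype_coe, ?_⟩
    rw [map_comap_subtype_coe (measurableSet_singleton _).compl, restrict_compl_singleton]
  have h_sub : (Subtype.val : ({0}ᶜ : Set (E d)) → E d) ⁻¹' capLayer d r ⊆
      homeomorphUnitSphereProd (E d) ⁻¹' S :=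
    fun _ hy => homeomorphUnitSphereProd_mem_of_mem_capLayer hy
  calc ∫⁻ y in capLayer d r, f (capProj y)
      = ∫⁻ y in (Subtype.val : ({0}ᶜ : Set (E d)) → E d) ⁻¹' capLayer d r, f (capProj y)
          ∂volume.comap Subtype.val :=
        (h_coe.setLIntegral_comp_preimage_emb
          (MeasurableEmbedding.subtype_coe (measurableSet_singleton _).compl) _ _).symm
    _ ≤ ∫⁻ y in homeomorphUnitSphereProd (E d) ⁻¹' S,
          f ((1 / 2 : ℝ) • ((homeomorphUnitSphereProd (E d) y).1 : E d))
          ∂volume.comap Subtype.val := by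
        refine (lintegral_mono_set h_sub).trans_eq ?_
        simp only [capProj, homeomorphUnitSphereProd_apply_fst_coe]
    _ = ∫⁻ p in S, f ((1 / 2 : ℝ) • (p.1 : E d)) ∂((volume : Measure (E d)).toSphere.prod
          (Measure.volumeIoiPow (Module.finrank ℝ (E d) - 1))) :=
        (volume : Measure (E d)).measurePreserving_homeomorphUnitSphereProd
          |>.setLIntegral_comp_preimage hS (hf'.comp measurable_fst)
    _ = (∫⁻ p in upperSphere d, f ((1 / 2 : ℝ) • (p : E d)) ∂(volume : Measure (E d)).toSphere) *
          Measure.volumeIoiPow (Module.finrank ℝ (E d) - 1)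
            (Subtype.val ⁻¹' Set.Ico (1 / 2 - r) (1 / 2)) := by
        rw [← Measure.prod_restrict, ← setLIntegral_one,
          ← lintegral_prod_mul hf'.aemeasurable aemeasurable_const]
        simp only [mul_one]
    _ ≤ (∫⁻ p in upperSphere d, f ((1 / 2 : ℝ) • (p : E d)) ∂(volume : Measure (E d)).toSphere) *
          (ENNReal.ofReal ((1 / 2) ^ d) * ENNReal.ofReal r) := by
        gcongr
        refine (volumeIoiPow_Ico_le _ _ _).trans_eq ?_
        simp
    _ = ENNReal.ofReal r * ∫⁻ y, f y ∂capMeasure d := by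
        rw [capMeasure, lintegral_smul_measure, lintegral_map hf h_half, smul_eq_mul]
        ring

theorem eventually_setLIntegral_le {X : Type*} [PseudoMetricSpace X] [MeasurableSpace X]
    [BorelSpace X] {μ ν : Measure X} {K : Set X} (hK : IsCompact K) (hKm : MeasurableSet K)
    {L : ℝ → Set X} {π : X → X} (hLm : ∀ r, MeasurableSet (L r))
    (hL : ∀ r, ∀ y ∈ L r, y ∈ K ∧ π y ∈ K ∧ dist y (π y) ≤ r)
    (hπ : ∀ (f : X → ℝ≥0∞) (_ : Measurable f) (r : ℝ),
      ∫⁻ y in L r, f (π y) ∂μ ≤ ENNReal.ofReal r * ∫⁻ y, f y ∂ν)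
    {G : X → ℝ} (hG : ContinuousOn G K) {η : ℝ} (hη : 0 < η) :
    ∀ᶠ r in 𝓝 0, ∫⁻ y in L r, ENNReal.ofReal (G y) ∂μ ≤
      ENNReal.ofReal r * ∫⁻ y in K, ENNReal.ofReal (G y + η) ∂ν := by
  obtain ⟨δ, hδ, hGδ⟩ := Metric.uniformContinuousOn_iff.1
    (hK.uniformContinuousOn_of_continuous hG) η hη
  set f : X → ℝ≥0∞ := fun y => ENNReal.ofReal (G y + η)
  have hf : Measurable (K.indicator f) := by
    classical
    have hfc : ContinuousOn f K :=
      ENNReal.continuous_ofReal.comp_continuousOn (hG.add continuousOn_const)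
    rw [← Set.piecewise_eq_indicator]
    exact hfc.measurable_piecewise continuousOn_const hKm
  filter_upwards [Iio_mem_nhds hδ] with r hr
  calc ∫⁻ y in L r, ENNReal.ofReal (G y) ∂μ
      ≤ ∫⁻ y in L r, K.indicator f (π y) ∂μ := by
        refine setLIntegral_mono' (hLm r) fun y hy => ?_
        obtain ⟨hyK, hπK, hdist⟩ := hL r y hy
        rw [Set.indicator_of_mem hπK]
        have := (abs_lt.1 (hGδ y hyK _ hπK (hdist.trans_lt hr))).2
        exact ENNReal.ofReal_le_ofReal (by linarith)
    _ ≤ ENNReal.ofReal r * ∫⁻ y, K.indicator f y ∂ν := hπ _ hf r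
    _ = ENNReal.ofReal r * ∫⁻ y in K, f y ∂ν := by rw [lintegral_indicator hKm]

theorem eventually_setLIntegral_boundaryLayers_le {G : E d → ℝ}
    (hG : ContinuousOn G (closedHalfBall d)) {η : ℝ} (hη : 0 < η) :
    ∀ᶠ r in 𝓝 (0 : ℝ), (∫⁻ y in flatLayer d r, ENNReal.ofReal (G y)) +
        ∫⁻ y in capLayer d r, ENNReal.ofReal (G y) ≤
      ENNReal.ofReal r *
        ∫⁻ y in closedHalfBall d, ENNReal.ofReal (G y + η) ∂boundaryMeasure d := by
  have h_flat (r : ℝ) (y : E d) (hy : y ∈ flatLayer d r) :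
      y ∈ closedHalfBall d ∧ flatProj y ∈ closedHalfBall d ∧ dist y (flatProj y) ≤ r :=
    ⟨halfBall_subset_closedHalfBall hy.1, flatProj_mem_closedHalfBall hy.1,
      by rw [dist_flatProj, abs_of_pos hy.1.2]; exact hy.2⟩
  have h_cap (r : ℝ) (y : E d) (hy : y ∈ capLayer d r) :
      y ∈ closedHalfBall d ∧ capProj y ∈ closedHalfBall d ∧ dist y (capProj y) ≤ r := by
    refine ⟨halfBall_subset_closedHalfBall hy.1, capProj_mem_closedHalfBall hy.1, ?_⟩
    have hy₀ : y ≠ 0 := fun h => by simpa [h] using hy.1.2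
    rw [dist_capProj hy₀, abs_of_nonpos (by linarith [hy.1.1])]
    linarith [show 1 / 2 - r ≤ ‖y‖ from hy.2]
  have hm : MeasurableSet (closedHalfBall d) := isClosed_closedHalfBall.measurableSet
  filter_upwards [
    eventually_setLIntegral_le isCompact_closedHalfBall hm measurableSet_flatLayer h_flat
      (fun _ hf r => lintegral_flatLayer_comp_flatProj_le hf r) hG hη,
    eventually_setLIntegral_le isCompact_closedHalfBall hm measurableSet_capLayer h_cap
      (fun _ hf r => lintegral_capLayer_comp_capProj_le hf r) hG hη] with r hr_flat hr_cap
  rw [boundaryMeasure_eq_add, Measure.restrict_add, lintegral_add_measure, mul_add]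
  exact add_le_add hr_flat hr_cap

end BoundaryLayers

section Cutoff

open Filter Topology

variable {d : ℕ} {r : ℝ}

theorem hasPD_coord (i k : Fin (d + 1)) (y : E d) :
    HasPD k (fun z : E d => z i) (if i = k then 1 else 0) y := by
  have := ((EuclideanSpace.proj i : E d →L[ℝ] ℝ).hasFDerivAt (x := y)).hasLineDerivAt
    (EuclideanSpace.single k 1)
  simpa [HasPD, Pi.single_apply] using this

theorem hasPD_norm_sq (k : Fin (d + 1)) (y : E d) : HasPD k (fun z => ‖z‖ ^ 2) (2 * y k) y := by
  have := (hasStrictFDerivAt_norm_sq y).hasFDerivAt.hasLineDerivAt (EuclideanSpace.single k 1)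
  simpa [HasPD, EuclideanSpace.inner_single_right] using this

theorem hasCompactSupport_deriv_smoothTransition :
    HasCompactSupport (deriv Real.smoothTransition) := by
  refine HasCompactSupport.intro (isCompact_Icc (a := 0) (b := 1)) fun t ht => ?_
  rcases not_and_or.1 ht with ht | ht
  · refine IsLocalMin.deriv_eq_zero (Eventually.of_forall fun x => ?_)
    rw [Real.smoothTransition.zero_of_nonpos (not_le.1 ht).le]
    exact Real.smoothTransition.nonneg x
  · refine IsLocalMax.deriv_eq_zero (Eventually.of_forall fun x => ?_)
    rw [Real.smoothTransition.one_of_one_le (not_le.1 ht).le]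
    exact Real.smoothTransition.le_one x

theorem exists_norm_deriv_smoothTransition_le :
    ∃ C, ∀ t, ‖deriv Real.smoothTransition t‖ ≤ C :=
  (Real.smoothTransition.contDiff (n := 1)).continuous_deriv le_rfl
    |>.bounded_above_of_compact_support hasCompactSupport_deriv_smoothTransition

/-- A smooth cutoff function, compactly supported in the half ball and equal to one off the boundary
layers of width `r`. -/
def cutoff (r : ℝ) (y : E d) : ℝ :=
  Real.smoothTransition (2 / r * y (Fin.last d) - 1) *
    Real.smoothTransition (1 / r * (1 - 4 * ‖y‖ ^ 2) - 1)

theorem contDiff_cutoff : ContDiff ℝ 1 (cutoff r : E d → ℝ) := by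
  have h_flat : ContDiff ℝ 1 fun y : E d => 2 / r * y (Fin.last d) - 1 := by fun_prop
  have h_cap : ContDiff ℝ 1 fun y : E d => 1 / r * (1 - 4 * ‖y‖ ^ 2) - 1 :=
    (contDiff_const.mul (contDiff_const.sub (contDiff_const.mul (contDiff_norm_sq ℝ)))).sub
      contDiff_const
  exact (Real.smoothTransition.contDiff.comp h_flat).mul
    (Real.smoothTransition.contDiff.comp h_cap)

theorem cutoff_nonneg (y : E d) : 0 ≤ cutoff r y :=
  mul_nonneg (Real.smoothTransition.nonneg _) (Real.smoothTransition.nonneg _)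

theorem cutoff_le_one (y : E d) : cutoff r y ≤ 1 :=
  mul_le_one₀ (Real.smoothTransition.le_one _) (Real.smoothTransition.nonneg _)
    (Real.smoothTransition.le_one _)

theorem tsupport_cutoff_subset_halfBall (hr : 0 < r) :
    tsupport (cutoff r : E d → ℝ) ⊆ halfBall d := by
  have h_supp : Function.support (cutoff r : E d → ℝ) ⊆
      {y | r ≤ 2 * y (Fin.last d)} ∩ {y | r ≤ 1 - 4 * ‖y‖ ^ 2} := by
    intro y hy
    obtain ⟨h_flat, h_cap⟩ := mul_ne_zero_iff.1 (show cutoff r y ≠ 0 from hy)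
    rw [Ne, Real.smoothTransition.zero_iff_nonpos, not_le, sub_pos, div_mul_eq_mul_div,
      one_lt_div hr] at h_flat h_cap
    exact ⟨h_flat.le, by simpa using h_cap.le⟩
  have h_closed : IsClosed ({y | r ≤ 2 * y (Fin.last d)} ∩ {y : E d | r ≤ 1 - 4 * ‖y‖ ^ 2}) :=
    (isClosed_le (by fun_prop) (by fun_prop)).inter (isClosed_le (by fun_prop) (by fun_prop))
  refine (closure_minimal h_supp h_closed).trans fun y ⟨h_flat, h_cap⟩ => ⟨?_, ?_⟩
  · rw [Set.mem_ofPred_eq] at h_cap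
    nlinarith [norm_nonneg y]
  · rw [Set.mem_ofPred_eq] at h_flat
    linarith

theorem hasCompactSupport_cutoff (hr : 0 < r) : HasCompactSupport (cutoff r : E d → ℝ) :=
  isCompact_closedHalfBall.of_isClosed_subset (isClosed_tsupport _)
    ((tsupport_cutoff_subset_halfBall hr).trans halfBall_subset_closedHalfBall)

theorem cutoff_eq_one (hr : 0 < r) {y : E d} (hy : y ∈ halfBall d)
    (hlayers : y ∉ flatLayer d r ∪ capLayer d r) : cutoff r y = 1 := by
  obtain ⟨h_flat, h_cap⟩ := not_or.1 hlayers
  replace h_flat : r < y (Fin.last d) := not_le.1 fun h => h_flat ⟨hy, h⟩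
  replace h_cap : ‖y‖ < 1 / 2 - r := not_le.1 fun h => h_cap ⟨hy, h⟩
  rw [cutoff, Real.smoothTransition.one_of_one_le, Real.smoothTransition.one_of_one_le, one_mul]
  · rw [le_sub_iff_add_le, div_mul_eq_mul_div, le_div_iff₀ hr]
    nlinarith [norm_nonneg y]
  · rw [le_sub_iff_add_le, div_mul_eq_mul_div, le_div_iff₀ hr]
    linarith

theorem eventually_cutoff_eq_one {y : E d} (hy : y ∈ halfBall d) :
    ∀ᶠ r in 𝓝[>] (0 : ℝ), cutoff r y = 1 := by
  have h_flat : ∀ᶠ r in 𝓝[>] (0 : ℝ), r < y (Fin.last d) :=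
    mem_nhdsWithin_of_mem_nhds (Iio_mem_nhds hy.2)
  have h_cap : ∀ᶠ r in 𝓝[>] (0 : ℝ), r < 1 / 2 - ‖y‖ :=
    mem_nhdsWithin_of_mem_nhds (Iio_mem_nhds (sub_pos.2 hy.1))
  filter_upwards [h_flat, h_cap, self_mem_nhdsWithin] with r hr_flat hr_cap hr
  refine cutoff_eq_one hr hy (not_or.2 ⟨fun h => hr_flat.not_ge h.2, fun h => ?_⟩)
  linarith [show 1 / 2 - r ≤ ‖y‖ from h.2]

theorem pd_cutoff_eq_zero (hr : 0 < r) {y : E d} (hy : y ∈ halfBall d)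
    (hlayers : y ∉ flatLayer d r ∪ capLayer d r) (k : Fin (d + 1)) : pd k (cutoff r) y = 0 := by
  have h_max : IsLocalMax (cutoff r) y := Eventually.of_forall fun z =>
    (cutoff_le_one z).trans_eq (cutoff_eq_one hr hy hlayers).symm
  rw [pd_eq_fderiv (contDiff_cutoff.differentiable one_ne_zero y), h_max.fderiv_eq_zero,
    zero_apply]

theorem hasPD_cutoff (r : ℝ) (y : E d) (k : Fin (d + 1)) :
    HasPD k (cutoff r)
      (deriv Real.smoothTransition (2 / r * y (Fin.last d) - 1) *
          (2 / r * if Fin.last d = k then 1 else 0) *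
            Real.smoothTransition (1 / r * (1 - 4 * ‖y‖ ^ 2) - 1) +
        Real.smoothTransition (2 / r * y (Fin.last d) - 1) *
          (deriv Real.smoothTransition (1 / r * (1 - 4 * ‖y‖ ^ 2) - 1) * -(8 / r * y k))) y := by
  have h_deriv (t : ℝ) : HasDerivAt Real.smoothTransition (deriv Real.smoothTransition t) t :=
    ((Real.smoothTransition.contDiff (n := 1)).differentiable one_ne_zero _).hasDerivAt
  have h_flat := (((hasPD_coord (Fin.last d) k y).const_mul (2 / r)).sub
    (HasPD.const 1 k y)).comp (h_deriv _)
  have h_cap := ((((HasPD.const 1 k y).sub ((hasPD_norm_sq k y).const_mul 4)).const_mul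
    (1 / r)).sub (HasPD.const 1 k y)).comp (h_deriv _)
  exact (h_flat.mul h_cap).congr_deriv (by ring)

theorem norm_pd_cutoff_le {C : ℝ} (hC : ∀ t, ‖deriv Real.smoothTransition t‖ ≤ C) (hr : 0 < r)
    {y : E d} (hy : ‖y‖ ≤ 1 / 2) (k : Fin (d + 1)) : ‖pd k (cutoff r) y‖ ≤ 6 * C / r := by
  have h_one (t : ℝ) : ‖Real.smoothTransition t‖ ≤ 1 := by
    rw [Real.norm_of_nonneg (Real.smoothTransition.nonneg t)]
    exact Real.smoothTransition.le_one t
  have h_flat : ‖2 / r * (if Fin.last d = k then 1 else 0)‖ ≤ 2 / r * 1 :=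
    norm_mul_le_of_le (Real.norm_of_nonneg (by positivity)).le (by split_ifs <;> simp)
  have h_cap : ‖-(8 / r * y k)‖ ≤ 8 / r * (1 / 2) := by
    rw [norm_neg]
    exact norm_mul_le_of_le (Real.norm_of_nonneg (by positivity)).le
      ((PiLp.norm_apply_le y k).trans hy)
  rw [(hasPD_cutoff r y k).pd_eq]
  calc _ ≤ C * (2 / r * 1) * 1 + 1 * (C * (8 / r * (1 / 2))) := norm_add_le_of_le
        (norm_mul_le_of_le (norm_mul_le_of_le (hC _) h_flat) (h_one _))
        (norm_mul_le_of_le (h_one _) (norm_mul_le_of_le (hC _) h_cap))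
    _ = 6 * C / r := by ring

theorem lintegral_sum_norm_pd_cutoff_mul_le {C : ℝ}
    (hC : ∀ t, ‖deriv Real.smoothTransition t‖ ≤ C) (hr : 0 < r) (G : E d → ℝ) :
    ∫⁻ y in halfBall d, ENNReal.ofReal ((∑ k, |pd k (cutoff r) y|) * G y) ≤
      ENNReal.ofReal (6 * (d + 1) * C / r) *
        ((∫⁻ y in flatLayer d r, ENNReal.ofReal (G y)) +
          ∫⁻ y in capLayer d r, ENNReal.ofReal (G y)) := by
  set L := flatLayer d r ∪ capLayer d r
  have hL : MeasurableSet L := (measurableSet_flatLayer r).union (measurableSet_capLayer r)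
  have h_sum (y : E d) (hy : y ∈ halfBall d) :
      ∑ k, |pd k (cutoff r) y| ≤ 6 * (d + 1) * C / r :=
    (Finset.sum_le_card_nsmul _ _ _ fun k _ => norm_pd_cutoff_le hC hr hy.1.le k).trans_eq
      (by simp; ring)
  have h_le (y : E d) (hy : y ∈ halfBall d) :
      ENNReal.ofReal ((∑ k, |pd k (cutoff r) y|) * G y) ≤
        L.indicator (fun y => ENNReal.ofReal (6 * (d + 1) * C / r) * ENNReal.ofReal (G y)) y := by
    by_cases hyL : y ∈ L
    · rw [Set.indicator_of_mem hyL,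
        ENNReal.ofReal_mul (Finset.sum_nonneg fun k _ => abs_nonneg _)]
      gcongr
      exact h_sum y hy
    · simp [pd_cutoff_eq_zero hr hy hyL]
  calc _ ≤ ∫⁻ y in halfBall d, L.indicator
          (fun y => ENNReal.ofReal (6 * (d + 1) * C / r) * ENNReal.ofReal (G y)) y :=
        setLIntegral_mono' isOpen_halfBall.measurableSet h_le
    _ ≤ ∫⁻ y in L, ENNReal.ofReal (6 * (d + 1) * C / r) * ENNReal.ofReal (G y) :=
        (setLIntegral_le_lintegral _ _).trans_eq (lintegral_indicator hL _)
    _ ≤ _ := by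
        rw [lintegral_const_mul' _ _ ENNReal.ofReal_ne_top]
        gcongr
        exact lintegral_union_le _ _ _

end Cutoff

section Limit

open Filter Topology

variable {d : ℕ}

theorem closedHalfBall_mem_nhds {y : E d} (hy : y ∈ halfBall d) : closedHalfBall d ∈ 𝓝 y :=
  mem_of_superset (isOpen_halfBall.mem_nhds hy) halfBall_subset_closedHalfBall

theorem ofReal_integral_le_setLIntegral {X : Type*} [MeasurableSpace X] {μ : Measure X}
    {U : Set X} (hU : MeasurableSet U) {f g : X → ℝ} (hf : ∀ x ∉ U, f x = 0)
    (hfg : ∀ x ∈ U, f x ≤ g x) :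
    ENNReal.ofReal (∫ x, f x ∂μ) ≤ ∫⁻ x in U, ENNReal.ofReal (g x) ∂μ := by
  rw [← setIntegral_eq_integral_of_forall_compl_eq_zero hf]
  by_cases hi : Integrable f (μ.restrict U)
  · rw [integral_eq_lintegral_pos_part_sub_lintegral_neg_part hi]
    refine ENNReal.ofReal_le_of_le_toReal (sub_le_self _ ENNReal.toReal_nonneg) |>.trans ?_
    exact setLIntegral_mono' hU fun x hx => ENNReal.ofReal_le_ofReal (hfg x hx)
  · simp [integral_undef hi]

theorem setLIntegral_le_ofReal_integral {X : Type*} [MeasurableSpace X] {μ : Measure X}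
    {U : Set X} (hU : MeasurableSet U) {f : X → ℝ} (hfi : Integrable f μ)
    (hf : ∀ x ∉ U, f x = 0) (hf₀ : ∀ x ∈ U, 0 ≤ f x) :
    ∫⁻ x in U, ENNReal.ofReal (f x) ∂μ ≤ ENNReal.ofReal (∫ x, f x ∂μ) := by
  rw [← setIntegral_eq_integral_of_forall_compl_eq_zero hf,
    ofReal_integral_eq_lintegral_ofReal hfi.integrableOn (ae_restrict_of_forall_mem hU hf₀)]

theorem ofReal_mul_lintegral_cutoff_le {c c' C r : ℝ} (hc : 0 ≤ c) (hc' : 0 ≤ c')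
    (hC : ∀ t, ‖deriv Real.smoothTransition t‖ ≤ C) (hr : 0 < r) {F G : E d → ℝ}
    (hF : ∀ y, 0 ≤ F y) (hG : ContinuousOn G (closedHalfBall d)) (hG₀ : ∀ y ∈ halfBall d, 0 ≤ G y)
    (h : c * ∫ y, cutoff r y * G y ≤ (∫ y, cutoff r y * F y) +
      c' * ∫ y, (∑ k, |pd k (cutoff r) y|) * G y) :
    ENNReal.ofReal c * ∫⁻ y in halfBall d, ENNReal.ofReal (cutoff r y * G y) ≤
      (∫⁻ y in halfBall d, ENNReal.ofReal (F y)) + ENNReal.ofReal (6 * (d + 1) * C * c' / r) *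
        ((∫⁻ y in flatLayer d r, ENNReal.ofReal (G y)) +
          ∫⁻ y in capLayer d r, ENNReal.ofReal (G y)) := by
  have hU : MeasurableSet (halfBall d) := isOpen_halfBall.measurableSet
  have hsub := tsupport_cutoff_subset_halfBall (d := d) hr
  have h_off (y : E d) (hy : y ∉ halfBall d) : cutoff r y = 0 :=
    image_eq_zero_of_notMem_tsupport fun hy' => hy (hsub hy')
  have h_pd_off (y : E d) (hy : y ∉ halfBall d) (k : Fin (d + 1)) : pd k (cutoff r) y = 0 :=
    pd_eq_zero_of_notMem_tsupport (fun hy' => hy (hsub hy')) k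
  have h_lower := setLIntegral_le_ofReal_integral (μ := volume) hU
    (integrable_mul_of_tsupport contDiff_cutoff.continuous (hasCompactSupport_cutoff hr)
      fun y hy => hG.continuousAt (closedHalfBall_mem_nhds (hsub hy)))
    (fun y hy => by rw [h_off y hy, zero_mul])
    fun y hy => mul_nonneg (cutoff_nonneg y) (hG₀ y hy)
  have h_source : ENNReal.ofReal (∫ y, cutoff r y * F y) ≤
      ∫⁻ y in halfBall d, ENNReal.ofReal (F y) :=
    ofReal_integral_le_setLIntegral hU (fun y hy => by rw [h_off y hy, zero_mul])
      fun y _ => mul_le_of_le_one_left (hF y) (cutoff_le_one y)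
  have h_layer := (ofReal_integral_le_setLIntegral (μ := volume) hU
    (f := fun y => (∑ k, |pd k (cutoff r) y|) * G y)
    (fun y hy => by simp [h_pd_off y hy]) fun y _ => le_rfl).trans
      (lintegral_sum_norm_pd_cutoff_mul_le hC hr G)
  calc ENNReal.ofReal c * ∫⁻ y in halfBall d, ENNReal.ofReal (cutoff r y * G y)
      ≤ ENNReal.ofReal (c * ∫ y, cutoff r y * G y) := by rw [ENNReal.ofReal_mul hc]; gcongr
    _ ≤ ENNReal.ofReal (∫ y, cutoff r y * F y) +
          ENNReal.ofReal (c' * ∫ y, (∑ k, |pd k (cutoff r) y|) * G y) :=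
        (ENNReal.ofReal_le_ofReal h).trans ENNReal.ofReal_add_le
    _ ≤ _ := by
        have h_const : 6 * (d + 1) * C * c' / r = c' * (6 * (d + 1) * C / r) := by ring
        rw [ENNReal.ofReal_mul hc', h_const, ENNReal.ofReal_mul hc', mul_assoc]
        gcongr

theorem eventually_ofReal_mul_lintegral_cutoff_le {c c' C η : ℝ} (hc : 0 ≤ c) (hc' : 0 ≤ c')
    (hC : ∀ t, ‖deriv Real.smoothTransition t‖ ≤ C) (hη : 0 < η) {F G : E d → ℝ}
    (hF : ∀ y, 0 ≤ F y) (hG : ContinuousOn G (closedHalfBall d)) (hG₀ : ∀ y ∈ halfBall d, 0 ≤ G y)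
    (h : ∀ r > 0, c * ∫ y, cutoff r y * G y ≤ (∫ y, cutoff r y * F y) +
      c' * ∫ y, (∑ k, |pd k (cutoff r) y|) * G y) :
    ∀ᶠ r in 𝓝[>] (0 : ℝ),
      ENNReal.ofReal c * ∫⁻ y in halfBall d, ENNReal.ofReal (cutoff r y * G y) ≤
        (∫⁻ y in halfBall d, ENNReal.ofReal (F y)) + ENNReal.ofReal (6 * (d + 1) * C * c') *
          ∫⁻ y in closedHalfBall d, ENNReal.ofReal (G y + η) ∂boundaryMeasure d := by
  filter_upwards [self_mem_nhdsWithin,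
    mem_nhdsWithin_of_mem_nhds (eventually_setLIntegral_boundaryLayers_le hG hη)] with r hr hlayer
  have hr' : r ≠ 0 := ne_of_gt hr
  have hC₀ : 0 ≤ C := (norm_nonneg _).trans (hC 0)
  refine (ofReal_mul_lintegral_cutoff_le hc hc' hC hr hF hG hG₀ (h r hr)).trans ?_
  refine add_le_add le_rfl ((mul_le_mul_right hlayer _).trans_eq ?_)
  rw [← mul_assoc, ← ENNReal.ofReal_mul (div_nonneg (by positivity) hr.le), div_mul_cancel₀ _ hr']

theorem mul_lintegral_halfBall_le_of_eventually_cutoff {f : E d → ℝ}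
    (hf : ContinuousOn f (halfBall d)) {k B : ℝ≥0∞} (hk : k ≠ ⊤)
    (h : ∀ᶠ r in 𝓝[>] (0 : ℝ),
      k * ∫⁻ y in halfBall d, ENNReal.ofReal (cutoff r y * f y) ≤ B) :
    k * ∫⁻ y in halfBall d, ENNReal.ofReal (f y) ≤ B := by
  have hU : MeasurableSet (halfBall d) := isOpen_halfBall.measurableSet
  obtain ⟨r, hr⟩ := exists_seq_tendsto (𝓝[>] (0 : ℝ))
  have hmeas (j : ℕ) : AEMeasurable (fun y => k * ENNReal.ofReal (cutoff (r j) y * f y))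
      (volume.restrict (halfBall d)) :=
    ((contDiff_cutoff.continuous.continuousOn.mul hf).aemeasurable hU).ennreal_ofReal.const_mul k
  have h_liminf (y : E d) (hy : y ∈ halfBall d) :
      k * ENNReal.ofReal (f y) =
        liminf (fun j => k * ENNReal.ofReal (cutoff (r j) y * f y)) atTop := by
    refine (Tendsto.liminf_eq (tendsto_const_nhds.congr' ?_)).symm
    filter_upwards [hr.eventually (eventually_cutoff_eq_one hy)] with j hj
    rw [hj, one_mul]
  simp only [← lintegral_const_mul' k _ hk] at h ⊢
  calc ∫⁻ y in halfBall d, k * ENNReal.ofReal (f y)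
      = ∫⁻ y in halfBall d, liminf (fun j => k * ENNReal.ofReal (cutoff (r j) y * f y)) atTop :=
        setLIntegral_congr_fun hU h_liminf
    _ ≤ liminf (fun j => ∫⁻ y in halfBall d, k * ENNReal.ofReal (cutoff (r j) y * f y)) atTop :=
        lintegral_liminf_le' hmeas
    _ ≤ B := liminf_le_of_frequently_le' (hr.eventually h).frequently

theorem ofReal_mul_lintegral_halfBall_le {c c' C : ℝ} (hc : 0 ≤ c) (hc' : 0 ≤ c')
    (hC : ∀ t, ‖deriv Real.smoothTransition t‖ ≤ C) {F G : E d → ℝ}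
    (hF : ∀ y, 0 ≤ F y) (hG : ContinuousOn G (closedHalfBall d)) (hG₀ : ∀ y ∈ halfBall d, 0 ≤ G y)
    (h : ∀ r > 0, c * ∫ y, cutoff r y * G y ≤ (∫ y, cutoff r y * F y) +
      c' * ∫ y, (∑ k, |pd k (cutoff r) y|) * G y) :
    ENNReal.ofReal c * ∫⁻ y in halfBall d, ENNReal.ofReal (G y) ≤
      (∫⁻ y in halfBall d, ENNReal.ofReal (F y)) + ENNReal.ofReal (6 * (d + 1) * C * c') *
        ∫⁻ y in closedHalfBall d, ENNReal.ofReal (G y) ∂boundaryMeasure d := by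
  set I := ∫⁻ y in halfBall d, ENNReal.ofReal (F y)
  set A := ∫⁻ y in closedHalfBall d, ENNReal.ofReal (G y) ∂boundaryMeasure d
  set B := ENNReal.ofReal (6 * (d + 1) * C * c')
  set V := (boundaryMeasure d).restrict (closedHalfBall d) Set.univ
  have h_approx (η : ℝ) (hη : 0 < η) :
      ENNReal.ofReal c * ∫⁻ y in halfBall d, ENNReal.ofReal (G y) ≤
        I + B * (A + ENNReal.ofReal η * V) := by
    refine (mul_lintegral_halfBall_le_of_eventually_cutoff
      (hG.mono halfBall_subset_closedHalfBall) ENNReal.ofReal_ne_top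
      (eventually_ofReal_mul_lintegral_cutoff_le hc hc' hC hη hF hG hG₀ h)).trans ?_
    gcongr
    calc ∫⁻ y in closedHalfBall d, ENNReal.ofReal (G y + η) ∂boundaryMeasure d
        ≤ ∫⁻ y in closedHalfBall d, ENNReal.ofReal (G y) + ENNReal.ofReal η ∂boundaryMeasure d :=
          lintegral_mono fun _ => ENNReal.ofReal_add_le
      _ = A + ENNReal.ofReal η * V := by
          rw [lintegral_add_right _ measurable_const, lintegral_const]
  have h_lim : Tendsto (fun η : ℝ => I + B * (A + ENNReal.ofReal η * V)) (𝓝[>] 0)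
      (𝓝 (I + B * (A + ENNReal.ofReal 0 * V))) :=
    tendsto_const_nhds.add (ENNReal.Tendsto.const_mul (tendsto_const_nhds.add
      (ENNReal.Tendsto.mul_const (ENNReal.tendsto_ofReal (tendsto_id.mono_left nhdsWithin_le_nhds))
        (Or.inr (measure_ne_top _ _)))) (Or.inr ENNReal.ofReal_ne_top))
  rw [ENNReal.ofReal_zero, zero_mul, add_zero] at h_lim
  exact ge_of_tendsto h_lim (eventually_mem_nhdsWithin.mono h_approx)

end Limit

section Weight

variable {d : ℕ} {k l : Fin (d + 1)} {y : E d}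

theorem h_eq_norm_sq (y : E d) :
    h y = -1 / 4 * ‖y‖ ^ 2 + (3 / 4 * (y (Fin.last d) * y (Fin.last d)) - y (Fin.last d)) := by
  rw [h, EuclideanSpace.real_norm_sq_eq, Fin.sum_univ_castSucc]
  ring

theorem contDiff_h {n : WithTop ℕ∞} : ContDiff ℝ n (h : E d → ℝ) := by
  unfold h
  fun_prop

theorem hasPD_h (k : Fin (d + 1)) (y : E d) :
    HasPD k h (-1 / 2 * y k + (if Fin.last d = k then 1 else 0) * (3 / 2 * y (Fin.last d) - 1))
      y := by
  have h_last := hasPD_coord (Fin.last d) k y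
  rw [funext h_eq_norm_sq]
  exact (((hasPD_norm_sq k y).const_mul (-1 / 4)).add
    (((h_last.mul h_last).const_mul (3 / 4)).sub h_last)).congr_deriv (by ring)

theorem pd_h_eq (k : Fin (d + 1)) :
    pd k (h : E d → ℝ) = fun y =>
      -1 / 2 * y k + (if Fin.last d = k then 1 else 0) * (3 / 2 * y (Fin.last d) - 1) :=
  funext fun y => (hasPD_h k y).pd_eq

theorem pd_pd_h (k l : Fin (d + 1)) (y : E d) :
    pd k (pd l h) y = -1 / 2 * (if l = k then 1 else 0) +
      (if Fin.last d = l then 1 else 0) * (3 / 2 * (if Fin.last d = k then 1 else 0)) := by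
  rw [pd_h_eq]
  exact (((hasPD_coord l k y).const_mul _).add ((((hasPD_coord (Fin.last d) k y).const_mul _).sub
    (HasPD.const 1 k y)).const_mul _)).pd_eq.trans (by rw [sub_zero])

theorem norm_coord_le_half (hy : y ∈ halfBall d) (k : Fin (d + 1)) : ‖y k‖ ≤ 1 / 2 :=
  (PiLp.norm_apply_le y k).trans hy.1.le

theorem norm_pd_h_le (hy : y ∈ halfBall d) (k : Fin (d + 1)) : ‖pd k h y‖ ≤ 1 := by
  have hk := abs_le.1 (norm_coord_le_half hy k)
  have h_last := hy.2
  rw [pd_h_eq, Real.norm_eq_abs, abs_le]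
  dsimp only
  split_ifs with h_eq
  · subst h_eq
    constructor <;> linarith
  · constructor <;> linarith

theorem norm_pd_pd_h_le (k l : Fin (d + 1)) (y : E d) : ‖pd k (pd l h) y‖ ≤ 1 := by
  rw [pd_pd_h]
  split_ifs <;> first | (norm_num; done) | grind

theorem quarter_le_norm_grad_h_sq (hy : y ∈ halfBall d) : 1 / 4 ≤ ‖grad h y‖ ^ 2 := by
  have h_coord := abs_le.1 (norm_coord_le_half hy (Fin.last d))
  have h_pd : pd (Fin.last d) h y = y (Fin.last d) - 1 := by
    rw [pd_h_eq, if_pos rfl]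
    ring
  calc 1 / 4 ≤ (y (Fin.last d) - 1) ^ 2 := by nlinarith
    _ = ‖pd (Fin.last d) h y‖ ^ 2 := by rw [h_pd, Real.norm_eq_abs, sq_abs]
    _ ≤ ‖grad h y‖ ^ 2 := by gcongr; exact norm_pd_le_norm_grad _

theorem neg_one_le_h (hy : y ∈ halfBall d) : -1 ≤ h y := by
  have h_coord := abs_le.1 (norm_coord_le_half hy (Fin.last d))
  rw [h_eq_norm_sq]
  nlinarith [hy.1, norm_nonneg y, sq_nonneg (y (Fin.last d))]

theorem mul_exp_neg_le_largeParam {τ s : ℝ} (hτ : 0 ≤ τ) (hs : 0 ≤ s) (hy : y ∈ halfBall d) :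
    τ * (s * Real.exp (-s)) ≤ largeParam τ s h y := by
  have h_exp : -s ≤ s * h y := by nlinarith [neg_one_le_h hy]
  rw [largeParam, ← mul_assoc]
  gcongr

end Weight

section DerivativesWithin

open Filter Topology

variable {d : ℕ} {f v : E d → ℝ} {y : E d}

theorem convex_closedHalfBall : Convex ℝ (closedHalfBall d) := by
  have h_ball : Convex ℝ {y : E d | ‖y‖ ≤ 1 / 2} := by
    simpa only [Metric.closedBall, dist_zero_right] using convex_closedBall (0 : E d) (1 / 2)
  exact h_ball.inter
    (convex_halfSpace_ge (EuclideanSpace.proj (𝕜 := ℝ) (Fin.last d) : E d →L[ℝ] ℝ).isLinear 0)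

theorem nonempty_halfBall : (halfBall d).Nonempty :=
  ⟨EuclideanSpace.single (Fin.last d) (1 / 4), by simp; norm_num, by simp⟩

theorem uniqueDiffOn_closedHalfBall : UniqueDiffOn ℝ (closedHalfBall d) :=
  uniqueDiffOn_convex convex_closedHalfBall (nonempty_halfBall.mono
    (interior_maximal halfBall_subset_closedHalfBall isOpen_halfBall))

theorem continuousOn_gradientWithin (hv : ContDiffOn ℝ 2 v (closedHalfBall d)) :
    ContinuousOn (gradientWithin v (closedHalfBall d)) (closedHalfBall d) :=
  (InnerProductSpace.toDual ℝ (E d)).symm.continuous.comp_continuousOn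
    (hv.continuousOn_fderivWithin uniqueDiffOn_closedHalfBall one_le_two)

theorem partialWithin_eq_pd {S : Set (E d)} (hS : S ∈ 𝓝 y) (hf : DifferentiableAt ℝ f y)
    (k : Fin (d + 1)) : partialWithin S k f y = pd k f y := by
  rw [partialWithin, fderivWithin_of_mem_nhds hS, pd_eq_fderiv hf]

theorem partialWithin_partialWithin_eq_pd (hy : y ∈ halfBall d) (hv : ContDiffAt ℝ 2 v y)
    (k l : Fin (d + 1)) :
    partialWithin (closedHalfBall d) k (partialWithin (closedHalfBall d) l v) y =
      pd k (pd l v) y := by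
  have h_eventually : partialWithin (closedHalfBall d) l v =ᶠ[𝓝 y] pd l v := by
    filter_upwards [isOpen_halfBall.mem_nhds hy, hv.eventually (by simp)] with z hz hvz
    exact partialWithin_eq_pd (closedHalfBall_mem_nhds hz) (hvz.differentiableAt two_ne_zero) l
  have h_mem := closedHalfBall_mem_nhds hy
  rw [← partialWithin_eq_pd h_mem (differentiableAt_pd hv), partialWithin, partialWithin,
    fderivWithin_of_mem_nhds h_mem, fderivWithin_of_mem_nhds h_mem, h_eventually.fderiv_eq]

theorem gradientWithin_eq_grad (hy : y ∈ halfBall d) (hv : DifferentiableAt ℝ v y) :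
    gradientWithin v (closedHalfBall d) y = grad v y := by
  ext k
  have h_inner (g : E d) : g k = inner ℝ g (EuclideanSpace.single k (1 : ℝ)) := by
    simp [EuclideanSpace.inner_single_right]
  rw [h_inner, gradientWithin, InnerProductSpace.toDual_symm_apply]
  exact partialWithin_eq_pd (closedHalfBall_mem_nhds hy) hv k

end DerivativesWithin

section Symmetrization

variable {d : ℕ} {a : Fin (d + 1) → Fin (d + 1) → E d → ℝ} {θ M : ℝ} {y : E d}

/-- The symmetric part of a coefficient matrix. -/
def symmetrize (a : Fin (d + 1) → Fin (d + 1) → E d → ℝ) (i j : Fin (d + 1)) (y : E d) : ℝ :=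
  (a i j y + a j i y) / 2

theorem sum_symmetrize_mul {X : Fin (d + 1) → Fin (d + 1) → ℝ} (hX : ∀ i j, X i j = X j i) :
    ∑ i, ∑ j, symmetrize a i j y * X i j = ∑ i, ∑ j, a i j y * X i j := by
  have h_swap : ∑ i, ∑ j, a j i y * X i j = ∑ i, ∑ j, a i j y * X i j := by
    rw [Finset.sum_comm]
    simp only [hX]
  calc ∑ i, ∑ j, symmetrize a i j y * X i j
      = (∑ i, ∑ j, a i j y * X i j + ∑ i, ∑ j, a j i y * X i j) / 2 := by
        simp only [symmetrize, div_mul_eq_mul_div, add_mul, ← Finset.sum_div,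
          Finset.sum_add_distrib]
    _ = ∑ i, ∑ j, a i j y * X i j := by rw [h_swap, add_self_div_two]

theorem ellipticOp_eq_nondivOp_symmetrize {b : Fin (d + 1) → E d → ℝ} {c v : E d → ℝ}
    (hy : y ∈ halfBall d) (hv : ContDiffAt ℝ 2 v y) :
    ellipticOp a b c v y = nondivOp (symmetrize a) b c v y := by
  unfold ellipticOp nondivOp
  rw [sum_symmetrize_mul fun i j => pd_comm hv]
  simp only [partialWithin_partialWithin_eq_pd hy hv,
    partialWithin_eq_pd (closedHalfBall_mem_nhds hy) (hv.differentiableAt two_ne_zero)]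

theorem UniformlyElliptic.le_sum_symmetrize (ha : UniformlyElliptic (halfBall d) a θ)
    (hy : y ∈ halfBall d) (ξ : E d) :
    θ * ‖ξ‖ ^ 2 ≤ ∑ i, (∑ j, symmetrize a i j y * ξ j) * ξ i := by
  simp only [Finset.sum_mul, mul_assoc]
  rw [sum_symmetrize_mul fun i j => mul_comm _ _]
  exact (ha y hy ξ).trans_eq (by simp only [mul_assoc, mul_comm])

theorem norm_add_div_two_le {p q : ℝ} (hp : |p| ≤ M) (hq : |q| ≤ M) : ‖(p + q) / 2‖ ≤ M := by
  rw [norm_div, Real.norm_two, div_le_iff₀ two_pos, mul_two]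
  exact norm_add_le_of_le hp hq

theorem C1NormLE.contDiffAt (ha : C1NormLE (halfBall d) a M) (hy : y ∈ halfBall d)
    (i j : Fin (d + 1)) : ContDiffAt ℝ 1 (a i j) y :=
  (ha i j).1.contDiffAt (isOpen_halfBall.mem_nhds hy)

theorem C1NormLE.norm_pd_symmetrize_le (ha : C1NormLE (halfBall d) a M) (hy : y ∈ halfBall d)
    (k i j : Fin (d + 1)) : ‖pd k (symmetrize a i j) y‖ ≤ M := by
  have hd (i j : Fin (d + 1)) := (ha.contDiffAt hy i j).differentiableAt one_ne_zero
  have h_le (i j : Fin (d + 1)) : |pd k (a i j) y| ≤ M := by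
    rw [← partialWithin_eq_pd (isOpen_halfBall.mem_nhds hy) (hd i j)]
    exact ((ha i j).2 y hy).2 k
  have h_pd : HasPD k (symmetrize a i j) ((pd k (a i j) y + pd k (a j i) y) / 2) y :=
    ((HasPD.of_differentiableAt (hd i j)).add (.of_differentiableAt (hd j i))).div_const 2
  rw [h_pd.pd_eq]
  exact norm_add_div_two_le (h_le i j) (h_le j i)

theorem isAdmissibleSymbol_symmetrize (hθ : 0 ≤ θ) (ha : C1NormLE (halfBall d) a M)
    (hell : UniformlyElliptic (halfBall d) a θ) (hy : y ∈ halfBall d) :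
    IsAdmissibleSymbol (max (d + 1) M) (θ / 4) h (symmetrize a) y where
  one_le := le_max_of_le_left (by simp)
  card_le := le_max_of_le_left (by simp)
  contDiffAt_weight := contDiff_h.contDiffAt
  norm_pd_weight_le k := (norm_pd_h_le hy k).trans (le_max_of_le_left (by simp))
  norm_pd_pd_weight_le k l := (norm_pd_pd_h_le k l y).trans (le_max_of_le_left (by simp))
  contDiffAt_coeff i j := ((ha.contDiffAt hy i j).add (ha.contDiffAt hy j i)).div_const 2
  symm i j := by rw [symmetrize, symmetrize, add_comm]
  norm_coeff_le i j := le_max_of_le_right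
    (norm_add_div_two_le ((ha i j).2 y hy).1 ((ha j i).2 y hy).1)
  norm_pd_coeff_le k i j := le_max_of_le_right (ha.norm_pd_symmetrize_le hy k i j)
  elliptic ξ := (mul_le_mul_of_nonneg_right (by linarith) (sq_nonneg _)).trans
    (hell.le_sum_symmetrize hy ξ)
  noncharacteristic :=
    calc θ / 4 = θ * (1 / 4) := by ring
      _ ≤ θ * ‖grad h y‖ ^ 2 := by gcongr; exact quarter_le_norm_grad_h_sq hy
      _ ≤ dirichletEnergy (symmetrize a) h y := hell.le_sum_symmetrize hy _

end Symmetrization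

section Norms

variable {d : ℕ} {τ s : ℝ} {v : E d → ℝ} {μ ν : Measure (E d)}

/-- The quantity `τ^{3/2} s² ‖ψ^{3/2} e^{τψ} v‖` in `L²(μ)`. -/
def valueNorm (τ s : ℝ) (v : E d → ℝ) (μ : Measure (E d)) : ℝ≥0∞ :=
  ENNReal.ofReal (τ ^ (3 / 2 : ℝ) * s ^ 2) *
    eLpNorm (fun y => psi s y ^ (3 / 2 : ℝ) * Real.exp (τ * psi s y) * v y) 2 μ

/-- The quantity `τ^{1/2} s ‖ψ^{1/2} e^{τψ} ∇v‖` in `L²(μ)`, with the one-sided gradient of `v` on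
the boundary of the half ball. -/
def gradientNorm (τ s : ℝ) (v : E d → ℝ) (μ : Measure (E d)) : ℝ≥0∞ :=
  ENNReal.ofReal (τ ^ (1 / 2 : ℝ) * s) *
    eLpNorm (fun y => (psi s y ^ (1 / 2 : ℝ) * Real.exp (τ * psi s y)) •
      gradientWithin v (closedHalfBall d) y) 2 μ

/-- The extension of `carlemanDensity` to the closed half ball by one-sided derivatives. -/
def closedDensity (τ s : ℝ) (v : E d → ℝ) (y : E d) : ℝ :=
  expWeight τ s h y ^ 2 * (largeParam τ s h y * ‖gradientWithin v (closedHalfBall d) y‖ ^ 2 +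
    largeParam τ s h y ^ 3 * v y ^ 2)

theorem valueNorm_mono_measure (hμν : μ ≤ ν) : valueNorm τ s v μ ≤ valueNorm τ s v ν :=
  mul_le_mul_right (eLpNorm_mono_measure _ hμν) _

theorem gradientNorm_mono_measure (hμν : μ ≤ ν) : gradientNorm τ s v μ ≤ gradientNorm τ s v ν :=
  mul_le_mul_right (eLpNorm_mono_measure _ hμν) _

theorem closedDensity_eq_carlemanDensity {y : E d} (hy : y ∈ halfBall d)
    (hv : DifferentiableAt ℝ v y) : closedDensity τ s v y = carlemanDensity τ s h v y := by
  rw [closedDensity, gradientWithin_eq_grad hy hv, carlemanDensity, carlemanEnergy]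

theorem continuous_largeParam_h : Continuous (largeParam τ s h : E d → ℝ) :=
  continuous_iff_continuousAt.2 fun _ =>
    (contDiffAt_largeParam (n := 0) contDiff_h.contDiffAt).continuousAt

theorem continuous_expWeight_h : Continuous (expWeight τ s h : E d → ℝ) :=
  continuous_iff_continuousAt.2 fun _ =>
    (contDiffAt_expWeight (n := 0) contDiff_h.contDiffAt).continuousAt

theorem continuousOn_closedDensity (hv : ContDiffOn ℝ 2 v (closedHalfBall d)) :
    ContinuousOn (closedDensity τ s v) (closedHalfBall d) := by
  have hσ := (continuous_largeParam_h (τ := τ) (s := s)).continuousOn (s := closedHalfBall d)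
  exact (continuous_expWeight_h.continuousOn.pow 2).mul
    ((hσ.mul ((continuousOn_gradientWithin hv).norm.pow 2)).add
      ((hσ.pow 3).mul (hv.continuousOn.pow 2)))

theorem sq_ofReal_mul_eLpNorm_two {X F : Type*} [MeasurableSpace X] {μ : Measure X}
    [NormedAddCommGroup F] {k : ℝ} (hk : 0 ≤ k) (f : X → F) :
    (ENNReal.ofReal k * eLpNorm f 2 μ) ^ 2 = ∫⁻ y, ENNReal.ofReal ((k * ‖f y‖) ^ 2) ∂μ := by
  have h_norm : eLpNorm f 2 μ ^ 2 = ∫⁻ y, ‖f y‖ₑ ^ 2 ∂μ := by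
    simpa only [NNReal.coe_ofNat, ENNReal.coe_ofNat, ENNReal.rpow_ofNat] using
      eLpNorm_nnreal_pow_eq_lintegral (f := f) (μ := μ) (p := 2) two_ne_zero
  rw [mul_pow, h_norm, ← lintegral_const_mul' _ _ (ENNReal.pow_ne_top ENNReal.ofReal_ne_top)]
  refine lintegral_congr fun y => ?_
  rw [← mul_pow, ← ofReal_norm, ← ENNReal.ofReal_mul hk, ENNReal.ofReal_pow (by positivity)]

theorem sq_rpow_div_two {x : ℝ} (hx : 0 ≤ x) (p : ℝ) : (x ^ (p / 2)) ^ 2 = x ^ p := by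
  rw [← Real.rpow_mul_natCast hx, Nat.cast_ofNat, div_mul_cancel₀ _ two_ne_zero]

theorem sq_mul_norm_weighted_value (hτ : 0 ≤ τ) (y : E d) :
    (τ ^ (3 / 2 : ℝ) * s ^ 2 *
        ‖psi s y ^ (3 / 2 : ℝ) * Real.exp (τ * psi s y) * v y‖) ^ 2 =
      s * (expWeight τ s h y ^ 2 * (largeParam τ s h y ^ 3 * v y ^ 2)) := by
  have hψ : 0 ≤ psi s y := (Real.exp_pos _).le
  rw [Real.norm_eq_abs]
  simp only [mul_pow, sq_abs, sq_rpow_div_two hτ, sq_rpow_div_two hψ, Real.rpow_ofNat]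
  unfold largeParam expWeight psi
  ring

theorem sq_mul_norm_weighted_gradient (hτ : 0 ≤ τ) (X : E d) (y : E d) :
    (τ ^ (1 / 2 : ℝ) * s * ‖(psi s y ^ (1 / 2 : ℝ) * Real.exp (τ * psi s y)) • X‖) ^ 2 =
      s * (expWeight τ s h y ^ 2 * (largeParam τ s h y * ‖X‖ ^ 2)) := by
  have hψ : 0 ≤ psi s y := (Real.exp_pos _).le
  rw [norm_smul, Real.norm_eq_abs]
  simp only [mul_pow, sq_abs, sq_rpow_div_two hτ, sq_rpow_div_two hψ, Real.rpow_one]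
  unfold largeParam expWeight psi
  ring

theorem valueNorm_sq_add_gradientNorm_sq (hτ : 0 ≤ τ) (hs : 0 ≤ s) (hv : AEMeasurable v μ) :
    valueNorm τ s v μ ^ 2 + gradientNorm τ s v μ ^ 2 =
      ENNReal.ofReal s * ∫⁻ y, ENNReal.ofReal (closedDensity τ s v y) ∂μ := by
  have hσ (y : E d) : 0 ≤ largeParam τ s h y := by unfold largeParam; positivity
  have h_meas : AEMeasurable (fun y => ENNReal.ofReal
      (s * (expWeight τ s h y ^ 2 * (largeParam τ s h y ^ 3 * v y ^ 2)))) μ :=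
    ((continuous_expWeight_h.measurable.pow_const 2).aemeasurable.mul
      ((continuous_largeParam_h.measurable.pow_const 3).aemeasurable.mul
        (hv.pow_const 2)) |>.const_mul s).ennreal_ofReal
  rw [valueNorm, gradientNorm, sq_ofReal_mul_eLpNorm_two (by positivity),
    sq_ofReal_mul_eLpNorm_two (by positivity),
    ← lintegral_const_mul' _ _ ENNReal.ofReal_ne_top]
  simp only [sq_mul_norm_weighted_value hτ, sq_mul_norm_weighted_gradient hτ]
  rw [← lintegral_add_left' h_meas]
  refine lintegral_congr fun y => ?_
  have hσy := hσ y
  rw [← ENNReal.ofReal_add (by positivity) (by positivity), ← ENNReal.ofReal_mul hs,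
    ← mul_add, ← mul_add, closedDensity, add_comm (largeParam τ s h y * _)]

end Norms

section SquaredEstimate

variable {d : ℕ} {N κ ε τ s Kb Kc C : ℝ} {a : Fin (d + 1) → Fin (d + 1) → E d → ℝ}
  {b : Fin (d + 1) → E d → ℝ} {c v : E d → ℝ}

theorem mul_integral_cutoff_mul_closedDensity_le (hs : 1 ≤ s) (hκ : 0 ≤ κ)
    (hsκ : 32 * N ^ 9 ≤ s * κ ^ 2) (hεκ : 112 * s * N ^ 10 * ε ≤ κ ^ 2)
    (hε₀ : 0 ≤ ε) (hε₁ : ε ≤ 1) (hKb : 0 ≤ Kb) (hKc : 0 ≤ Kc)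
    (ha : ∀ y ∈ halfBall d, IsAdmissibleSymbol N κ h (symmetrize a) y)
    (hσ : ∀ y ∈ halfBall d, 1 ≤ ε * largeParam τ s h y)
    (hbσ : ∀ y ∈ halfBall d, Kb ≤ ε * largeParam τ s h y)
    (hcσ : ∀ y ∈ halfBall d, Kc ≤ ε * largeParam τ s h y ^ 2)
    (hb : ∀ i, W1InftyNormLE (halfBall d) (b i) Kb) (hc : W1InftyNormLE (halfBall d) c Kc)
    (hv : ∀ y ∈ halfBall d, ContDiffAt ℝ 2 v y) {r : ℝ} (hr : 0 < r) :
    s * κ ^ 2 / (3 * N ^ 3) * ∫ y, cutoff r y * closedDensity τ s v y ≤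
      (∫ y, cutoff r y * (expWeight τ s h y * nondivOp (symmetrize a) b c v y) ^ 2) +
        36 * s * N ^ 11 * ∫ y, (∑ k, |pd k (cutoff r) y|) * closedDensity τ s v y := by
  have hsub := tsupport_cutoff_subset_halfBall (d := d) hr
  have h_density {χ : E d → ℝ} (hχ : ∀ y ∉ halfBall d, χ y = 0) :
      ∫ y, χ y * closedDensity τ s v y = ∫ y, χ y * carlemanDensity τ s h v y := by
    refine integral_congr_ae (.of_forall fun y => ?_)
    by_cases hy : y ∈ halfBall d
    · simp only [closedDensity_eq_carlemanDensity hy ((hv y hy).differentiableAt two_ne_zero)]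
    · simp only [hχ y hy, zero_mul]
  rw [h_density fun y hy => image_eq_zero_of_notMem_tsupport fun hy' => hy (hsub hy'),
    h_density fun y hy => by simp [pd_eq_zero_of_notMem_tsupport fun hy' => hy (hsub hy')]]
  exact mul_integral_carlemanDensity_le_of_w1Infty isOpen_halfBall hs hκ hsκ hεκ hε₀ hε₁ hKb hKc
    contDiff_cutoff cutoff_nonneg (hasCompactSupport_cutoff hr) hsub ha hσ hbσ hcσ hb hc hv

theorem lintegral_nondivOp_symmetrize_sq (hv : ∀ y ∈ halfBall d, ContDiffAt ℝ 2 v y) :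
    ∫⁻ y in halfBall d,
        ENNReal.ofReal ((expWeight τ s h y * nondivOp (symmetrize a) b c v y) ^ 2) =
      eLpNorm (fun y => Real.exp (τ * psi s y) * ellipticOp a b c v y) 2
        (volume.restrict (halfBall d)) ^ 2 := by
  rw [← one_mul (eLpNorm _ _ _), ← ENNReal.ofReal_one, sq_ofReal_mul_eLpNorm_two zero_le_one]
  refine setLIntegral_congr_fun isOpen_halfBall.measurableSet fun y hy => ?_
  simp only [one_mul, Real.norm_eq_abs, sq_abs, ellipticOp_eq_nondivOp_symmetrize hy (hv y hy)]
  rfl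

theorem carleman_squares (hs : 1 ≤ s) (hκ : 0 ≤ κ) (hN : 0 ≤ N) (hτ : 0 ≤ τ)
    (hsκ : 32 * N ^ 9 ≤ s * κ ^ 2) (hεκ : 112 * s * N ^ 10 * ε ≤ κ ^ 2)
    (hε₀ : 0 ≤ ε) (hε₁ : ε ≤ 1) (hKb : 0 ≤ Kb) (hKc : 0 ≤ Kc)
    (hC : ∀ t, ‖deriv Real.smoothTransition t‖ ≤ C)
    (ha : ∀ y ∈ halfBall d, IsAdmissibleSymbol N κ h (symmetrize a) y)
    (hσ : ∀ y ∈ halfBall d, 1 ≤ ε * largeParam τ s h y)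
    (hbσ : ∀ y ∈ halfBall d, Kb ≤ ε * largeParam τ s h y)
    (hcσ : ∀ y ∈ halfBall d, Kc ≤ ε * largeParam τ s h y ^ 2)
    (hb : ∀ i, W1InftyNormLE (halfBall d) (b i) Kb) (hc : W1InftyNormLE (halfBall d) c Kc)
    (hv : ContDiffOn ℝ 2 v (closedHalfBall d)) :
    ENNReal.ofReal (s * κ ^ 2 / (3 * N ^ 3)) *
        (valueNorm τ s v (volume.restrict (halfBall d)) ^ 2 +
          gradientNorm τ s v (volume.restrict (halfBall d)) ^ 2) ≤
      ENNReal.ofReal s * eLpNorm (fun y => Real.exp (τ * psi s y) * ellipticOp a b c v y) 2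
          (volume.restrict (halfBall d)) ^ 2 +
        ENNReal.ofReal (6 * (d + 1) * C * (36 * s * N ^ 11)) *
          (valueNorm τ s v (boundaryMeasure d) ^ 2 +
            gradientNorm τ s v (boundaryMeasure d) ^ 2) := by
  have hs₀ : 0 ≤ s := zero_le_one.trans hs
  have hv_at (y : E d) (hy : y ∈ halfBall d) : ContDiffAt ℝ 2 v y :=
    hv.contDiffAt (closedHalfBall_mem_nhds hy)
  have h_nonneg (y : E d) : 0 ≤ closedDensity τ s v y := by
    unfold closedDensity largeParam
    positivity
  have h_meas_halfBall : AEMeasurable v (volume.restrict (halfBall d)) :=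
    (hv.continuousOn.mono halfBall_subset_closedHalfBall).aemeasurable
      isOpen_halfBall.measurableSet
  have h_meas_boundary : AEMeasurable v ((boundaryMeasure d).restrict (closedHalfBall d)) :=
    hv.continuousOn.aemeasurable isClosed_closedHalfBall.measurableSet
  have h_lintegral := ofReal_mul_lintegral_halfBall_le (by positivity) (by positivity) hC
    (fun y => sq_nonneg _) (continuousOn_closedDensity hv) (fun y _ => h_nonneg y)
    fun r hr => mul_integral_cutoff_mul_closedDensity_le hs hκ hsκ hεκ hε₀ hε₁ hKb hKc ha hσ hbσ
      hcσ hb hc hv_at hr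
  rw [lintegral_nondivOp_symmetrize_sq hv_at] at h_lintegral
  rw [valueNorm_sq_add_gradientNorm_sq hτ hs₀ h_meas_halfBall, mul_left_comm]
  refine (mul_le_mul_right h_lintegral _).trans ?_
  rw [mul_add, mul_left_comm, ← valueNorm_sq_add_gradientNorm_sq hτ hs₀ h_meas_boundary]
  gcongr
  · exact valueNorm_mono_measure Measure.restrict_le_self
  · exact gradientNorm_mono_measure Measure.restrict_le_self

end SquaredEstimate

section Parameters

theorem ofReal_mul_le_of_ofReal_mul_sq_le {l R : ℝ} (hl : 0 ≤ l) (hR : 0 < R) {Z S : ℝ≥0∞}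
    (hle : ENNReal.ofReal l * Z ^ 2 ≤ ENNReal.ofReal R * S ^ 2) :
    ENNReal.ofReal √(l / R) * Z ≤ S := by
  have hR₀ : ENNReal.ofReal R ≠ 0 := (ENNReal.ofReal_pos.2 hR).ne'
  refine (ENNReal.pow_le_pow_left_iff two_ne_zero).1 ?_
  rw [mul_pow, ← ENNReal.ofReal_pow (Real.sqrt_nonneg _), Real.sq_sqrt (by positivity),
    ← ENNReal.mul_le_mul_iff_right hR₀ ENNReal.ofReal_ne_top, ← mul_assoc,
    ← ENNReal.ofReal_mul hR.le, mul_div_cancel₀ _ hR.ne']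
  exact hle

theorem exists_add_le_of_sq_add_sq_le {l p : ℝ} (hl : 0 < l) (hp : 0 < p) (q : ℝ) :
    ∃ C : ℝ, 0 < C ∧ ∀ Z₁ Z₂ X Y₁ Y₂ : ℝ≥0∞,
      ENNReal.ofReal l * (Z₁ ^ 2 + Z₂ ^ 2) ≤
        ENNReal.ofReal p * X ^ 2 + ENNReal.ofReal q * (Y₁ ^ 2 + Y₂ ^ 2) →
      ENNReal.ofReal C * (Z₁ + Z₂) ≤ X + Y₁ + Y₂ := by
  set R := max p q
  have hR : 0 < R := lt_max_of_lt_left hp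
  refine ⟨√(l / R) / 2, by positivity, fun Z₁ Z₂ X Y₁ Y₂ hle => ?_⟩
  have h_sq : X ^ 2 + (Y₁ ^ 2 + Y₂ ^ 2) ≤ (X + Y₁ + Y₂) ^ 2 :=
    calc X ^ 2 + (Y₁ ^ 2 + Y₂ ^ 2) ≤
          X ^ 2 + (Y₁ ^ 2 + Y₂ ^ 2) + 2 * (X * Y₁ + X * Y₂ + Y₁ * Y₂) := le_self_add
      _ = (X + Y₁ + Y₂) ^ 2 := by ring
  have h_sum : ENNReal.ofReal l * (Z₁ ^ 2 + Z₂ ^ 2) ≤ ENNReal.ofReal R * (X + Y₁ + Y₂) ^ 2 :=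
    calc _ ≤ ENNReal.ofReal R * X ^ 2 + ENNReal.ofReal R * (Y₁ ^ 2 + Y₂ ^ 2) := by
          refine hle.trans ?_
          gcongr
          exacts [le_max_left p q, le_max_right p q]
      _ ≤ ENNReal.ofReal R * (X + Y₁ + Y₂) ^ 2 := by rw [← mul_add]; gcongr
  have h_each (Z : ℝ≥0∞) (hZ : Z ^ 2 ≤ Z₁ ^ 2 + Z₂ ^ 2) :
      ENNReal.ofReal √(l / R) * Z ≤ X + Y₁ + Y₂ :=
    ofReal_mul_le_of_ofReal_mul_sq_le hl.le hR ((mul_le_mul_right hZ _).trans h_sum)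
  rw [ENNReal.ofReal_div_of_pos two_pos, ENNReal.ofReal_ofNat, ENNReal.mul_comm_div,
    mul_div_assoc', ENNReal.div_le_iff two_ne_zero (by simp), mul_two, mul_add]
  exact add_le_add (h_each Z₁ le_self_add) (h_each Z₂ le_add_self)

theorem exists_threshold {ε K δ : ℝ} (hε : 0 < ε) (hK : 0 ≤ K) (hδ : 0 < δ) :
    ∃ C : ℝ, 0 < C ∧ ∀ α lam t : ℝ, (δ ≤ |α| ∨ δ ≤ |lam|) → C * (|α| + √|lam|) < t →
      1 ≤ ε * t ∧ K * (|α| + 1) ≤ ε * t ∧ K * (α ^ 2 + |lam|) ≤ ε * t ^ 2 := by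
  set m := min δ √δ
  have hm : 0 < m := by positivity
  refine ⟨1 + (1 + K) * (1 + 1 / m) / ε, by positivity, fun α lam t hαl ht => ?_⟩
  set x := |α| + √|lam|
  have hmx : m ≤ x := by
    rcases hαl with hα | hlam
    · exact (min_le_left _ _).trans (hα.trans (le_add_of_nonneg_right (Real.sqrt_nonneg _)))
    · exact (min_le_right _ _).trans ((Real.sqrt_le_sqrt hlam).trans
        (le_add_of_nonneg_left (abs_nonneg _)))
  have hx : 0 < x := hm.trans_le hmx
  have h_one : 1 ≤ x / m := (one_le_div hm).2 hmx
  have hαx : |α| ≤ x := le_add_of_nonneg_right (Real.sqrt_nonneg _)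
  have h_sq : α ^ 2 + |lam| ≤ x ^ 2 := by
    rw [← sq_abs α, ← Real.sq_sqrt (abs_nonneg lam)]
    exact pow_add_pow_le (abs_nonneg _) (Real.sqrt_nonneg _) two_ne_zero
  have hxt : x ≤ t := by
    refine le_trans ?_ ht.le
    exact le_mul_of_one_le_left hx.le (le_add_of_nonneg_right (by positivity))
  have hεt : (1 + K) * (x + x / m) ≤ ε * t :=
    calc (1 + K) * (x + x / m) = ε * ((1 + K) * (1 + 1 / m) / ε * x) := by field_simp
      _ ≤ ε * ((1 + (1 + K) * (1 + 1 / m) / ε) * x) := by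
          gcongr
          exact le_add_of_nonneg_left zero_le_one
      _ ≤ ε * t := by gcongr
  have hKx : K * x ≤ ε * t := by nlinarith
  refine ⟨by nlinarith, by nlinarith, ?_⟩
  calc K * (α ^ 2 + |lam|) ≤ K * x * x := by rw [mul_assoc, ← sq]; gcongr
    _ ≤ ε * t * t := mul_le_mul hKx hxt hx.le ((by positivity : 0 ≤ K * x).trans hKx)
    _ = ε * t ^ 2 := by ring

end Parameters

end HalfBallCarleman

end

open HalfBallCarleman in
theorem proposition4_general (d : ℕ) (θ M : ℝ) (hθ : 0 < θ) :
    ∃ s₀ : ℝ, 0 < s₀ ∧ ∀ s : ℝ, s₀ ≤ s → ∀ K δ : ℝ, 0 < K → 0 < δ →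
      ∃ Cs C₀ : ℝ, 0 < Cs ∧ 0 < C₀ ∧
        ∀ (a : Fin (d + 1) → Fin (d + 1) → E d → ℝ) (b : Fin (d + 1) → E d → ℝ) (c : E d → ℝ)
          (α lam : ℝ),
          C1NormLE (halfBall d) a M → UniformlyElliptic (halfBall d) a θ →
          (∀ i, W1InftyNormLE (halfBall d) (b i) (K * (|α| + 1))) →
          W1InftyNormLE (halfBall d) c (K * (α ^ 2 + |lam|)) →
          (δ ≤ |α| ∨ δ ≤ |lam|) →
          ∀ v : E d → ℝ, ContDiffOn ℝ 2 v (closedHalfBall d) →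
          ∀ τ : ℝ, Cs * (|α| + √|lam|) < τ →
            ENNReal.ofReal (C₀ * τ ^ (3 / 2 : ℝ) * s ^ 2) *
                eLpNorm (fun y => psi s y ^ (3 / 2 : ℝ) * Real.exp (τ * psi s y) * v y) 2
                  (volume.restrict (halfBall d)) +
              ENNReal.ofReal (C₀ * τ ^ (1 / 2 : ℝ) * s) *
                eLpNorm (fun y => (psi s y ^ (1 / 2 : ℝ) * Real.exp (τ * psi s y)) •
                    gradientWithin v (closedHalfBall d) y) 2
                  (volume.restrict (halfBall d)) ≤
            eLpNorm (fun y => Real.exp (τ * psi s y) * ellipticOp a b c v y) 2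
                (volume.restrict (halfBall d)) +
              ENNReal.ofReal (τ ^ (3 / 2 : ℝ) * s ^ 2) *
                eLpNorm (fun y => psi s y ^ (3 / 2 : ℝ) * Real.exp (τ * psi s y) * v y) 2
                  (boundaryMeasure d) +
              ENNReal.ofReal (τ ^ (1 / 2 : ℝ) * s) *
                eLpNorm (fun y => (psi s y ^ (1 / 2 : ℝ) * Real.exp (τ * psi s y)) •
                    gradientWithin v (closedHalfBall d) y) 2
                  (boundaryMeasure d) := by
  obtain ⟨L, hL⟩ := exists_norm_deriv_smoothTransition_le
  set N := max (d + 1 : ℝ) M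
  set κ := θ / 4
  have hN : 0 < N := lt_max_of_lt_left (by positivity)
  have hκ : 0 < κ := by positivity
  refine ⟨max 1 (32 * N ^ 9 / κ ^ 2), by positivity, fun s hs K δ hK hδ => ?_⟩
  obtain ⟨hs₁, hsκ⟩ := max_le_iff.1 hs
  have hs₀ : 0 < s := zero_lt_one.trans_le hs₁
  set ε := min 1 (κ ^ 2 / (112 * s * N ^ 10))
  have hεκ : 112 * s * N ^ 10 * ε ≤ κ ^ 2 :=
    (le_div_iff₀' (by positivity)).1 (min_le_right _ _)
  obtain ⟨C, hC, h_threshold⟩ := exists_threshold (by positivity : 0 < ε) hK.le hδ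
  obtain ⟨C₀, hC₀, h_sqrt⟩ := exists_add_le_of_sq_add_sq_le
    (by positivity : 0 < s * κ ^ 2 / (3 * N ^ 3)) hs₀ (6 * (d + 1) * L * (36 * s * N ^ 11))
  refine ⟨C / (s * Real.exp (-s)), C₀, by positivity, hC₀, ?_⟩
  intro a b c α lam ha hell hb hc hαlam v hv τ hτ
  have hτ₀ : 0 ≤ τ := le_trans (by positivity) hτ.le
  obtain ⟨hε_one, hε_b, hε_c⟩ := h_threshold α lam (τ * (s * Real.exp (-s))) hαlam (by
    rwa [div_mul_eq_mul_div, div_lt_iff₀ (by positivity)] at hτ)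
  have hσ (y : E d) (hy : y ∈ halfBall d) := mul_exp_neg_le_largeParam hτ₀ hs₀.le hy
  have h_squares := carleman_squares hs₁ hκ.le hN.le hτ₀ ((div_le_iff₀ (by positivity)).1 hsκ) hεκ
    (by positivity) (min_le_left _ _) (by positivity) (by positivity) hL
    (fun y hy => isAdmissibleSymbol_symmetrize hθ.le ha hell hy)
    (fun y hy => hε_one.trans (by gcongr; exact hσ y hy))
    (fun y hy => hε_b.trans (by gcongr; exact hσ y hy))
    (fun y hy => hε_c.trans (by gcongr; exact hσ y hy)) hb hc hv
  simpa only [valueNorm, gradientNorm, mul_add, mul_assoc, ENNReal.ofReal_mul hC₀.le] using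
    h_sqrt _ _ _ _ _ h_squares

open HalfBallCarleman in
theorem proposition4 (d : ℕ) (θ M : ℝ) (hθ : 0 < θ) (hM : 0 < M) :
    ∃ s₀ : ℝ, 0 < s₀ ∧ ∀ s : ℝ, s₀ ≤ s → ∀ K δ : ℝ, 0 < K → 0 < δ →
      ∃ Cs C₀ : ℝ, 0 < Cs ∧ 0 < C₀ ∧
        ∀ (a : Fin (d + 1) → Fin (d + 1) → E d → ℝ) (b : Fin (d + 1) → E d → ℝ) (c : E d → ℝ)
          (α lam : ℝ),
          C1NormLE (halfBall d) a M → UniformlyElliptic (halfBall d) a θ →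
          (∀ i, W1InftyNormLE (halfBall d) (b i) (K * (|α| + 1))) →
          W1InftyNormLE (halfBall d) c (K * (α ^ 2 + |lam|)) →
          (δ ≤ |α| ∨ δ ≤ |lam|) →
          ∀ v : E d → ℝ, ContDiffOn ℝ ∞ v (closedHalfBall d) →
          ∀ τ : ℝ, Cs * (|α| + √|lam|) < τ →
            ENNReal.ofReal (C₀ * τ ^ (3 / 2 : ℝ) * s ^ 2) *
                eLpNorm (fun y => psi s y ^ (3 / 2 : ℝ) * Real.exp (τ * psi s y) * v y) 2
                  (volume.restrict (halfBall d)) +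
              ENNReal.ofReal (C₀ * τ ^ (1 / 2 : ℝ) * s) *
                eLpNorm (fun y => (psi s y ^ (1 / 2 : ℝ) * Real.exp (τ * psi s y)) •
                    gradientWithin v (closedHalfBall d) y) 2
                  (volume.restrict (halfBall d)) ≤
            eLpNorm (fun y => Real.exp (τ * psi s y) * ellipticOp a b c v y) 2
                (volume.restrict (halfBall d)) +
              ENNReal.ofReal (τ ^ (3 / 2 : ℝ) * s ^ 2) *
                eLpNorm (fun y => psi s y ^ (3 / 2 : ℝ) * Real.exp (τ * psi s y) * v y) 2
                  (boundaryMeasure d) +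
              ENNReal.ofReal (τ ^ (1 / 2 : ℝ) * s) *
                eLpNorm (fun y => (psi s y ^ (1 / 2 : ℝ) * Real.exp (τ * psi s y)) •
                    gradientWithin v (closedHalfBall d) y) 2
                  (boundaryMeasure d) := by
  obtain ⟨s₀, hs₀, h_carleman⟩ := proposition4_general d θ M hθ
  refine ⟨s₀, hs₀, fun s hs K δ hK hδ => ?_⟩
  obtain ⟨Cs, C₀, hCs, hC₀, h_estimate⟩ := h_carleman s hs K δ hK hδ
  exact ⟨Cs, C₀, hCs, hC₀, fun a b c α lam ha hell hb hc hαlam v hv =>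
    h_estimate a b c α lam ha hell hb hc hαlam v (hv.of_le ENat.LEInfty.out)⟩
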